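/- **Setting.** For $m\in[0,1)$ let $K(m)=\int_0^{\pi/2}\frac{d\theta}{\sqrt{1-m\sin^2\theta}}$ and $E(m)=\int_0^{\pi/2}\sqrt{1-m\sin^2\theta}\,d\theta$. The density of states (DOS) and the tracer velocity of the KdV soliton condensates of genus $0$ and $1$ are the following functions on the spectral support $\Gamma^+$; the DOS is extended by $0$ outside $\Gamma^+$. * Genus $0$, $\lambda_1\ge 0$: $\Gamma^+=[0,\lambda_1]$, $u^{(0)}(\eta;\lambda_1)=\dfrac{\eta}{\pi\sqrt{\lambda_1^2-\eta^2}}$, $s^{(0)}(\eta;\lambda_1)=6(2\eta^2-\lambda_1^2)$. * Genus $1$, $0\le\lambda_1<\lambda_2<\lambda_3$: $\Gamma^+=[0,\lambda_1]\cup[\lambda_2,\lambda_3]$, $$u^{(1)}(\eta;\lambda_1,\lambda_2,\lambda_3)=\frac{i\eta(\eta^2-w^2)}{\pi R(\eta)},\qquad s^{(1)}(\eta;\lambda_1,\lambda_2,\lambda_3)=12\,\frac{\eta^4-h^2\eta^2-r^2}{\eta^2-w^2},$$ where $R(\eta)=\sqrt{(\eta^2-\lambda_1^2)(\eta^2-\lambda_2^2)(\eta^2-\lambda_3^2)}$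 is taken on the upper shore of the cuts, with $R(\eta)\sim\eta^3$ at infinity, and $$w^2=\lambda_3^2-(\lambda_3^2-\lambda_1^2)\mu,\quad h^2=\tfrac12(\lambda_1^2+\lambda_2^2+\lambda_3^2),\quad \mu=\frac{E(m)}{K(m)},\quad m=\frac{\lambda_2^2-\lambda_1^2}{\lambda_3^2-\lambda_1^2},$$ $$r^2=\tfrac16\big[\lambda_3^2(\lambda_3^2-\lambda_2^2-\lambda_1^2)-2\lambda_1^2\lambda_2^2-(\lambda_1^2+\lambda_2^2+\lambda_3^2)(\lambda_3^2-\lambda_1^2)\mu\big].$$ The Whitham velocities are $V_j(\lambda_1,\lambda_2,\lambda_3)=s^{(1)}(\lambda_j;\lambda_1,\lambda_2,\lambda_3)$. A modulated condensate (a condensate of genus $0$ or $1$ for each $x\in\mathbb R$, $t>0$), with DOS $u(\eta;x,t)$, velocity $s(\eta;x,t)$ and support $\Gamma^+(x,t)$, *solves the Riemann problem* with condensate states $L$ (for $x<0$) and $R$ (for $x>0$) and with edge speeds $s_\pm$ if $s_-<s_+$ and: 1. as $t\to0^+$, $u(\eta;x,t)$ tends to the DOS of $L$ for every $x<0$ and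 to the DOS of $R$ for every $x>0$ (for every $\eta$); 2. at every $(x,t)$ with $t>0$ we have $u\ge0$, and for $\eta\in\Gamma^+$ the dispersion relations of a condensate $$\int_{\Gamma^+}\ln\Big|\frac{\mu+\eta}{\mu-\eta}\Big|u(\mu)\,d\mu=\eta,\qquad \int_{\Gamma^+}\ln\Big|\frac{\mu+\eta}{\mu-\eta}\Big|u(\mu)s(\mu)\,d\mu=4\eta^3$$ and, if $\eta>0$, the equation of state $s(\eta)=4\eta^2+\frac1\eta\int_{\Gamma^+}\ln\big|\frac{\mu+\eta}{\mu-\eta}\big|u(\mu)[s(\eta)-s(\mu)]\,d\mu$ hold, with absolutely convergent integrals; 3. $u_t+(us)_x=0$ holds classically at every $(x,t)$, $t>0$, $x\ne s_\pm t$, for $\eta$ in the interior of $\Gamma^+(x,t)$; and, for every $\eta>0$ that is not a band edge of $L$ or of $R$, $u$ and $us$ are locally integrable in $(x,t)$ up to $t=0$ and the equation holds in the sense of distributions on $t>0$ with the step initial data given by $L$ and $R$; 4. for every $t>0$ and every $\eta>0$ that is not a band edge of $L$ or of $R$, $u(\eta;x,t)$ tends to the DOS of $L$ as $x\to s_-t$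 and to the DOS of $R$ as $x\to s_+t$. **Claim.** For $0\le\lambda_1<\lambda_2<\lambda_3$, $$V_1=2(\lambda_1^2+\lambda_2^2+\lambda_3^2)+\tfrac{4(\lambda_2^2-\lambda_1^2)}{\mu-1},\quad V_2=2(\lambda_1^2+\lambda_2^2+\lambda_3^2)+\tfrac{4(\lambda_3^2-\lambda_2^2)(\lambda_2^2-\lambda_1^2)}{\lambda_3^2-\lambda_2^2-(\lambda_3^2-\lambda_1^2)\mu},\quad V_3=2(\lambda_1^2+\lambda_2^2+\lambda_3^2)+\tfrac{4(\lambda_3^2-\lambda_2^2)}{\mu}.$$ *Rarefaction wave.* Let $0\le q_-<q_+$, $s_\pm=6q_\pm^2$, and let $\lambda_1(x,t)=q_-$ for $x\le s_-t$, $\lambda_1(x,t)=\sqrt{x/6t}$ for $s_-t<x<s_+t$, $\lambda_1(x,t)=q_+$ for $x\ge s_+t$. Then $\lambda_1$ is continuous in $x$ for each $t>0$, satisfies $(\lambda_1)_t+6\lambda_1^2(\lambda_1)_x=0$ for $t>0$, $x\ne s_\pm t$, and the genus $0$ condensate with edge $\lambda_1(x,t)$ solves the Riemann problem with left state $u^{(0)}(\cdot;q_-)$,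 right state $u^{(0)}(\cdot;q_+)$ and edge speeds $s_\pm$. *Genus $1$ waves.* In each of the following cases let one of the edges, $\lambda_j$, vary in the open interval $I=(\mathrm{lo},\mathrm{hi})$ while the other two are fixed as indicated. | wave | left state $L$ | right state $R$ | edges in the wave | $I$ | $s_-$ | $s_+$ | |---|---|---|---|---|---|---| | DSW ($0\le q_+<q_-$), $j=2$ | $u^{(0)}(q_-)$ | $u^{(0)}(q_+)$ | $(q_+,\lambda_2,q_-)$ | $(q_+,q_-)$ | $12q_+^2-6q_-^2$ | $2q_+^2+4q_-^2$ | | $3^+$ ($0\le q_-<\lambda_2^+<\lambda_3^+$), $j=3$ | $u^{(0)}(q_-)$ | $u^{(1)}(q_-,\lambda_2^+,\lambda_3^+)$ | $(q_-,\lambda_2^+,\lambda_3)$ | $(\lambda_2^+,\lambda_3^+)$ | $2q_-^2+4(\lambda_2^+)^2$ | $V_3(q_-,\lambda_2^+,\lambda_3^+)$ | | $2^+$ ($0\le\lambda_1^+<\lambda_2^+<q_-$), $j=2$ | $u^{(0)}(q_-)$ | $u^{(1)}(\lambda_1^+,\lambda_2^+,q_-)$ | $(\lambda_1^+,\lambda_2,q_-)$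 | $(\lambda_1^+,\lambda_2^+)$ | $12(\lambda_1^+)^2-6q_-^2$ | $V_2(\lambda_1^+,\lambda_2^+,q_-)$ | | $1^-$ ($0\le\lambda_1^-<\lambda_2^-<q_+$), $j=1$ | $u^{(1)}(\lambda_1^-,\lambda_2^-,q_+)$ | $u^{(0)}(q_+)$ | $(\lambda_1,\lambda_2^-,q_+)$ | $(\lambda_1^-,\lambda_2^-)$ | $V_1(\lambda_1^-,\lambda_2^-,q_+)$ | $12(\lambda_2^-)^2-6q_+^2$ | | $2^-$ ($0\le q_+<\lambda_2^-<\lambda_3^-$), $j=2$ | $u^{(1)}(q_+,\lambda_2^-,\lambda_3^-)$ | $u^{(0)}(q_+)$ | $(q_+,\lambda_2,\lambda_3^-)$ | $(\lambda_2^-,\lambda_3^-)$ | $V_2(q_+,\lambda_2^-,\lambda_3^-)$ | $2q_+^2+4(\lambda_3^-)^2$ | In each case $s_-$ and $s_+$ are the limits of $V_j$ as $\lambda_j\to\mathrm{lo}^+$ and $\lambda_j\to\mathrm{hi}^-$. For each $\xi\in(s_-,s_+)$ the equation $V_j(\lambda_1,\lambda_2,\lambda_3)=\xi$ has a unique solution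 $\lambda_j=\lambda_j(\xi)\in I$; this solution is continuous in $\xi$, tends to $\mathrm{lo}$ as $\xi\to s_-^+$ and to $\mathrm{hi}$ as $\xi\to s_+^-$. With $\lambda_j=\lambda_j(x/t)$ the three edges satisfy the Whitham equations $(\lambda_k)_t+V_k(\lambda_1,\lambda_2,\lambda_3)(\lambda_k)_x=0$, $k=1,2,3$, for $t>0$, $s_-t<x<s_+t$. The modulated condensate that equals $L$ for $x\le s_-t$, the genus $1$ condensate with these edges for $s_-t<x<s_+t$, and $R$ for $x\ge s_+t$, solves the Riemann problem with states $L,R$ and edge speeds $s_\pm$ (in particular $s_-<s_+$). -/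

import Mathlib

open Set Filter Topology MeasureTheory

noncomputable section

/-- Complete elliptic integral of the first kind, as a function of the parameter `m = k²`. -/
def ellipticK (m : ℝ) : ℝ :=
  ∫ θ in (0 : ℝ)..(Real.pi / 2), 1 / Real.sqrt (1 - m * Real.sin θ ^ 2)

/-- Complete elliptic integral of the second kind, as a function of the parameter `m = k²`. -/
def ellipticE (m : ℝ) : ℝ :=
  ∫ θ in (0 : ℝ)..(Real.pi / 2), Real.sqrt (1 - m * Real.sin θ ^ 2)

/-- The ratio `μ(m) = E(m) / K(m)`, at `m = (b² - a²) / (c² - a²)`. -/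
def muRatio (a b c : ℝ) : ℝ :=
  ellipticE ((b ^ 2 - a ^ 2) / (c ^ 2 - a ^ 2)) / ellipticK ((b ^ 2 - a ^ 2) / (c ^ 2 - a ^ 2))

/-- The constant `w²` of the genus 1 condensate with band edges `a, b, c`. -/
def wSq (a b c : ℝ) : ℝ := c ^ 2 - (c ^ 2 - a ^ 2) * muRatio a b c

/-- The constant `h²` of the genus 1 condensate with band edges `a, b, c`. -/
def hSq (a b c : ℝ) : ℝ := (a ^ 2 + b ^ 2 + c ^ 2) / 2

/-- The constant `r²` of the genus 1 condensate with band edges `a, b, c`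
(a traditional symbol: the number may be negative). -/
def rSq (a b c : ℝ) : ℝ :=
  (c ^ 2 * (c ^ 2 - b ^ 2 - a ^ 2) - 2 * b ^ 2 * a ^ 2
    - (c ^ 2 + b ^ 2 + a ^ 2) * (c ^ 2 - a ^ 2) * muRatio a b c) / 6

/-- The data `{N; (λ₁, …, λ_{2N+1})}` of a condensate of genus `N = 0` or `N = 1`. -/
inductive Condensate : Type
  | genus0 (a : ℝ) : Condensate
  | genus1 (a b c : ℝ) : Condensate

namespace Condensate

/-- The spectral support `Γ⁺`: `[0, λ₁]` in genus 0, `[0, λ₁] ∪ [λ₂, λ₃]` in genus 1. -/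
def support : Condensate → Set ℝ
  | genus0 a => Icc 0 a
  | genus1 a b c => Icc 0 a ∪ Icc b c

/-- The set of the band edges `λ_j`. -/
def edges : Condensate → Set ℝ
  | genus0 a => {a}
  | genus1 a b c => {a, b, c}

/-- The band edges are in their proper order. -/
def Ordered : Condensate → Prop
  | genus0 a => 0 ≤ a
  | genus1 a b c => 0 ≤ a ∧ a < b ∧ b < c

/-- The density of states `u(η)`, extended by zero outside `Γ⁺`.

In genus 1 it is `i η (η² - w²) / (π R(η))` with `R² = (η² - a²)(η² - b²)(η² - c²)`, where `R` is
taken on the upper shore of the cuts and `R(η) ~ η³` at infinity. Hence `R = i √|R²|` on `[b, c]` and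
`R = -i √|R²|` on `[0, a]`, and `|R²| = (η² - a²)(η² - b²)(c² - η²)` on both bands. -/
def dos : Condensate → ℝ → ℝ
  | genus0 a => (Icc 0 a).indicator fun η => η / (Real.pi * Real.sqrt (a ^ 2 - η ^ 2))
  | genus1 a b c => (Icc 0 a ∪ Icc b c).indicator fun η =>
      (if η ≤ a then -1 else 1) * (η * (η ^ 2 - wSq a b c)) /
        (Real.pi * Real.sqrt ((η ^ 2 - a ^ 2) * (η ^ 2 - b ^ 2) * (c ^ 2 - η ^ 2)))

/-- The tracer (transport) velocity `s(η)`, meaningful for `η ∈ Γ⁺`. -/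
def velocity : Condensate → ℝ → ℝ
  | genus0 a => fun η => 6 * (2 * η ^ 2 - a ^ 2)
  | genus1 a b c => fun η =>
      12 * (η ^ 4 - hSq a b c * η ^ 2 - rSq a b c) / (η ^ 2 - wSq a b c)

/-- The spectral flux density `v = u s`. -/
def flux (C : Condensate) (η : ℝ) : ℝ := C.dos η * C.velocity η

/-- `∫_{Γ⁺} log |(μ + η) / (μ - η)| f(μ) dμ` converges absolutely and equals `A`. -/
def HasLogIntegral (C : Condensate) (η : ℝ) (f : ℝ → ℝ) (A : ℝ) : Prop :=
  IntegrableOn (fun μ => Real.log |(μ + η) / (μ - η)| * f μ) C.support ∧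
    ∫ μ in C.support, Real.log |(μ + η) / (μ - η)| * f μ = A

/-- `C` is an equilibrium soliton condensate: the density of states is nonnegative, the nonlinear
dispersion relations with spectral scaling function `σ = 0` hold on `Γ⁺`, and so does the equation
of state `s(η) = 4η² + (1/η) ∫_{Γ⁺} log |(μ + η)/(μ - η)| u(μ) (s(η) - s(μ)) dμ`. -/
structure IsEquilibrium (C : Condensate) : Prop where
  ordered : C.Ordered
  dos_nonneg : ∀ η, 0 ≤ C.dos η
  dispersion_u : ∀ η ∈ C.support, C.HasLogIntegral η C.dos η
  dispersion_v : ∀ η ∈ C.support, C.HasLogIntegral η C.flux (4 * η ^ 3)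
  state : ∀ η ∈ C.support, 0 < η → ∃ A : ℝ,
    C.HasLogIntegral η (fun μ => C.dos μ * (C.velocity η - C.velocity μ)) A ∧
      C.velocity η = 4 * η ^ 2 + 1 / η * A

end Condensate

/-- Whitham characteristic velocity `V₁(λ₁, λ₂, λ₃) = s(λ₁; λ₁, λ₂, λ₃)` in genus 1. -/
def whithamV1 (a b c : ℝ) : ℝ := (Condensate.genus1 a b c).velocity a

/-- Whitham characteristic velocity `V₂(λ₁, λ₂, λ₃) = s(λ₂; λ₁, λ₂, λ₃)` in genus 1. -/
def whithamV2 (a b c : ℝ) : ℝ := (Condensate.genus1 a b c).velocity b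

/-- Whitham characteristic velocity `V₃(λ₁, λ₂, λ₃) = s(λ₃; λ₁, λ₂, λ₃)` in genus 1. -/
def whithamV3 (a b c : ℝ) : ℝ := (Condensate.genus1 a b c).velocity c

/-- `∂ₜ g + ∂ₓ f = 0` holds classically at `(x, t)`. -/
def BalanceAt (g f : ℝ → ℝ → ℝ) (x t : ℝ) : Prop :=
  ∃ gt fx : ℝ, HasDerivAt (fun τ => g x τ) gt t ∧ HasDerivAt (fun y => f y t) fx x ∧ gt + fx = 0

/-- `∂ₜ l + V ∂ₓ l = 0` holds classically at `(x, t)`; `V` is the velocity at that point. -/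
def TransportAt (l : ℝ → ℝ → ℝ) (V : ℝ) (x t : ℝ) : Prop :=
  ∃ lt lx : ℝ, HasDerivAt (fun τ => l x τ) lt t ∧ HasDerivAt (fun y => l y t) lx x ∧
    lt + V * lx = 0

/-- The genus 1 Whitham modulation system at `(x, t)`. -/
def Whitham1At (a b c : ℝ → ℝ → ℝ) (x t : ℝ) : Prop :=
  TransportAt a (whithamV1 (a x t) (b x t) (c x t)) x t ∧
  TransportAt b (whithamV2 (a x t) (b x t) (c x t)) x t ∧
  TransportAt c (whithamV3 (a x t) (b x t) (c x t)) x t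

/-- `g` is a distributional solution of `∂ₜ g + ∂ₓ f = 0` for `t > 0` with initial values `g₀`:
`g` and `f` are locally integrable up to `t = 0`, and the equation, with the initial values, is
satisfied after integration against smooth compactly supported test functions `φ(x, t)`. -/
def IsWeakSolution (g f : ℝ → ℝ → ℝ) (g₀ : ℝ → ℝ) : Prop :=
  (∀ K : Set (ℝ × ℝ), IsCompact K →
    IntegrableOn (fun p : ℝ × ℝ => g p.1 p.2) (K ∩ {p | 0 < p.2}) ∧
    IntegrableOn (fun p : ℝ × ℝ => f p.1 p.2) (K ∩ {p | 0 < p.2})) ∧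
  ∀ φ : ℝ × ℝ → ℝ, ContDiff ℝ ((⊤ : ℕ∞) : WithTop ℕ∞) φ → HasCompactSupport φ →
    (∫ p in {p : ℝ × ℝ | 0 < p.2},
        (g p.1 p.2 * fderiv ℝ φ p (0, 1) + f p.1 p.2 * fderiv ℝ φ p (1, 0)))
      + ∫ x : ℝ, g₀ x * φ (x, 0) = 0

/-- The constant states `L` and `R` connected by the self-similar state `M (x/t)` in the sector
`sL t < x < sR t`. -/
def centeredWave (L : Condensate) (M : ℝ → Condensate) (R : Condensate) (sL sR : ℝ)
    (x t : ℝ) : Condensate :=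
  if x ≤ sL * t then L else if x < sR * t then M (x / t) else R

/-- The modulated condensate `C` solves, for `t > 0`, the Riemann problem for the spectral kinetic
equation with the state `L` on `x < 0` and the state `R` on `x > 0`, with wave edges `x = sL t` and
`x = sR t`. -/
structure SolvesRiemannProblem (L R : Condensate) (sL sR : ℝ) (C : ℝ → ℝ → Condensate) : Prop where
  /-- the edges are properly ordered -/
  speed_lt : sL < sR
  /-- the initial density of states is attained on the left -/
  initial_left : ∀ x < 0, ∀ η, Tendsto (fun t => (C x t).dos η) (𝓝[>] 0) (𝓝 (L.dos η))
  /-- the initial density of states is attained on the right -/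
  initial_right : ∀ x > 0, ∀ η, Tendsto (fun t => (C x t).dos η) (𝓝[>] 0) (𝓝 (R.dos η))
  /-- the equation of state, and the condensate property, at every point -/
  equilibrium : ∀ x t, 0 < t → (C x t).IsEquilibrium
  /-- the continuity equation, classically, for every `η` in the interior of `Γ⁺(x, t)` -/
  continuity_eq : ∀ x t, 0 < t → x ≠ sL * t → x ≠ sR * t → ∀ η ∈ interior (C x t).support,
    BalanceAt (fun y τ => (C y τ).dos η) (fun y τ => (C y τ).flux η) x t
  /-- the continuity equation, in the sense of distributions on the whole half plane; `u` is
  infinite along a whole sector when `η` is a band edge of a constant state -/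
  weak_eq : ∀ η, 0 < η → η ∉ L.edges ∪ R.edges →
    IsWeakSolution (fun x t => (C x t).dos η) (fun x t => (C x t).flux η)
      (fun x => if x < 0 then L.dos η else R.dos η)
  /-- matching with the state on the left -/
  match_left : ∀ t, 0 < t → ∀ η, 0 < η → η ∉ L.edges ∪ R.edges →
    Tendsto (fun x => (C x t).dos η) (𝓝 (sL * t)) (𝓝 (L.dos η))
  /-- matching with the state on the right -/
  match_right : ∀ t, 0 < t → ∀ η, 0 < η → η ∉ L.edges ∪ R.edges →
    Tendsto (fun x => (C x t).dos η) (𝓝 (sR * t)) (𝓝 (R.dos η))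

/-- On `(sL, sR)` the profile `ℓ` is the solution of `V (ℓ ξ) = ξ` in `(lo, hi)`, which is unique;
`sL` and `sR` are the values of `V` at the ends `lo` and `hi` (as limits), and `ℓ` runs
from `lo` to `hi`. -/
structure IsWaveProfile (V : ℝ → ℝ) (lo hi sL sR : ℝ) (ℓ : ℝ → ℝ) : Prop where
  speed_left : Tendsto V (𝓝[>] lo) (𝓝 sL)
  speed_right : Tendsto V (𝓝[<] hi) (𝓝 sR)
  mem : ∀ ξ ∈ Ioo sL sR, ℓ ξ ∈ Ioo lo hi
  eq : ∀ ξ ∈ Ioo sL sR, V (ℓ ξ) = ξ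
  unique : ∀ ξ ∈ Ioo sL sR, ∀ y ∈ Ioo lo hi, V y = ξ → y = ℓ ξ
  continuousOn : ContinuousOn ℓ (Ioo sL sR)
  edge_left : Tendsto ℓ (𝓝[>] sL) (𝓝 lo)
  edge_right : Tendsto ℓ (𝓝[<] sR) (𝓝 hi)

/-- The centered rarefaction wave `λ₁(x, t)` of the Hopf equation. -/
def rarefaction (qm qp x t : ℝ) : ℝ :=
  if x ≤ 6 * qm ^ 2 * t then qm
  else if x < 6 * qp ^ 2 * t then Real.sqrt (x / (6 * t))
  else qp

end

/-! Write A < B < C for the squared band edges and W = w². In genus 1 the density and the flux are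
algebraic in η, A, B, C and W, so W is the only transcendental ingredient. It is fixed by a
vanishing gap period: ∫ (M − W)/√((M − A)(B − M)(C − M)) dM = 0 over (A, B).

Monotonicity of the speeds. The derivatives of E and K give a Riccati equation for E/K, hence ∂W/∂Y
= 1/2 − (W − Y)²/(2(Y − X₁)(Y − X₂)) for each squared edge Y, the other two being X₁, X₂. The
Whitham velocity of Y is 2(Y + X₁ + X₂) + 4(Y − X₁)(Y − X₂)/(Y − W). The inequalities (A + B)/2 ≤ W
< B, which come from elementary bounds on E and K, make this velocity strictly increasing in its own
edge. Quantitative forms of the same bounds give the limits when a gap closes or a band collapses.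
So the moving edge is recovered from x/t by inverting a monotone function (`exists_isWaveProfile`).

Equilibrium. With M = μ² and H = η², the logarithmic kernel is the integral over T of 1/(√(M − T)
√(H − T)), for 0 < T < min(M, H). After exchanging the integrals, the inner integral over the bands
above T is evaluated by `two_band_identity`, with T as a fourth branch point: it is an affine
function of T plus an integral over part of the gap. The affine part gives η or 4η³. The gap part
disappears after the Abel integration in T, because ∫ dT/√((T − M)(H − T)) over (M, H) equals π for
every M, so that only a multiple of the vanishing gap period is left (`gapDensity_abel`). The
equation of state is a linear combination of the two dispersion relations.

Classical kinetic equation. Each edge Y satisfies ∂(us)/∂Y = V ∂u/∂Y with V its own Whitham velocity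
(`flux_slope_eq`). If only one edge moves and V = x/t along the wave, then u and us are functions G,
F of ξ = x/t with F′ = ξG′, which is the continuity equation for self-similar functions.

Weak kinetic equation. The density becomes infinite on the ray where the moving edge passes through
η. The profile P = F − ξG stays continuous there, since us − Vu has an extra factor η² − Y that
turns 1/√ into √. Off a finite set P′ = −G, so Q = −t P(x/t) is a potential with Q_x = u and Q_t =
−us. Integration by parts on lines against the test function gives the weak equation with its
initial data (`isWeakSolution_selfSimilar`). The structure `IsSimpleWave` collects what this
argument needs, and all six waves are instances of it. -/

noncomputable section

/-! ### Complete elliptic integrals -/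

/-- The Legendre modulus function `√(1 - m sin² θ)`. -/
def legendreDelta (m θ : ℝ) : ℝ := Real.sqrt (1 - m * Real.sin θ ^ 2)

theorem one_sub_le_legendre {m : ℝ} (h0 : 0 ≤ m) (θ : ℝ) : 1 - m ≤ 1 - m * Real.sin θ ^ 2 := by
  have := Real.sin_sq_le_one θ
  nlinarith

theorem legendreDelta_sq {m : ℝ} (h0 : 0 ≤ m) (h1 : m < 1) (θ : ℝ) :
    legendreDelta m θ ^ 2 = 1 - m * Real.sin θ ^ 2 :=
  Real.sq_sqrt (by linarith [one_sub_le_legendre h0 θ])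

theorem legendreDelta_pos {m : ℝ} (h0 : 0 ≤ m) (h1 : m < 1) (θ : ℝ) : 0 < legendreDelta m θ :=
  Real.sqrt_pos.2 (by linarith [one_sub_le_legendre h0 θ])

theorem sqrt_one_sub_le_legendreDelta {m : ℝ} (h0 : 0 ≤ m) (θ : ℝ) :
    Real.sqrt (1 - m) ≤ legendreDelta m θ :=
  Real.sqrt_le_sqrt (one_sub_le_legendre h0 θ)

theorem legendreDelta_le_one {m : ℝ} (h0 : 0 ≤ m) (θ : ℝ) : legendreDelta m θ ≤ 1 := by
  refine Real.sqrt_le_iff.2 ⟨zero_le_one, ?_⟩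
  nlinarith [sq_nonneg (Real.sin θ)]

@[fun_prop]
theorem continuous_legendreDelta (m : ℝ) : Continuous (legendreDelta m) := by
  unfold legendreDelta; fun_prop

theorem continuous_one_div_legendreDelta {m : ℝ} (h0 : 0 ≤ m) (h1 : m < 1) :
    Continuous fun θ => 1 / legendreDelta m θ :=
  continuous_const.div (continuous_legendreDelta m) fun θ => (legendreDelta_pos h0 h1 θ).ne'

theorem hasDerivAt_legendreDelta_left {m : ℝ} (h0 : 0 ≤ m) (h1 : m < 1) (θ : ℝ) :
    HasDerivAt (fun x => legendreDelta x θ) (-(Real.sin θ ^ 2 / (2 * legendreDelta m θ))) m := by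
  have h := ((hasDerivAt_id m).mul_const (Real.sin θ ^ 2)).const_sub 1
  have h2 := h.sqrt (by simp only [id]; linarith [one_sub_le_legendre h0 θ])
  refine h2.congr_deriv ?_
  simp only [legendreDelta, id]
  ring

theorem hasDerivAt_legendreDelta_right {m : ℝ} (h0 : 0 ≤ m) (h1 : m < 1) (θ : ℝ) :
    HasDerivAt (legendreDelta m) (-(m * Real.sin θ * Real.cos θ / legendreDelta m θ)) θ := by
  have h : HasDerivAt (fun θ => 1 - m * Real.sin θ ^ 2)
      (-(m * (2 * Real.sin θ * Real.cos θ))) θ := by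
    simpa using (((Real.hasDerivAt_sin θ).fun_pow 2).const_mul m).const_sub 1
  have h2 := h.sqrt (by linarith [one_sub_le_legendre h0 θ])
  refine h2.congr_deriv ?_
  have := (legendreDelta_pos h0 h1 θ).ne'
  simp only [legendreDelta] at *
  field_simp

theorem ellipticK_eq (m : ℝ) :
    ellipticK m = ∫ θ in (0 : ℝ)..(Real.pi / 2), 1 / legendreDelta m θ := rfl

theorem ellipticE_eq (m : ℝ) :
    ellipticE m = ∫ θ in (0 : ℝ)..(Real.pi / 2), legendreDelta m θ := rfl

theorem half_pi_le_ellipticK {m : ℝ} (h0 : 0 ≤ m) (h1 : m < 1) : Real.pi / 2 ≤ ellipticK m := by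
  have h := intervalIntegral.integral_mono_on (a := 0) (b := Real.pi / 2)
    (f := fun _ => (1 : ℝ)) (g := fun θ => 1 / legendreDelta m θ) (μ := volume)
    (by positivity) (by simp) ((continuous_one_div_legendreDelta h0 h1).intervalIntegrable _ _)
    (fun θ _ => by
      rw [le_div_iff₀ (legendreDelta_pos h0 h1 θ)]
      linarith [legendreDelta_le_one h0 θ])
  simpa [ellipticK_eq] using h

theorem ellipticK_pos {m : ℝ} (h0 : 0 ≤ m) (h1 : m < 1) : 0 < ellipticK m :=
  lt_of_lt_of_le (by positivity) (half_pi_le_ellipticK h0 h1)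

theorem ellipticK_le {m : ℝ} (h0 : 0 ≤ m) (h1 : m < 1) :
    ellipticK m ≤ Real.pi / 2 / Real.sqrt (1 - m) := by
  have hs : 0 < Real.sqrt (1 - m) := Real.sqrt_pos.2 (by linarith)
  have h := intervalIntegral.integral_mono_on (a := 0) (b := Real.pi / 2)
    (f := fun θ => 1 / legendreDelta m θ) (g := fun _ => 1 / Real.sqrt (1 - m)) (μ := volume)
    (by positivity) ((continuous_one_div_legendreDelta h0 h1).intervalIntegrable _ _) (by simp)
    (fun θ _ => one_div_le_one_div_of_le hs (sqrt_one_sub_le_legendreDelta h0 θ))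
  rw [ellipticK_eq]
  refine h.trans (le_of_eq ?_)
  simp [div_eq_mul_inv]

theorem one_le_ellipticE {m : ℝ} (h1 : m < 1) : 1 ≤ ellipticE m := by
  have h := intervalIntegral.integral_mono_on (a := 0) (b := Real.pi / 2)
    (f := fun θ => Real.cos θ) (g := fun θ => legendreDelta m θ) (μ := volume)
    (by positivity) (Real.continuous_cos.intervalIntegrable _ _)
    ((continuous_legendreDelta m).intervalIntegrable _ _)
    (fun θ _ => by
      apply Real.le_sqrt_of_sq_le
      nlinarith [Real.sin_sq_add_cos_sq θ, sq_nonneg (Real.sin θ)])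
  simpa [ellipticE_eq] using h

theorem ellipticE_le {m : ℝ} (h0 : 0 ≤ m) : ellipticE m ≤ Real.pi / 2 := by
  have h := intervalIntegral.integral_mono_on (a := 0) (b := Real.pi / 2)
    (f := fun θ => legendreDelta m θ) (g := fun _ => (1 : ℝ)) (μ := volume)
    (by positivity) ((continuous_legendreDelta m).intervalIntegrable _ _) (by simp)
    (fun θ _ => legendreDelta_le_one h0 θ)
  simpa [ellipticE_eq] using h

/-- `∫ cos² / Δ`, the combination `(E - (1 - m) K) / m`. -/
theorem ellipticE_sub_ellipticK {m : ℝ} (h0 : 0 ≤ m) (h1 : m < 1) :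
    ellipticE m - (1 - m) * ellipticK m =
      m * ∫ θ in (0 : ℝ)..(Real.pi / 2), Real.cos θ ^ 2 / legendreDelta m θ := by
  rw [ellipticE_eq, ellipticK_eq, ← intervalIntegral.integral_const_mul,
    ← intervalIntegral.integral_const_mul, ← intervalIntegral.integral_sub]
  · refine intervalIntegral.integral_congr fun θ _ => ?_
    have hp := (legendreDelta_pos h0 h1 θ).ne'
    have h2 := legendreDelta_sq h0 h1 θ
    have h3 := Real.sin_sq_add_cos_sq θ
    field_simp
    rw [h2]
    linear_combination -m * h3
  · exact (continuous_legendreDelta m).intervalIntegrable _ _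
  · exact ((continuous_one_div_legendreDelta h0 h1).intervalIntegrable _ _).const_mul _

theorem pi_div_four_le_integral_cos_sq_div {m : ℝ} (h0 : 0 ≤ m) (h1 : m < 1) :
    Real.pi / 4 ≤ ∫ θ in (0 : ℝ)..(Real.pi / 2), Real.cos θ ^ 2 / legendreDelta m θ := by
  have h := intervalIntegral.integral_mono_on (a := 0) (b := Real.pi / 2)
    (f := fun θ => Real.cos θ ^ 2) (g := fun θ => Real.cos θ ^ 2 / legendreDelta m θ) (μ := volume)
    (by positivity) ((Real.continuous_cos.pow 2).intervalIntegrable _ _)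
    (((Real.continuous_cos.pow 2).div (continuous_legendreDelta m)
      fun θ => (legendreDelta_pos h0 h1 θ).ne').intervalIntegrable _ _)
    (fun θ _ => by
      rw [le_div_iff₀ (legendreDelta_pos h0 h1 θ)]
      nlinarith [legendreDelta_le_one h0 θ, sq_nonneg (Real.cos θ)])
  rw [integral_cos_sq] at h
  refine le_trans (le_of_eq ?_) h
  simp
  ring

/-- `E(m) ≤ (1 - m/2) K(m)`. -/
theorem ellipticE_le_mul_ellipticK {m : ℝ} (h0 : 0 ≤ m) (h1 : m < 1) :
    ellipticE m ≤ (1 - m / 2) * ellipticK m := by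
  -- The function sin θ cos θ/Δ vanishes at both ends, and its derivative is (cos² − sin²)/Δ plus a
  -- nonnegative term. Hence ∫ (cos² − sin²)/Δ ≤ 0, and m/2 times this integral is E − (1 − m/2)K.
  have hd : ∀ θ, HasDerivAt (fun θ => Real.sin θ * Real.cos θ / legendreDelta m θ)
      ((Real.cos θ ^ 2 - Real.sin θ ^ 2) / legendreDelta m θ +
        m * (Real.sin θ * Real.cos θ) ^ 2 / legendreDelta m θ ^ 3) θ := fun θ => by
    have hp := (legendreDelta_pos h0 h1 θ).ne'
    have h := ((Real.hasDerivAt_sin θ).mul (Real.hasDerivAt_cos θ)).div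
      (hasDerivAt_legendreDelta_right h0 h1 θ) hp
    refine h.congr_deriv ?_
    simp only [Pi.mul_apply]
    field_simp
    ring
  have hc1 : Continuous fun θ => (Real.cos θ ^ 2 - Real.sin θ ^ 2) / legendreDelta m θ :=
    (by fun_prop : Continuous fun θ => Real.cos θ ^ 2 - Real.sin θ ^ 2).div
      (continuous_legendreDelta m) fun θ => (legendreDelta_pos h0 h1 θ).ne'
  have hc2 : Continuous fun θ => m * (Real.sin θ * Real.cos θ) ^ 2 / legendreDelta m θ ^ 3 :=
    (by fun_prop : Continuous fun θ => m * (Real.sin θ * Real.cos θ) ^ 2).div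
      (by fun_prop) fun θ => (pow_pos (legendreDelta_pos h0 h1 θ) 3).ne'
  have h := intervalIntegral.integral_eq_sub_of_hasDerivAt (a := 0) (b := Real.pi / 2)
    (fun θ _ => hd θ) ((hc1.add hc2).intervalIntegrable _ _)
  rw [intervalIntegral.integral_add (hc1.intervalIntegrable _ _) (hc2.intervalIntegrable _ _)] at h
  simp only [Real.sin_pi_div_two, Real.cos_pi_div_two, Real.sin_zero, mul_zero, zero_mul, zero_div,
    sub_zero] at h
  have h2 : 0 ≤ ∫ θ in (0 : ℝ)..(Real.pi / 2),
      m * (Real.sin θ * Real.cos θ) ^ 2 / legendreDelta m θ ^ 3 :=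
    intervalIntegral.integral_nonneg (by positivity) fun θ _ => by
      have := legendreDelta_pos h0 h1 θ
      positivity
  have h3 : ellipticE m - (1 - m / 2) * ellipticK m = m / 2 *
      ∫ θ in (0 : ℝ)..(Real.pi / 2), (Real.cos θ ^ 2 - Real.sin θ ^ 2) / legendreDelta m θ := by
    rw [ellipticE_eq, ellipticK_eq, ← intervalIntegral.integral_const_mul,
      ← intervalIntegral.integral_const_mul, ← intervalIntegral.integral_sub]
    · refine intervalIntegral.integral_congr fun θ _ => ?_
      have hp := (legendreDelta_pos h0 h1 θ).ne'
      have h2 := legendreDelta_sq h0 h1 θ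
      have h3 := Real.sin_sq_add_cos_sq θ
      field_simp
      rw [h2]
      linear_combination -m * h3
    · exact (continuous_legendreDelta m).intervalIntegrable _ _
    · exact ((continuous_one_div_legendreDelta h0 h1).intervalIntegrable _ _).const_mul _
  nlinarith

theorem hasDerivAt_ellipticE {m : ℝ} (h0 : 0 < m) (h1 : m < 1) :
    HasDerivAt ellipticE ((ellipticE m - ellipticK m) / (2 * m)) m := by
  -- The midpoint between m and 1: for parameters below M the function Δ is at least √(1 − M), which
  -- gives a constant dominating function.
  set M := (1 + m) / 2 with hM
  have hM1 : M < 1 := by rw [hM]; linarith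
  have hs : 0 < Real.sqrt (1 - M) := Real.sqrt_pos.2 (by linarith)
  have h := (intervalIntegral.hasDerivAt_integral_of_dominated_loc_of_deriv_le (μ := volume)
    (a := 0) (b := Real.pi / 2) (F := legendreDelta)
    (F' := fun x θ => -(Real.sin θ ^ 2 / (2 * legendreDelta x θ))) (x₀ := m) (s := Ioo 0 M)
    (bound := fun _ => 1 / (2 * Real.sqrt (1 - M)))
    (Ioo_mem_nhds h0 (by rw [hM]; linarith))
    (Eventually.of_forall fun x => (continuous_legendreDelta x).aestronglyMeasurable)
    ((continuous_legendreDelta m).intervalIntegrable _ _)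
    (by
      refine Continuous.aestronglyMeasurable (Continuous.neg ?_)
      exact (by fun_prop : Continuous fun θ => Real.sin θ ^ 2).div (by fun_prop)
        fun θ => by have := legendreDelta_pos h0.le h1 θ; positivity)
    (Eventually.of_forall fun θ _ x hx => by
      have h3 : Real.sqrt (1 - M) ≤ legendreDelta x θ :=
        (Real.sqrt_le_sqrt (by linarith [hx.2])).trans (sqrt_one_sub_le_legendreDelta hx.1.le θ)
      have := legendreDelta_pos hx.1.le (hx.2.trans hM1) θ
      rw [norm_neg, Real.norm_of_nonneg (by positivity)]
      exact div_le_div₀ zero_le_one (Real.sin_sq_le_one θ) (by positivity) (by linarith))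
    (by simp)
    (Eventually.of_forall fun θ _ x hx =>
      hasDerivAt_legendreDelta_left hx.1.le (hx.2.trans hM1) θ)).2
  refine h.congr_deriv ?_
  rw [ellipticE_eq, ellipticK_eq, ← intervalIntegral.integral_sub, ← intervalIntegral.integral_div]
  · refine intervalIntegral.integral_congr fun θ _ => ?_
    have hp := (legendreDelta_pos h0.le h1 θ).ne'
    have h2 := legendreDelta_sq h0.le h1 θ
    field_simp
    rw [h2]
    ring
  · exact (continuous_legendreDelta m).intervalIntegrable _ _
  · exact (continuous_one_div_legendreDelta h0.le h1).intervalIntegrable _ _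

/-- Δ − (1 − m)/Δ³ is the θ-derivative of m sin θ cos θ/Δ, which vanishes at 0 and π/2. This turns
the 1/Δ³ produced by differentiating K back into E. -/
theorem integral_one_div_legendreDelta_cube {m : ℝ} (h0 : 0 < m) (h1 : m < 1) :
    (1 - m) * ∫ θ in (0 : ℝ)..(Real.pi / 2), 1 / legendreDelta m θ ^ 3 = ellipticE m := by
  have hc : Continuous fun θ => 1 / legendreDelta m θ ^ 3 :=
    continuous_const.div (by fun_prop) fun θ => (pow_pos (legendreDelta_pos h0.le h1 θ) 3).ne'
  have hd : ∀ θ, HasDerivAt (fun θ => m * (Real.sin θ * Real.cos θ / legendreDelta m θ))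
      (legendreDelta m θ - (1 - m) * (1 / legendreDelta m θ ^ 3)) θ := fun θ => by
    have hp := (legendreDelta_pos h0.le h1 θ).ne'
    have h := (((Real.hasDerivAt_sin θ).mul (Real.hasDerivAt_cos θ)).div
      (hasDerivAt_legendreDelta_right h0.le h1 θ) hp).const_mul m
    refine h.congr_deriv ?_
    have h2 := legendreDelta_sq h0.le h1 θ
    have h3 : Real.cos θ ^ 2 = 1 - Real.sin θ ^ 2 := by linarith [Real.sin_sq_add_cos_sq θ]
    have h4 : legendreDelta m θ ^ 4 = (1 - m * Real.sin θ ^ 2) ^ 2 := by rw [← h2]; ring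
    simp only [Pi.mul_apply]
    field_simp
    rw [h4, h2]
    simp only [h3]
    ring
  have h := intervalIntegral.integral_eq_sub_of_hasDerivAt (a := 0) (b := Real.pi / 2)
    (fun θ _ => hd θ)
    (((continuous_legendreDelta m).sub (continuous_const.mul hc)).intervalIntegrable _ _)
  rw [intervalIntegral.integral_sub ((continuous_legendreDelta m).intervalIntegrable _ _)
    ((hc.intervalIntegrable _ _).const_mul _), intervalIntegral.integral_const_mul] at h
  simp only [Real.sin_pi_div_two, Real.cos_pi_div_two, Real.sin_zero, mul_zero, zero_mul, zero_div,
    sub_zero] at h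
  rw [ellipticE_eq]
  linarith

theorem hasDerivAt_ellipticK {m : ℝ} (h0 : 0 < m) (h1 : m < 1) :
    HasDerivAt ellipticK ((ellipticE m - (1 - m) * ellipticK m) / (2 * m * (1 - m))) m := by
  set M := (1 + m) / 2 with hM
  have hM1 : M < 1 := by rw [hM]; linarith
  have hs : 0 < Real.sqrt (1 - M) := Real.sqrt_pos.2 (by linarith)
  have h := (intervalIntegral.hasDerivAt_integral_of_dominated_loc_of_deriv_le (μ := volume)
    (a := 0) (b := Real.pi / 2) (F := fun x θ => 1 / legendreDelta x θ)
    (F' := fun x θ => Real.sin θ ^ 2 / (2 * legendreDelta x θ ^ 3)) (x₀ := m) (s := Ioo 0 M)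
    (bound := fun _ => 1 / (2 * Real.sqrt (1 - M) ^ 3))
    (Ioo_mem_nhds h0 (by rw [hM]; linarith))
    (Filter.mem_of_superset (Ioo_mem_nhds h0 h1) fun x hx =>
      (continuous_one_div_legendreDelta hx.1.le hx.2).aestronglyMeasurable)
    ((continuous_one_div_legendreDelta h0.le h1).intervalIntegrable _ _)
    (by
      refine Continuous.aestronglyMeasurable ?_
      exact (by fun_prop : Continuous fun θ => Real.sin θ ^ 2).div (by fun_prop)
        fun θ => by have := legendreDelta_pos h0.le h1 θ; positivity)
    (Eventually.of_forall fun θ _ x hx => by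
      have h3 : Real.sqrt (1 - M) ≤ legendreDelta x θ :=
        (Real.sqrt_le_sqrt (by linarith [hx.2])).trans (sqrt_one_sub_le_legendreDelta hx.1.le θ)
      have := legendreDelta_pos hx.1.le (hx.2.trans hM1) θ
      rw [Real.norm_of_nonneg (by positivity)]
      have h4 : Real.sqrt (1 - M) ^ 3 ≤ legendreDelta x θ ^ 3 := by gcongr
      exact div_le_div₀ zero_le_one (Real.sin_sq_le_one θ) (by positivity) (by linarith))
    (by simp)
    (Eventually.of_forall fun θ _ x hx => by
      have hp := legendreDelta_pos hx.1.le (hx.2.trans hM1) θ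
      have h5 := (hasDerivAt_legendreDelta_left hx.1.le (hx.2.trans hM1) θ).inv hp.ne'
      simp only [one_div]
      refine h5.congr_deriv ?_
      field_simp)).2
  refine h.congr_deriv ?_
  have hm1 : 1 - m ≠ 0 := by linarith
  have hc : Continuous fun θ => 1 / legendreDelta m θ ^ 3 :=
    continuous_const.div (by fun_prop) fun θ => (pow_pos (legendreDelta_pos h0.le h1 θ) 3).ne'
  rw [← integral_one_div_legendreDelta_cube h0 h1]
  trans ((∫ θ in (0 : ℝ)..(Real.pi / 2), 1 / legendreDelta m θ ^ 3) - ellipticK m) / (2 * m)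
  · rw [ellipticK_eq, ← intervalIntegral.integral_sub, ← intervalIntegral.integral_div]
    · refine intervalIntegral.integral_congr fun θ _ => ?_
      have hp := (legendreDelta_pos h0.le h1 θ).ne'
      have h2 := legendreDelta_sq h0.le h1 θ
      field_simp
      rw [h2]
      ring
    · exact hc.intervalIntegrable _ _
    · exact (continuous_one_div_legendreDelta h0.le h1).intervalIntegrable _ _
  · field_simp

/-- Since cos θ ≤ π/2 − θ, Δ² = cos² θ + (1 − m) sin² θ ≤ (π/2 − θ + √(1 − m))². The reciprocal of
the right-hand root integrates to the logarithm. The bound forces K → ∞, hence E/K → 0, as m → 1. -/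
theorem log_le_ellipticK {m : ℝ} (h0 : 0 ≤ m) (h1 : m < 1) :
    Real.log ((Real.pi / 2 + Real.sqrt (1 - m)) / Real.sqrt (1 - m)) ≤ ellipticK m := by
  set e := Real.sqrt (1 - m) with he
  have hs : 0 < e := Real.sqrt_pos.2 (by linarith)
  have he2 : e ^ 2 = 1 - m := Real.sq_sqrt (by linarith)
  have hpi := Real.pi_pos
  have hpos : ∀ θ ∈ Icc 0 (Real.pi / 2), 0 < Real.pi / 2 - θ + e := fun θ hθ => by
    linarith [hθ.2]
  have hco : ContinuousOn (fun θ => 1 / (Real.pi / 2 - θ + e)) (uIcc 0 (Real.pi / 2)) := by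
    rw [uIcc_of_le (by positivity)]
    exact continuousOn_const.div (by fun_prop) fun θ hθ => (hpos θ hθ).ne'
  have h := intervalIntegral.integral_mono_on (a := 0) (b := Real.pi / 2)
    (f := fun θ => 1 / (Real.pi / 2 - θ + e)) (g := fun θ => 1 / legendreDelta m θ) (μ := volume)
    (by positivity) hco.intervalIntegrable
    ((continuous_one_div_legendreDelta h0 h1).intervalIntegrable _ _)
    (fun θ hθ => by
      refine one_div_le_one_div_of_le (legendreDelta_pos h0 h1 θ) ?_
      refine Real.sqrt_le_iff.2 ⟨(hpos θ hθ).le, ?_⟩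
      have h2 : Real.cos θ ≤ Real.pi / 2 - θ := by
        rw [← Real.sin_pi_div_two_sub]; exact Real.sin_le (by linarith [hθ.2])
      have h3 : 0 ≤ Real.cos θ := Real.cos_nonneg_of_mem_Icc ⟨by linarith [hθ.1], hθ.2⟩
      have h4 := Real.sin_sq_add_cos_sq θ
      have h5 := Real.sin_sq_le_one θ
      have h6 : 1 - m * Real.sin θ ^ 2 = Real.cos θ ^ 2 + e ^ 2 * Real.sin θ ^ 2 := by
        rw [he2]; linear_combination -h4
      rw [h6]
      nlinarith [mul_nonneg (sub_nonneg.2 (h3.trans h2)) hs.le, sq_nonneg e, sq_nonneg (Real.sin θ)])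
  refine le_trans (le_of_eq ?_) h
  have h7 := intervalIntegral.integral_eq_sub_of_hasDerivAt (a := 0) (b := Real.pi / 2)
    (f := fun θ => -Real.log (Real.pi / 2 - θ + e)) (f' := fun θ => 1 / (Real.pi / 2 - θ + e))
    (fun θ hθ => by
      rw [uIcc_of_le (by positivity)] at hθ
      have h8 := ((((hasDerivAt_id θ).const_sub (Real.pi / 2)).add_const e).log
        (hpos θ hθ).ne').neg
      refine h8.congr_deriv ?_
      simp only [id]
      ring) hco.intervalIntegrable
  rw [h7, Real.log_div (by positivity) hs.ne', sub_self, sub_zero, zero_add]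
  ring

/-! ### The ratio `E / K` -/

/-- `μ(m) = E(m)/K(m)`. -/
def ellipticRatio (m : ℝ) : ℝ := ellipticE m / ellipticK m

theorem ellipticRatio_le {m : ℝ} (h0 : 0 ≤ m) (h1 : m < 1) : ellipticRatio m ≤ 1 - m / 2 := by
  rw [ellipticRatio, div_le_iff₀ (ellipticK_pos h0 h1)]
  exact ellipticE_le_mul_ellipticK h0 h1

/-- E − (1 − m)K = m ∫ cos²/Δ ≥ mπ/4, while K √(1 − m) ≤ π/2. The surplus (m/2)√(1 − m) over the
bound 1 − m keeps w² strictly below the squared second edge, and it is sharp to first order as m →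
0. -/
theorem le_ellipticRatio {m : ℝ} (h0 : 0 ≤ m) (h1 : m < 1) :
    1 - m + m / 2 * Real.sqrt (1 - m) ≤ ellipticRatio m := by
  rw [ellipticRatio, le_div_iff₀ (ellipticK_pos h0 h1)]
  have hs : 0 < Real.sqrt (1 - m) := Real.sqrt_pos.2 (by linarith)
  have h2 := ellipticE_sub_ellipticK h0 h1
  have h3 := pi_div_four_le_integral_cos_sq_div h0 h1
  have h4 := ellipticK_le h0 h1
  rw [le_div_iff₀ hs] at h4
  nlinarith

theorem ellipticRatio_pos {m : ℝ} (h0 : 0 ≤ m) (h1 : m < 1) : 0 < ellipticRatio m :=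
  div_pos (by linarith [one_le_ellipticE h1]) (ellipticK_pos h0 h1)

theorem ellipticRatio_le_log {m : ℝ} (h0 : 0 ≤ m) (h1 : m < 1) :
    ellipticRatio m ≤
      Real.pi / 2 / Real.log ((Real.pi / 2 + Real.sqrt (1 - m)) / Real.sqrt (1 - m)) := by
  have hs : 0 < Real.sqrt (1 - m) := Real.sqrt_pos.2 (by linarith)
  refine div_le_div₀ (by positivity) (ellipticE_le h0) (Real.log_pos ?_) (log_le_ellipticK h0 h1)
  rw [lt_div_iff₀ hs]
  linarith [Real.pi_pos]

/-- Combines E ≥ 1 with K ≤ (π/2)/√(1 − m). Although E/K tends to 0 as m → 1, the quotient still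
does, which is what the velocities need when the upper band collapses. -/
theorem one_sub_div_ellipticRatio_le {m : ℝ} (h0 : 0 ≤ m) (h1 : m < 1) :
    (1 - m) / ellipticRatio m ≤ Real.pi / 2 * Real.sqrt (1 - m) := by
  have hs : 0 < Real.sqrt (1 - m) := Real.sqrt_pos.2 (by linarith)
  have h2 := one_le_ellipticE h1
  have h3 := ellipticK_le h0 h1
  have h4 := ellipticK_pos h0 h1
  have h5 : Real.sqrt (1 - m) ^ 2 = 1 - m := Real.sq_sqrt (by linarith)
  rw [le_div_iff₀ hs] at h3
  rw [ellipticRatio, div_div_eq_mul_div, div_le_iff₀ (by linarith)]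
  calc (1 - m) * ellipticK m = Real.sqrt (1 - m) ^ 2 * ellipticK m := by rw [h5]
    _ = Real.sqrt (1 - m) * (ellipticK m * Real.sqrt (1 - m)) := by ring
    _ ≤ Real.sqrt (1 - m) * (Real.pi / 2) := by gcongr
    _ ≤ Real.pi / 2 * Real.sqrt (1 - m) * ellipticE m := by
        have : 0 ≤ Real.pi / 2 * Real.sqrt (1 - m) := by positivity
        nlinarith

/-- A Riccati equation: the derivative is rational in m and the ratio itself. This is why all
derivatives of w² are rational in w² and the squared edges. -/
theorem hasDerivAt_ellipticRatio {m : ℝ} (h0 : 0 < m) (h1 : m < 1) :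
    HasDerivAt ellipticRatio
      (-((ellipticRatio m - (1 - m)) ^ 2 + m * (1 - m)) / (2 * m * (1 - m))) m := by
  have hK := (ellipticK_pos h0.le h1).ne'
  have h := (hasDerivAt_ellipticE h0 h1).div (hasDerivAt_ellipticK h0 h1) hK
  refine h.congr_deriv ?_
  have hm1 : 1 - m ≠ 0 := by linarith
  simp only [ellipticRatio]
  field_simp
  ring

theorem tendsto_ellipticRatio_one : Tendsto ellipticRatio (𝓝[<] 1) (𝓝 0) := by
  have hev : ∀ᶠ m : ℝ in 𝓝[<] 1, 0 ≤ m ∧ m < 1 := by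
    filter_upwards [Ioo_mem_nhdsLT (show (0 : ℝ) < 1 by norm_num)] with m hm
    exact ⟨hm.1.le, hm.2⟩
  have hs : Tendsto (fun m : ℝ => Real.sqrt (1 - m)) (𝓝[<] 1) (𝓝[>] 0) := by
    refine tendsto_nhdsWithin_iff.2 ⟨?_, ?_⟩
    · have : Continuous fun m : ℝ => Real.sqrt (1 - m) := by fun_prop
      simpa using (this.tendsto 1).mono_left nhdsWithin_le_nhds
    · filter_upwards [hev] with m hm
      exact Real.sqrt_pos.2 (by linarith [hm.2])
  have hlog : Tendsto (fun e : ℝ => Real.log ((Real.pi / 2 + e) / e)) (𝓝[>] 0) atTop := by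
    refine Real.tendsto_log_atTop.comp ?_
    have h1 : Tendsto (fun e : ℝ => Real.pi / 2 + e) (𝓝[>] 0) (𝓝 (Real.pi / 2)) := by
      have : Continuous fun e : ℝ => Real.pi / 2 + e := by fun_prop
      simpa using (this.tendsto 0).mono_left nhdsWithin_le_nhds
    exact h1.pos_mul_atTop (by positivity) tendsto_inv_nhdsGT_zero
  refine tendsto_of_tendsto_of_tendsto_of_le_of_le' tendsto_const_nhds
    ((hlog.comp hs).const_div_atTop (Real.pi / 2)) ?_ ?_
  · filter_upwards [hev] with m hm using (ellipticRatio_pos hm.1 hm.2).le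
  · filter_upwards [hev] with m hm using ellipticRatio_le_log hm.1 hm.2

/-! ### The root `w²` of the genus 1 density of states -/

theorem muRatio_eq (a b c : ℝ) :
    muRatio a b c = ellipticRatio ((b ^ 2 - a ^ 2) / (c ^ 2 - a ^ 2)) := rfl

/-- In this form r² is symmetric in the three edges once w² is regarded as independent, so one
computation serves all three edges. -/
theorem rSq_eq (a b c : ℝ) : rSq a b c =
    (a ^ 2 + b ^ 2 + c ^ 2) * wSq a b c / 6
      - (a ^ 2 * b ^ 2 + b ^ 2 * c ^ 2 + c ^ 2 * a ^ 2) / 3 := by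
  unfold rSq wSq; ring

theorem sq_lt_sq_of_nonneg {a b : ℝ} (ha : 0 ≤ a) (hab : a < b) : a ^ 2 < b ^ 2 := by
  nlinarith

section Bounds

variable {a b c : ℝ} (ha : 0 ≤ a) (hab : a < b) (hbc : b < c)
include ha hab hbc

theorem modulus_mem : 0 < (b ^ 2 - a ^ 2) / (c ^ 2 - a ^ 2) ∧
    (b ^ 2 - a ^ 2) / (c ^ 2 - a ^ 2) < 1 := by
  have h1 := sq_lt_sq_of_nonneg ha hab
  have h2 := sq_lt_sq_of_nonneg (ha.trans hab.le) hbc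
  have h3 : 0 < c ^ 2 - a ^ 2 := by linarith
  exact ⟨div_pos (by linarith) h3, by rw [div_lt_one h3]; linarith⟩

/-- `le_ellipticRatio` rescaled by c² − a². Together with `midpoint_le_wSq` it places w²
asymptotically at the middle of (a², b²) when that gap closes. -/
theorem half_mul_sqrt_le_sq_sub_wSq :
    (b ^ 2 - a ^ 2) / 2 * Real.sqrt ((c ^ 2 - b ^ 2) / (c ^ 2 - a ^ 2)) ≤ b ^ 2 - wSq a b c := by
  obtain ⟨h0, h1⟩ := modulus_mem ha hab hbc
  have h3 : 0 < c ^ 2 - a ^ 2 := by nlinarith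
  have h := le_ellipticRatio h0.le h1
  have h4 : 1 - (b ^ 2 - a ^ 2) / (c ^ 2 - a ^ 2) = (c ^ 2 - b ^ 2) / (c ^ 2 - a ^ 2) := by
    field_simp; ring
  rw [h4, ← muRatio_eq] at h
  have h5 := mul_le_mul_of_nonneg_left h h3.le
  have h6 : (c ^ 2 - a ^ 2) * ((c ^ 2 - b ^ 2) / (c ^ 2 - a ^ 2) + (b ^ 2 - a ^ 2) / (c ^ 2 - a ^ 2)
      / 2 * Real.sqrt ((c ^ 2 - b ^ 2) / (c ^ 2 - a ^ 2))) = c ^ 2 - b ^ 2 +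
      (b ^ 2 - a ^ 2) / 2 * Real.sqrt ((c ^ 2 - b ^ 2) / (c ^ 2 - a ^ 2)) := by
    field_simp
  rw [h6] at h5
  unfold wSq
  linarith

theorem wSq_lt : wSq a b c < b ^ 2 := by
  have h := half_mul_sqrt_le_sq_sub_wSq ha hab hbc
  have h1 := sq_lt_sq_of_nonneg ha hab
  have h2 := sq_lt_sq_of_nonneg (ha.trans hab.le) hbc
  have h3 : 0 < Real.sqrt ((c ^ 2 - b ^ 2) / (c ^ 2 - a ^ 2)) :=
    Real.sqrt_pos.2 (div_pos (by linarith) (by linarith))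
  have h4 : 0 < (b ^ 2 - a ^ 2) / 2 := by linarith
  have := mul_pos h4 h3
  linarith

/-- The inequality E ≤ (1 − m/2)K rescaled: w² lies in the upper half of the gap. The monotonicity
of V₁ and V₂ rests on this. -/
theorem midpoint_le_wSq : (a ^ 2 + b ^ 2) / 2 ≤ wSq a b c := by
  obtain ⟨h0, h1⟩ := modulus_mem ha hab hbc
  have h3 : 0 < c ^ 2 - a ^ 2 := by nlinarith
  have h := ellipticRatio_le h0.le h1
  rw [← muRatio_eq] at h
  have h5 := mul_le_mul_of_nonneg_left h h3.le
  have h6 : (c ^ 2 - a ^ 2) * (1 - (b ^ 2 - a ^ 2) / (c ^ 2 - a ^ 2) / 2) =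
      c ^ 2 - (a ^ 2 + b ^ 2) / 2 := by
    field_simp; ring
  rw [h6] at h5
  unfold wSq
  linarith

theorem lt_wSq : a ^ 2 < wSq a b c := by
  have h1 := sq_lt_sq_of_nonneg ha hab
  linarith [midpoint_le_wSq ha hab hbc]

theorem sub_div_sub_wSq_le : (c ^ 2 - b ^ 2) / (c ^ 2 - wSq a b c) ≤
    Real.pi / 2 * Real.sqrt ((c ^ 2 - b ^ 2) / (c ^ 2 - a ^ 2)) := by
  obtain ⟨h0, h1⟩ := modulus_mem ha hab hbc
  have h3 : 0 < c ^ 2 - a ^ 2 := by nlinarith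
  have h := one_sub_div_ellipticRatio_le h0.le h1
  have hp := ellipticRatio_pos h0.le h1
  rw [← muRatio_eq] at h hp
  have h4 : 1 - (b ^ 2 - a ^ 2) / (c ^ 2 - a ^ 2) = (c ^ 2 - b ^ 2) / (c ^ 2 - a ^ 2) := by
    field_simp; ring
  rw [h4] at h
  refine le_trans (le_of_eq ?_) h
  unfold wSq
  field_simp
  ring_nf

end Bounds

/-- Partial derivative of `w²` with respect to a squared band edge `Y`, the other two being
`X₁, X₂`. -/
def wSqSlope (W Y X₁ X₂ : ℝ) : ℝ := 1 / 2 - (W - Y) ^ 2 / (2 * ((Y - X₁) * (Y - X₂)))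

/-- Chain rule with the Riccati equation for E/K. The three partial derivatives turn out to be one
expression with the edges permuted, although the definition of w² treats them differently. -/
theorem hasDerivAt_wSq {a b c : ℝ → ℝ} {a' b' c' y : ℝ} (ha : 0 ≤ a y) (hab : a y < b y)
    (hbc : b y < c y) (da : HasDerivAt a a' y) (db : HasDerivAt b b' y) (dc : HasDerivAt c c' y) :
    HasDerivAt (fun y => wSq (a y) (b y) (c y))
      (wSqSlope (wSq (a y) (b y) (c y)) (a y ^ 2) (b y ^ 2) (c y ^ 2) * (2 * a y * a')
        + wSqSlope (wSq (a y) (b y) (c y)) (b y ^ 2) (a y ^ 2) (c y ^ 2) * (2 * b y * b')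
        + wSqSlope (wSq (a y) (b y) (c y)) (c y ^ 2) (a y ^ 2) (b y ^ 2) * (2 * c y * c')) y := by
  have h1 := sq_lt_sq_of_nonneg ha hab
  have h2 := sq_lt_sq_of_nonneg (ha.trans hab.le) hbc
  obtain ⟨m0, m1⟩ := modulus_mem ha hab hbc
  have dA := da.fun_pow 2
  have dB := db.fun_pow 2
  have dC := dc.fun_pow 2
  have hD : c y ^ 2 - a y ^ 2 ≠ 0 := by linarith
  have hd := dC.sub ((dC.sub dA).mul
    ((hasDerivAt_ellipticRatio m0 m1).comp y ((dB.sub dA).div (dC.sub dA) hD)))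
  refine hd.congr_deriv ?_
  simp only [Function.comp, Pi.sub_apply, Pi.div_apply, wSqSlope, wSq, muRatio_eq]
  generalize ellipticRatio ((b y ^ 2 - a y ^ 2) / (c y ^ 2 - a y ^ 2)) = μ
  have e1 : b y ^ 2 - a y ^ 2 ≠ 0 := by linarith
  have e2 : c y ^ 2 - b y ^ 2 ≠ 0 := by linarith
  have e3 : 1 - (b y ^ 2 - a y ^ 2) / (c y ^ 2 - a y ^ 2) =
    (c y ^ 2 - b y ^ 2) / (c y ^ 2 - a y ^ 2) := by field_simp; ring
  have e4 : a y ^ 2 - b y ^ 2 = -(b y ^ 2 - a y ^ 2) := by ring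
  have e5 : b y ^ 2 - c y ^ 2 = -(c y ^ 2 - b y ^ 2) := by ring
  have e6 : a y ^ 2 - c y ^ 2 = -(c y ^ 2 - a y ^ 2) := by ring
  rw [e3, e4, e5, e6]
  push_cast
  simp only [pow_one]
  clear hd dA dB dC da db dc m0 m1 e3 e4 e5 e6
  generalize a y = x at *
  generalize b y = z at *
  generalize c y = w at *
  -- The lengths p of the gap and q of the upper band, in squared variables, serve as independent
  -- unknowns. All denominators are then products of p, q and p + q.
  obtain ⟨p, hp⟩ : ∃ p, z ^ 2 - x ^ 2 = p := ⟨_, rfl⟩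
  obtain ⟨q, hq⟩ : ∃ q, w ^ 2 - z ^ 2 = q := ⟨_, rfl⟩
  have hpq : w ^ 2 - x ^ 2 = p + q := by rw [← hp, ← hq]; ring
  have hw : w ^ 2 = p + q + x ^ 2 := by linarith
  have hz : z ^ 2 = p + x ^ 2 := by linarith
  rw [hp] at e1
  rw [hq] at e2
  rw [hpq] at hD
  rw [hpq, hp, hq, hw, hz]
  field_simp
  ring

/-! ### Whitham velocities -/

/-- The characteristic velocity attached to the squared band edge `Y`, in terms of the other two
squared edges and of `W = w²`. -/
def edgeVelocity (W Y X₁ X₂ : ℝ) : ℝ := 2 * (Y + X₁ + X₂) + 4 * ((Y - X₁) * (Y - X₂)) / (Y - W)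

section Velocity

variable {a b c : ℝ} (ha : 0 ≤ a) (hab : a < b) (hbc : b < c)
include ha hab hbc

/-- At η² = Y the numerator of s is 12 times (Y − W)(Y + X₁ + X₂)/6 + (Y − X₁)(Y − X₂)/3, by
`rSq_eq`. The same identity gives V₂ and V₃. -/
theorem whithamV1_eq :
    whithamV1 a b c = edgeVelocity (wSq a b c) (a ^ 2) (b ^ 2) (c ^ 2) := by
  have h : a ^ 2 - wSq a b c ≠ 0 := by linarith [lt_wSq ha hab hbc]
  simp only [whithamV1, Condensate.velocity, edgeVelocity, rSq_eq, hSq]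
  field_simp
  ring

theorem whithamV2_eq :
    whithamV2 a b c = edgeVelocity (wSq a b c) (b ^ 2) (a ^ 2) (c ^ 2) := by
  have h : b ^ 2 - wSq a b c ≠ 0 := by linarith [wSq_lt ha hab hbc]
  simp only [whithamV2, Condensate.velocity, edgeVelocity, rSq_eq, hSq]
  field_simp
  ring

theorem whithamV3_eq :
    whithamV3 a b c = edgeVelocity (wSq a b c) (c ^ 2) (a ^ 2) (b ^ 2) := by
  have h : c ^ 2 - wSq a b c ≠ 0 := by
    linarith [wSq_lt ha hab hbc, sq_lt_sq_of_nonneg (ha.trans hab.le) hbc]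
  simp only [whithamV3, Condensate.velocity, edgeVelocity, rSq_eq, hSq]
  field_simp
  ring

theorem whithamV1_formula : whithamV1 a b c = 2 * (a ^ 2 + b ^ 2 + c ^ 2)
    + 4 * (b ^ 2 - a ^ 2) / (muRatio a b c - 1) := by
  have h := lt_wSq ha hab hbc
  have h3 : 0 < c ^ 2 - a ^ 2 := by nlinarith
  have h4 : a ^ 2 - wSq a b c = (c ^ 2 - a ^ 2) * (muRatio a b c - 1) := by unfold wSq; ring
  have h5 : muRatio a b c - 1 ≠ 0 := fun h0 => by rw [h0] at h4; linarith
  rw [whithamV1_eq ha hab hbc, edgeVelocity, h4]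
  field_simp
  ring

theorem whithamV2_formula : whithamV2 a b c = 2 * (a ^ 2 + b ^ 2 + c ^ 2)
    + 4 * (c ^ 2 - b ^ 2) * (b ^ 2 - a ^ 2)
      / (c ^ 2 - b ^ 2 - (c ^ 2 - a ^ 2) * muRatio a b c) := by
  have h := wSq_lt ha hab hbc
  have h4 : c ^ 2 - b ^ 2 - (c ^ 2 - a ^ 2) * muRatio a b c = -(b ^ 2 - wSq a b c) := by
    unfold wSq; ring
  have h5 : b ^ 2 - wSq a b c ≠ 0 := by linarith
  rw [whithamV2_eq ha hab hbc, edgeVelocity, h4]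
  field_simp
  ring

theorem whithamV3_formula : whithamV3 a b c = 2 * (a ^ 2 + b ^ 2 + c ^ 2)
    + 4 * (c ^ 2 - b ^ 2) / muRatio a b c := by
  have h := wSq_lt ha hab hbc
  have h2 := sq_lt_sq_of_nonneg (ha.trans hab.le) hbc
  have h3 : 0 < c ^ 2 - a ^ 2 := by nlinarith
  have h4 : c ^ 2 - wSq a b c = (c ^ 2 - a ^ 2) * muRatio a b c := by unfold wSq; ring
  have h5 : muRatio a b c ≠ 0 := fun h0 => by rw [h0] at h4; linarith
  rw [whithamV3_eq ha hab hbc, edgeVelocity, h4]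
  field_simp
  ring

end Velocity

/-- Partial derivative of the characteristic velocity of `Y` with respect to `Y`. -/
def edgeVelocitySlope (W Y X₁ X₂ : ℝ) : ℝ :=
  (4 * (2 * Y - X₁ - X₂) * (Y - W) - 2 * ((Y - X₁) * (Y - X₂))) / (Y - W) ^ 2

/-- The term (W − Y)²/((Y − X₁)(Y − X₂)) of the slope of W meets the factor (Y − X₁)(Y − X₂)/(Y −
W)² and contributes a constant that cancels the derivative of 2(Y + X₁ + X₂). -/
theorem hasDerivAt_edgeVelocity {W : ℝ → ℝ} {X₁ X₂ y : ℝ} (h1 : y ^ 2 ≠ X₁) (h2 : y ^ 2 ≠ X₂)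
    (hw : y ^ 2 ≠ W y) (dW : HasDerivAt W (wSqSlope (W y) (y ^ 2) X₁ X₂ * (2 * y)) y) :
    HasDerivAt (fun y => edgeVelocity (W y) (y ^ 2) X₁ X₂)
      (edgeVelocitySlope (W y) (y ^ 2) X₁ X₂ * (2 * y)) y := by
  have d : HasDerivAt (fun y : ℝ => y ^ 2) (2 * y) y := by simpa using hasDerivAt_pow 2 y
  have e1 : y ^ 2 - X₁ ≠ 0 := sub_ne_zero.2 h1
  have e2 : y ^ 2 - X₂ ≠ 0 := sub_ne_zero.2 h2
  have e3 : y ^ 2 - W y ≠ 0 := sub_ne_zero.2 hw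
  have h := (((d.add_const X₁).add_const X₂).const_mul 2).add
    ((((d.sub_const X₁).mul (d.sub_const X₂)).const_mul 4).div (d.sub dW) e3)
  refine h.congr_deriv ?_
  simp only [edgeVelocitySlope, wSqSlope, Pi.mul_apply, Pi.sub_apply]
  generalize W y = w at *
  generalize y ^ 2 = Y at *
  have e4 : w - Y = -(Y - w) := by ring
  rw [e4]
  field_simp
  ring

/-! ### Each velocity increases strictly in its own edge -/

section Slope

variable {a b c : ℝ} (ha : 0 ≤ a) (hab : a < b) (hbc : b < c)
include ha hab hbc

/-- Inserting W − A ≥ (B − A)/2, the numerator is at least 2(B − A)², where A, B, C are the squared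
edges. -/
theorem edgeVelocitySlope_pos_one :
    0 < edgeVelocitySlope (wSq a b c) (a ^ 2) (b ^ 2) (c ^ 2) := by
  have h1 := sq_lt_sq_of_nonneg ha hab
  have h2 := sq_lt_sq_of_nonneg (ha.trans hab.le) hbc
  have h3 := midpoint_le_wSq ha hab hbc
  refine div_pos ?_ (by have : a ^ 2 - wSq a b c ≠ 0 := by linarith
                        positivity)
  have h4 := mul_le_mul_of_nonneg_left h3 (show 0 ≤ (b ^ 2 + c ^ 2 - 2 * a ^ 2) by linarith)
  have h5 := mul_pos (sub_pos.2 h1) (sub_pos.2 h1)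
  nlinarith

/-- The numerator is 4(2B − A − C)(B − W) + 2(B − A)(C − B). Both terms are nonnegative, and the
second positive, if 2B ≥ A + C. Otherwise B − W ≤ (B − A)/2 gives the lower bound 2(B − A)². -/
theorem edgeVelocitySlope_pos_two :
    0 < edgeVelocitySlope (wSq a b c) (b ^ 2) (a ^ 2) (c ^ 2) := by
  have h1 := sq_lt_sq_of_nonneg ha hab
  have h2 := sq_lt_sq_of_nonneg (ha.trans hab.le) hbc
  have h3 := midpoint_le_wSq ha hab hbc
  have h4 := wSq_lt ha hab hbc
  refine div_pos ?_ (by have : b ^ 2 - wSq a b c ≠ 0 := by linarith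
                        positivity)
  have h5 := mul_pos (sub_pos.2 h1) (sub_pos.2 h1)
  have h6 := mul_pos (sub_pos.2 h1) (sub_pos.2 h2)
  rcases le_total (a ^ 2 + c ^ 2) (2 * b ^ 2) with h | h
  · have := mul_nonneg (sub_nonneg.2 h) (sub_nonneg.2 h4.le)
    nlinarith
  · have := mul_nonneg (sub_nonneg.2 h) (sub_nonneg.2 h3)
    nlinarith

theorem edgeVelocitySlope_pos_three :
    0 < edgeVelocitySlope (wSq a b c) (c ^ 2) (a ^ 2) (b ^ 2) := by
  have h1 := sq_lt_sq_of_nonneg ha hab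
  have h2 := sq_lt_sq_of_nonneg (ha.trans hab.le) hbc
  have h4 := wSq_lt ha hab hbc
  refine div_pos ?_ (by have : c ^ 2 - wSq a b c ≠ 0 := by linarith
                        positivity)
  have h5 := mul_pos (show 0 < 2 * c ^ 2 - a ^ 2 - b ^ 2 by linarith) (sub_pos.2 h4)
  have h6 := mul_pos (sub_pos.2 h2) (sub_pos.2 h2)
  nlinarith [mul_pos (sub_pos.2 h1) (sub_pos.2 h2)]

end Slope

/-! ### Limits of `w²` and of the velocities -/

section Limits

variable {ι : Type*} {l : Filter ι} {a b c : ι → ℝ} {a₀ b₀ c₀ : ℝ}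

theorem tendsto_wSq (ha : 0 ≤ a₀) (hab : a₀ < b₀) (hbc : b₀ < c₀) (ta : Tendsto a l (𝓝 a₀))
    (tb : Tendsto b l (𝓝 b₀)) (tc : Tendsto c l (𝓝 c₀)) :
    Tendsto (fun i => wSq (a i) (b i) (c i)) l (𝓝 (wSq a₀ b₀ c₀)) := by
  obtain ⟨m0, m1⟩ := modulus_mem ha hab hbc
  have hD : c₀ ^ 2 - a₀ ^ 2 ≠ 0 := by nlinarith
  exact (tc.pow 2).sub (((tc.pow 2).sub (ta.pow 2)).mul
    ((hasDerivAt_ellipticRatio m0 m1).continuousAt.tendsto.comp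
      (((tb.pow 2).sub (ta.pow 2)).div ((tc.pow 2).sub (ta.pow 2)) hD)))

theorem tendsto_edgeVelocity {W Y X₁ X₂ : ι → ℝ} {W₀ Y₀ X₁₀ X₂₀ : ℝ} (h : Y₀ ≠ W₀)
    (tW : Tendsto W l (𝓝 W₀)) (tY : Tendsto Y l (𝓝 Y₀)) (t1 : Tendsto X₁ l (𝓝 X₁₀))
    (t2 : Tendsto X₂ l (𝓝 X₂₀)) :
    Tendsto (fun i => edgeVelocity (W i) (Y i) (X₁ i) (X₂ i)) l (𝓝 (edgeVelocity W₀ Y₀ X₁₀ X₂₀)) :=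
  (((tY.add t1).add t2).const_mul 2).add
    ((((tY.sub t1).mul (tY.sub t2)).const_mul 4).div (tY.sub tW) (sub_ne_zero.2 h))

/-! ### The gap between the first two edges closes -/

section LowerGapCloses

variable (ho : ∀ᶠ i in l, 0 ≤ a i ∧ a i < b i ∧ b i < c i) (he : 0 ≤ a₀) (hec : a₀ < c₀)
  (ta : Tendsto a l (𝓝 a₀)) (tb : Tendsto b l (𝓝 a₀)) (tc : Tendsto c l (𝓝 c₀))
include ho ta tb

theorem tendsto_wSq_of_lower_gap : Tendsto (fun i => wSq (a i) (b i) (c i)) l (𝓝 (a₀ ^ 2)) := by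
  refine tendsto_of_tendsto_of_tendsto_of_le_of_le' (ta.pow 2) (tb.pow 2) ?_ ?_
  · filter_upwards [ho] with i hi using (lt_wSq hi.1 hi.2.1 hi.2.2).le
  · filter_upwards [ho] with i hi using (wSq_lt hi.1 hi.2.1 hi.2.2).le

include he hec tc

/-- All three squares a², w², b² tend to the same point, so the velocities take the form 0/0. The
bounds of w² by the midpoint from both sides fix the ratio at 1/2. -/
theorem tendsto_sub_wSq_div : Tendsto (fun i => (b i ^ 2 - wSq (a i) (b i) (c i)) /
    (b i ^ 2 - a i ^ 2)) l (𝓝 (1 / 2)) := by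
  have hD : c₀ ^ 2 - a₀ ^ 2 ≠ 0 := by nlinarith
  have t1 : Tendsto (fun i => 1 / 2 * Real.sqrt ((c i ^ 2 - b i ^ 2) / (c i ^ 2 - a i ^ 2))) l
      (𝓝 (1 / 2)) := by
    have := (((tc.pow 2).sub (tb.pow 2)).div ((tc.pow 2).sub (ta.pow 2)) hD).sqrt.const_mul (1 / 2)
    simpa [div_self hD] using this
  refine tendsto_of_tendsto_of_tendsto_of_le_of_le' t1 tendsto_const_nhds ?_ ?_
  · filter_upwards [ho] with i hi
    have h1 := sq_lt_sq_of_nonneg hi.1 hi.2.1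
    rw [le_div_iff₀ (by linarith)]
    linarith [half_mul_sqrt_le_sq_sub_wSq hi.1 hi.2.1 hi.2.2]
  · filter_upwards [ho] with i hi
    have h1 := sq_lt_sq_of_nonneg hi.1 hi.2.1
    rw [div_le_iff₀ (by linarith)]
    linarith [midpoint_le_wSq hi.1 hi.2.1 hi.2.2]

/-- V₂ depends on the vanishing quantities only through the ratio (b² − w²)/(b² − a²). V₁ contains
one minus this ratio, which also tends to 1/2, so both velocities have the same limit. -/
theorem tendsto_whithamV2_of_lower_gap :
    Tendsto (fun i => whithamV2 (a i) (b i) (c i)) l (𝓝 (12 * a₀ ^ 2 - 6 * c₀ ^ 2)) := by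
  have t := ((((tb.pow 2).add (ta.pow 2)).add (tc.pow 2)).const_mul 2).sub
    ((((tc.pow 2).sub (tb.pow 2)).const_mul 4).div (tendsto_sub_wSq_div ho he hec ta tb tc)
      (by norm_num))
  have e : 2 * (a₀ ^ 2 + a₀ ^ 2 + c₀ ^ 2) - 4 * (c₀ ^ 2 - a₀ ^ 2) / (1 / 2) =
    12 * a₀ ^ 2 - 6 * c₀ ^ 2 := by ring
  rw [e] at t
  refine t.congr' ?_
  filter_upwards [ho] with i hi
  have h1 := sq_lt_sq_of_nonneg hi.1 hi.2.1
  have h2 : b i ^ 2 - wSq (a i) (b i) (c i) ≠ 0 := by linarith [wSq_lt hi.1 hi.2.1 hi.2.2]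
  rw [whithamV2_eq hi.1 hi.2.1 hi.2.2, edgeVelocity]
  have h3 : b i ^ 2 - a i ^ 2 ≠ 0 := by linarith
  simp only [Pi.div_apply]
  field_simp
  ring

theorem tendsto_whithamV1_of_lower_gap :
    Tendsto (fun i => whithamV1 (a i) (b i) (c i)) l (𝓝 (12 * a₀ ^ 2 - 6 * c₀ ^ 2)) := by
  have t := ((((tb.pow 2).add (ta.pow 2)).add (tc.pow 2)).const_mul 2).sub
    ((((tc.pow 2).sub (ta.pow 2)).const_mul 4).div
      ((tendsto_sub_wSq_div ho he hec ta tb tc).const_sub 1) (by norm_num))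
  have e : 2 * (a₀ ^ 2 + a₀ ^ 2 + c₀ ^ 2) - 4 * (c₀ ^ 2 - a₀ ^ 2) / (1 - 1 / 2) =
    12 * a₀ ^ 2 - 6 * c₀ ^ 2 := by ring
  rw [e] at t
  refine t.congr' ?_
  filter_upwards [ho] with i hi
  have h1 := sq_lt_sq_of_nonneg hi.1 hi.2.1
  have h2 : a i ^ 2 - wSq (a i) (b i) (c i) ≠ 0 := by linarith [lt_wSq hi.1 hi.2.1 hi.2.2]
  have h3 : b i ^ 2 - a i ^ 2 ≠ 0 := by linarith
  have h4 : 1 - (b i ^ 2 - wSq (a i) (b i) (c i)) / (b i ^ 2 - a i ^ 2) =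
      -(a i ^ 2 - wSq (a i) (b i) (c i)) / (b i ^ 2 - a i ^ 2) := by
    field_simp; ring
  rw [whithamV1_eq hi.1 hi.2.1 hi.2.2, edgeVelocity]
  simp only [Pi.div_apply, h4]
  field_simp
  ring

end LowerGapCloses

/-! ### The upper band collapses -/

section UpperBandCloses

variable (ho : ∀ᶠ i in l, 0 ≤ a i ∧ a i < b i ∧ b i < c i) (ha : 0 ≤ a₀) (hab : a₀ < b₀)
  (ta : Tendsto a l (𝓝 a₀)) (tb : Tendsto b l (𝓝 b₀)) (tc : Tendsto c l (𝓝 b₀))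
include ho ha hab ta tb tc

theorem tendsto_wSq_of_upper_band : Tendsto (fun i => wSq (a i) (b i) (c i)) l (𝓝 (b₀ ^ 2)) := by
  have hD : b₀ ^ 2 - a₀ ^ 2 ≠ 0 := by nlinarith
  have tm : Tendsto (fun i => (b i ^ 2 - a i ^ 2) / (c i ^ 2 - a i ^ 2)) l (𝓝[<] 1) := by
    refine tendsto_nhdsWithin_iff.2 ⟨?_, ?_⟩
    · have := ((tb.pow 2).sub (ta.pow 2)).div ((tc.pow 2).sub (ta.pow 2)) hD
      rwa [div_self hD] at this
    · filter_upwards [ho] with i hi using (modulus_mem hi.1 hi.2.1 hi.2.2).2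
  have t := (tc.pow 2).sub (((tc.pow 2).sub (ta.pow 2)).mul (tendsto_ellipticRatio_one.comp tm))
  rw [mul_zero, sub_zero] at t
  exact t

/-- Here w² approaches the collapsing band too, but c² − w² is at least of the order of √(c² − b²),
so the ratio vanishes. V₃ is affine in the ratio r, and V₂ contains it as r/(1 − r). -/
theorem tendsto_sub_div_sub_wSq :
    Tendsto (fun i => (c i ^ 2 - b i ^ 2) / (c i ^ 2 - wSq (a i) (b i) (c i))) l (𝓝 0) := by
  have hD : b₀ ^ 2 - a₀ ^ 2 ≠ 0 := by nlinarith
  have t1 := (((tc.pow 2).sub (tb.pow 2)).div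
    ((tc.pow 2).sub (ta.pow 2)) hD).sqrt.const_mul (Real.pi / 2)
  simp only [sub_self, zero_div, Real.sqrt_zero, mul_zero] at t1
  refine tendsto_of_tendsto_of_tendsto_of_le_of_le' tendsto_const_nhds t1 ?_ ?_
  · filter_upwards [ho] with i hi
    have h2 := sq_lt_sq_of_nonneg (hi.1.trans hi.2.1.le) hi.2.2
    have := wSq_lt hi.1 hi.2.1 hi.2.2
    exact div_nonneg (by linarith) (by linarith)
  · filter_upwards [ho] with i hi using sub_div_sub_wSq_le hi.1 hi.2.1 hi.2.2

theorem tendsto_whithamV3_of_upper_band :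
    Tendsto (fun i => whithamV3 (a i) (b i) (c i)) l (𝓝 (2 * a₀ ^ 2 + 4 * b₀ ^ 2)) := by
  have t := ((((tc.pow 2).add (ta.pow 2)).add (tb.pow 2)).const_mul 2).add
    ((((tc.pow 2).sub (ta.pow 2)).const_mul 4).mul (tendsto_sub_div_sub_wSq ho ha hab ta tb tc))
  have e : 2 * (b₀ ^ 2 + a₀ ^ 2 + b₀ ^ 2) + 4 * (b₀ ^ 2 - a₀ ^ 2) * 0 =
    2 * a₀ ^ 2 + 4 * b₀ ^ 2 := by ring
  rw [e] at t
  refine t.congr' ?_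
  filter_upwards [ho] with i hi
  rw [whithamV3_eq hi.1 hi.2.1 hi.2.2, edgeVelocity]
  ring

theorem tendsto_whithamV2_of_upper_band :
    Tendsto (fun i => whithamV2 (a i) (b i) (c i)) l (𝓝 (2 * a₀ ^ 2 + 4 * b₀ ^ 2)) := by
  have tr := tendsto_sub_div_sub_wSq ho ha hab ta tb tc
  have t := ((((tb.pow 2).add (ta.pow 2)).add (tc.pow 2)).const_mul 2).sub
    ((((tb.pow 2).sub (ta.pow 2)).const_mul 4).mul (tr.div (tr.const_sub 1) (by norm_num)))
  have e : 2 * (b₀ ^ 2 + a₀ ^ 2 + b₀ ^ 2) - 4 * (b₀ ^ 2 - a₀ ^ 2) * (0 / (1 - 0)) =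
    2 * a₀ ^ 2 + 4 * b₀ ^ 2 := by ring
  rw [e] at t
  refine t.congr' ?_
  filter_upwards [ho] with i hi
  have h2 : b i ^ 2 - wSq (a i) (b i) (c i) ≠ 0 := by linarith [wSq_lt hi.1 hi.2.1 hi.2.2]
  have h3 : c i ^ 2 - wSq (a i) (b i) (c i) ≠ 0 := by
    linarith [wSq_lt hi.1 hi.2.1 hi.2.2, sq_lt_sq_of_nonneg (hi.1.trans hi.2.1.le) hi.2.2]
  have h4 : 1 - (c i ^ 2 - b i ^ 2) / (c i ^ 2 - wSq (a i) (b i) (c i)) =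
      (b i ^ 2 - wSq (a i) (b i) (c i)) / (c i ^ 2 - wSq (a i) (b i) (c i)) := by
    field_simp; ring
  rw [whithamV2_eq hi.1 hi.2.1 hi.2.2, edgeVelocity]
  simp only [Pi.div_apply, h4]
  field_simp
  ring

end UpperBandCloses

end Limits

/-! ### Integrals against the arcsine weight -/

theorem integral_one_div_one_sub_mul_sin_sq {n : ℝ} (hn : n < 1) :
    ∫ θ in (0 : ℝ)..(Real.pi / 2), 1 / (1 - n * Real.sin θ ^ 2) =
      Real.pi / (2 * Real.sqrt (1 - n)) := by
  set k := Real.sqrt (1 - n) with hk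
  have hk0 : 0 < k := Real.sqrt_pos.2 (by linarith)
  have hk2 : k ^ 2 = 1 - n := Real.sq_sqrt (by linarith)
  have hpos : ∀ θ : ℝ, 0 < 1 - n * Real.sin θ ^ 2 := fun θ => by
    rcases (sq_nonneg (Real.sin θ)).eq_or_lt with h | h
    · rw [← h]; norm_num
    · nlinarith [mul_pos (sub_pos.2 hn) h, Real.sin_sq_le_one θ]
  have hden : ∀ θ : ℝ, 0 < Real.cos θ ^ 2 + k * Real.sin θ ^ 2 := fun θ => by
    have := Real.sin_sq_add_cos_sq θ
    rcases (sq_nonneg (Real.sin θ)).eq_or_lt with h | h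
    · rw [← h] at this ⊢; linarith
    · have := mul_pos hk0 h
      nlinarith [sq_nonneg (Real.cos θ)]
  -- The antiderivative is arctan(k tan θ)/k, rewritten through tan(α − θ) with tan α = k tan θ. The
  -- new form has no singularity at π/2.
  have hd : ∀ θ, HasDerivAt (fun θ => (θ + Real.arctan ((k - 1) * (Real.sin θ * Real.cos θ) /
      (Real.cos θ ^ 2 + k * Real.sin θ ^ 2))) / k) (1 / (1 - n * Real.sin θ ^ 2)) θ := fun θ => by
    have hs := Real.hasDerivAt_sin θ
    have hc := Real.hasDerivAt_cos θ
    have h1 := ((hs.fun_mul hc).const_mul (k - 1)).fun_div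
      ((hc.fun_pow 2).fun_add ((hs.fun_pow 2).const_mul k)) (hden θ).ne'
    have h2 := ((hasDerivAt_id θ).fun_add h1.arctan).div_const k
    refine h2.congr_deriv ?_
    have e1 := Real.sin_sq_add_cos_sq θ
    have hp := hpos θ
    have hn2 : n = 1 - k ^ 2 := by linarith
    rw [hn2] at hp ⊢
    have hq := hden θ
    generalize Real.sin θ = s at *
    generalize Real.cos θ = c at *
    have e2 : 1 - (1 - k ^ 2) * s ^ 2 = c ^ 2 + k ^ 2 * s ^ 2 := by linear_combination -e1
    rw [e2] at hp ⊢
    have e3 : 1 + ((k - 1) * (s * c) / (c ^ 2 + k * s ^ 2)) ^ 2 =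
        (c ^ 2 + k ^ 2 * s ^ 2) / (c ^ 2 + k * s ^ 2) ^ 2 := by
      field_simp
      linear_combination (c ^ 2 + k ^ 2 * s ^ 2) * e1
    rw [e3]
    push_cast
    have e4 : s ^ 2 = 1 - c ^ 2 := by linarith
    field_simp
    simp only [e4]
    ring
  have hc : Continuous fun θ => 1 / (1 - n * Real.sin θ ^ 2) :=
    continuous_const.div (by fun_prop) fun θ => (hpos θ).ne'
  rw [intervalIntegral.integral_eq_sub_of_hasDerivAt (fun θ _ => hd θ) (hc.intervalIntegrable _ _)]
  simp
  field_simp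

section Arc

variable {p q : ℝ} (hpq : p < q)

/-- The parametrization of `(p, q)` that uniformizes the arcsine weight. -/
def arcParam (p q θ : ℝ) : ℝ := p + (q - p) * Real.sin θ ^ 2

@[fun_prop]
theorem continuous_arcParam (p q : ℝ) : Continuous (arcParam p q) := by
  unfold arcParam; fun_prop

theorem hasDerivAt_arcParam (p q θ : ℝ) :
    HasDerivAt (arcParam p q) ((q - p) * (2 * Real.sin θ * Real.cos θ)) θ := by
  have h := (((Real.hasDerivAt_sin θ).fun_pow 2).const_mul (q - p)).const_add p
  exact h.congr_deriv (by simp)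

include hpq

theorem arcParam_mem (θ : ℝ) : arcParam p q θ ∈ Icc p q := by
  have h := Real.sin_sq_le_one θ
  have h2 := sq_nonneg (Real.sin θ)
  constructor <;> unfold arcParam <;> nlinarith

theorem arcParam_injOn : InjOn (arcParam p q) (Ioo 0 (Real.pi / 2)) := by
  intro x hx y hy hxy
  have h1 : Real.sin x ^ 2 = Real.sin y ^ 2 := by
    have : (q - p) * Real.sin x ^ 2 = (q - p) * Real.sin y ^ 2 := by
      unfold arcParam at hxy; linarith
    exact mul_left_cancel₀ (by linarith) this
  have hpi := Real.pi_pos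
  have h2 := Real.sin_pos_of_mem_Ioo ⟨hx.1, by linarith [hx.2]⟩
  have h3 := Real.sin_pos_of_mem_Ioo ⟨hy.1, by linarith [hy.2]⟩
  exact Real.injOn_sin ⟨by linarith [hx.1], hx.2.le⟩ ⟨by linarith [hy.1], hy.2.le⟩
    ((pow_left_inj₀ h2.le h3.le two_ne_zero).1 h1)

theorem arcParam_image : arcParam p q '' Ioo 0 (Real.pi / 2) = Ioo p q := by
  have hpi := Real.pi_pos
  have e0 : arcParam p q 0 = p := by simp [arcParam]
  have e1 : arcParam p q (Real.pi / 2) = q := by simp [arcParam]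
  apply Subset.antisymm
  · rintro _ ⟨x, hx, rfl⟩
    have h2 := Real.sin_pos_of_mem_Ioo ⟨hx.1, by linarith [hx.2]⟩
    have h3 := Real.cos_pos_of_mem_Ioo ⟨by linarith [hx.1], hx.2⟩
    have h4 := Real.sin_sq_add_cos_sq x
    have h5 := mul_pos (sub_pos.2 hpq) (pow_pos h2 2)
    have h6 := mul_pos (sub_pos.2 hpq) (pow_pos h3 2)
    constructor <;> unfold arcParam <;> nlinarith
  · have := intermediate_value_Ioo (f := arcParam p q) (by positivity : (0 : ℝ) ≤ Real.pi / 2)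
      (continuous_arcParam p q).continuousOn
    rwa [e0, e1] at this

theorem sqrt_arcParam {θ : ℝ} (hθ : θ ∈ Ioo 0 (Real.pi / 2)) :
    Real.sqrt ((arcParam p q θ - p) * (q - arcParam p q θ)) =
      (q - p) * (Real.sin θ * Real.cos θ) ∧ 0 < (q - p) * (Real.sin θ * Real.cos θ) := by
  have hpi := Real.pi_pos
  have h2 := Real.sin_pos_of_mem_Ioo ⟨hθ.1, by linarith [hθ.2]⟩
  have h3 := Real.cos_pos_of_mem_Ioo ⟨by linarith [hθ.1], hθ.2⟩
  have h5 : 0 < (q - p) * (Real.sin θ * Real.cos θ) := mul_pos (by linarith) (mul_pos h2 h3)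
  refine ⟨?_, h5⟩
  rw [Real.sqrt_eq_iff_mul_self_eq_of_pos h5]
  unfold arcParam
  linear_combination (q - p) ^ 2 * Real.sin θ ^ 2 * Real.sin_sq_add_cos_sq θ

/-- The Jacobian is twice the value of the square root, so the arcsine weight disappears and a
factor 2 remains. -/
theorem arc_smul_eq (g : ℝ → ℝ) {θ : ℝ} (hθ : θ ∈ Ioo 0 (Real.pi / 2)) :
    |(q - p) * (2 * Real.sin θ * Real.cos θ)| • (g (arcParam p q θ) /
      Real.sqrt ((arcParam p q θ - p) * (q - arcParam p q θ))) = 2 * g (arcParam p q θ) := by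
  obtain ⟨h1, h2⟩ := sqrt_arcParam hpq hθ
  have h3 : (q - p) * (2 * Real.sin θ * Real.cos θ) = 2 * ((q - p) * (Real.sin θ * Real.cos θ)) := by
    ring
  rw [h1, h3, abs_of_pos (by positivity), smul_eq_mul]
  generalize (q - p) * (Real.sin θ * Real.cos θ) = X at h2
  field_simp

theorem integral_arc (g : ℝ → ℝ) :
    ∫ N in Ioo p q, g N / Real.sqrt ((N - p) * (q - N)) =
      ∫ θ in (0 : ℝ)..(Real.pi / 2), 2 * g (arcParam p q θ) := by
  rw [← arcParam_image hpq, integral_image_eq_integral_abs_deriv_smul measurableSet_Ioo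
    (fun θ _ => (hasDerivAt_arcParam p q θ).hasDerivWithinAt) (arcParam_injOn hpq),
    intervalIntegral.integral_of_le (by positivity), integral_Ioc_eq_integral_Ioo]
  exact setIntegral_congr_fun measurableSet_Ioo fun θ hθ => arc_smul_eq hpq g hθ

theorem integrableOn_arc {g : ℝ → ℝ} (hg : ContinuousOn g (Icc p q)) :
    IntegrableOn (fun N => g N / Real.sqrt ((N - p) * (q - N))) (Ioo p q) := by
  rw [← arcParam_image hpq, integrableOn_image_iff_integrableOn_abs_deriv_smul measurableSet_Ioo
    (fun θ _ => (hasDerivAt_arcParam p q θ).hasDerivWithinAt) (arcParam_injOn hpq)]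
  have hc : Continuous fun θ => 2 * g (arcParam p q θ) :=
    continuous_const.mul (hg.comp_continuous (continuous_arcParam p q) (arcParam_mem hpq))
  refine (hc.continuousOn.integrableOn_Icc.mono_set Ioo_subset_Icc_self).congr_fun ?_
    measurableSet_Ioo
  exact fun θ hθ => (arc_smul_eq hpq g hθ).symm

theorem integral_arc_affine (α β : ℝ) :
    ∫ N in Ioo p q, (α * N + β) / Real.sqrt ((N - p) * (q - N)) =
      Real.pi * (α * ((p + q) / 2) + β) := by
  have e : ∀ θ, 2 * (α * arcParam p q θ + β) =
      2 * (α * p + β) + 2 * α * (q - p) * Real.sin θ ^ 2 := fun θ => by unfold arcParam; ring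
  rw [integral_arc hpq (fun N => α * N + β)]
  simp only [e]
  rw [intervalIntegral.integral_add (by simp)
    ((by fun_prop : Continuous fun θ => 2 * α * (q - p) * Real.sin θ ^ 2).intervalIntegrable _ _),
    intervalIntegral.integral_const_mul (2 * α * (q - p)), integral_sin_sq]
  simp
  ring

theorem integral_arc_one : ∫ N in Ioo p q, 1 / Real.sqrt ((N - p) * (q - N)) = Real.pi := by
  simpa using integral_arc_affine hpq 0 1

/-- Read from right to left: 1/√((M − p)(M − q)) is an average of 1/(M − N) over the band (p, q).
This and its mirror image turn two-band integrals into double integrals. -/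
theorem integral_arc_cauchy_right {M : ℝ} (hM : q < M) :
    ∫ N in Ioo p q, 1 / (M - N) / Real.sqrt ((N - p) * (q - N)) =
      Real.pi / Real.sqrt ((M - p) * (M - q)) := by
  have h1 : 0 < M - p := by linarith
  have hn : (q - p) / (M - p) < 1 := by rw [div_lt_one h1]; linarith
  have e : ∀ θ, 2 * (1 / (M - arcParam p q θ)) =
      2 / (M - p) * (1 / (1 - (q - p) / (M - p) * Real.sin θ ^ 2)) := fun θ => by
    have h2 : M - arcParam p q θ = (M - p) * (1 - (q - p) / (M - p) * Real.sin θ ^ 2) := by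
      unfold arcParam; field_simp; ring
    rw [h2, one_div, mul_inv, div_mul_div_comm, mul_one, div_eq_mul_inv 2, mul_inv]
  rw [integral_arc hpq]
  simp only [e]
  rw [intervalIntegral.integral_const_mul, integral_one_div_one_sub_mul_sin_sq hn]
  have e2 : 1 - (q - p) / (M - p) = (M - p) * (M - q) / (M - p) ^ 2 := by field_simp; ring
  rw [e2, Real.sqrt_div' _ (by positivity), Real.sqrt_sq h1.le]
  field_simp

theorem integral_arc_cauchy_left {N : ℝ} (hN : N < p) :
    ∫ M in Ioo p q, 1 / (M - N) / Real.sqrt ((M - p) * (q - M)) =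
      Real.pi / Real.sqrt ((p - N) * (q - N)) := by
  have h1 : 0 < p - N := by linarith
  have hn : -((q - p) / (p - N)) < 1 := by
    have : 0 < (q - p) / (p - N) := div_pos (by linarith) h1
    linarith
  have e : ∀ θ, 2 * (1 / (arcParam p q θ - N)) =
      2 / (p - N) * (1 / (1 - -((q - p) / (p - N)) * Real.sin θ ^ 2)) := fun θ => by
    have h2 : arcParam p q θ - N = (p - N) * (1 - -((q - p) / (p - N)) * Real.sin θ ^ 2) := by
      unfold arcParam; field_simp; ring
    rw [h2, one_div, mul_inv, div_mul_div_comm, mul_one, div_eq_mul_inv 2, mul_inv]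
  rw [integral_arc hpq]
  simp only [e]
  rw [intervalIntegral.integral_const_mul, integral_one_div_one_sub_mul_sin_sq hn]
  have e2 : 1 - -((q - p) / (p - N)) = (p - N) * (q - N) / (p - N) ^ 2 := by field_simp; ring
  rw [e2, Real.sqrt_div' _ (by positivity), Real.sqrt_sq h1.le]
  field_simp

end Arc

/-! ### The two-band identity -/

section TwoBand

variable {p q r s : ℝ} (hpq : p < q) (hqr : q < r) (hrs : r < s)
include hpq hrs

theorem integrable_arc_prod {g : ℝ × ℝ → ℝ} (hg : ContinuousOn g (Icc r s ×ˢ Icc p q)) :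
    Integrable (fun z : ℝ × ℝ => g z *
      (1 / Real.sqrt ((z.1 - r) * (s - z.1)) * (1 / Real.sqrt ((z.2 - p) * (q - z.2)))))
      ((volume.restrict (Ioo r s)).prod (volume.restrict (Ioo p q))) := by
  have h1 := integrableOn_arc hrs (g := fun _ => 1) continuousOn_const
  have h2 := integrableOn_arc hpq (g := fun _ => 1) continuousOn_const
  have h3 := Integrable.mul_prod h1 h2
  have hsub : Ioo r s ×ˢ Ioo p q ⊆ Icc r s ×ˢ Icc p q :=
    prod_mono Ioo_subset_Icc_self Ioo_subset_Icc_self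
  obtain ⟨B, hB⟩ := (isCompact_Icc.prod isCompact_Icc).exists_bound_of_continuousOn hg
  have hm : MeasurableSet (Ioo r s ×ˢ Ioo p q) := measurableSet_Ioo.prod measurableSet_Ioo
  refine h3.bdd_mul (c := B) ?_ ?_
  · rw [Measure.prod_restrict]
    exact (hg.mono hsub).aestronglyMeasurable hm
  · rw [Measure.prod_restrict]
    exact (ae_restrict_iff' hm).2 (Eventually.of_forall fun z hz => hB z (hsub hz))

include hqr

/-- In each integral, the root belonging to the other band is replaced by a Cauchy average over that
band. With f(M) = αM² + βM + γ, both become double integrals over (r, s) × (p, q) with the same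
product weight and with kernels f(M)/(M − N) and f(N)/(M − N). Their difference has the kernel α(M +
N) + β, which splits into one-dimensional arcsine integrals. It is the residue at infinity of f over
the square root, obtained without contours. -/
theorem two_band_identity (α β γ : ℝ) :
    (∫ M in Ioo r s, (α * M ^ 2 + β * M + γ) /
        Real.sqrt ((M - p) * (M - q) * ((M - r) * (s - M)))) -
      ∫ N in Ioo p q, (α * N ^ 2 + β * N + γ) /
        Real.sqrt ((N - p) * (q - N) * ((r - N) * (s - N))) =
      Real.pi * (β + α * ((p + q + r + s) / 2)) := by
  set f : ℝ → ℝ := fun M => α * M ^ 2 + β * M + γ with hf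
  have hpi := Real.pi_pos
  set w : ℝ × ℝ → ℝ := fun z =>
    1 / Real.sqrt ((z.1 - r) * (s - z.1)) * (1 / Real.sqrt ((z.2 - p) * (q - z.2))) with hw
  have hne : ∀ z ∈ Icc r s ×ˢ Icc p q, z.1 - z.2 ≠ 0 := fun z hz => by
    have h1 := hz.1.1
    have h2 := hz.2.2
    linarith
  have i1 := integrable_arc_prod hpq hrs (g := fun z => f z.1 / (z.1 - z.2))
    (ContinuousOn.div (by fun_prop) (by fun_prop) hne)
  have i2 := integrable_arc_prod hpq hrs (g := fun z => f z.2 / (z.1 - z.2))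
    (ContinuousOn.div (by fun_prop) (by fun_prop) hne)
  have e1 : Real.pi * (∫ M in Ioo r s, f M / Real.sqrt ((M - p) * (M - q) * ((M - r) * (s - M))))
      = ∫ z, f z.1 / (z.1 - z.2) * w z
        ∂((volume.restrict (Ioo r s)).prod (volume.restrict (Ioo p q))) := by
    rw [integral_prod _ i1, ← integral_const_mul]
    refine setIntegral_congr_fun measurableSet_Ioo fun M hM => ?_
    have h1 : 0 < (M - p) * (M - q) := mul_pos (by linarith [hM.1]) (by linarith [hM.1])
    have e : ∀ N, f M / (M - N) * (1 / Real.sqrt ((M - r) * (s - M)) *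
        (1 / Real.sqrt ((N - p) * (q - N)))) = f M / Real.sqrt ((M - r) * (s - M)) *
        (1 / (M - N) / Real.sqrt ((N - p) * (q - N))) := fun N => by
      ring
    simp only [e]
    rw [integral_const_mul, integral_arc_cauchy_right hpq (hqr.trans hM.1), Real.sqrt_mul h1.le]
    ring
  have e2 : Real.pi * (∫ N in Ioo p q, f N / Real.sqrt ((N - p) * (q - N) * ((r - N) * (s - N))))
      = ∫ z, f z.2 / (z.1 - z.2) * w z
        ∂((volume.restrict (Ioo r s)).prod (volume.restrict (Ioo p q))) := by
    rw [integral_prod_symm _ i2, ← integral_const_mul]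
    refine setIntegral_congr_fun measurableSet_Ioo fun N hN => ?_
    have h1 : 0 < (N - p) * (q - N) := mul_pos (by linarith [hN.1]) (by linarith [hN.2])
    have e : ∀ M, f N / (M - N) * (1 / Real.sqrt ((M - r) * (s - M)) *
        (1 / Real.sqrt ((N - p) * (q - N)))) = f N / Real.sqrt ((N - p) * (q - N)) *
        (1 / (M - N) / Real.sqrt ((M - r) * (s - M))) := fun M => by
      ring
    simp only [e]
    rw [integral_const_mul, integral_arc_cauchy_left hrs (hN.2.trans hqr), Real.sqrt_mul h1.le]
    ring
  have a1 := Integrable.mul_prod (integrableOn_arc hrs (g := fun N => α * N + β) (by fun_prop))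
    (integrableOn_arc hpq (g := fun _ => 1) continuousOn_const)
  have a2 := Integrable.mul_prod (integrableOn_arc hrs (g := fun _ => 1) continuousOn_const)
    (integrableOn_arc hpq (g := fun N => α * N) (by fun_prop))
  have e3 : ∫ z, (f z.1 / (z.1 - z.2) * w z - f z.2 / (z.1 - z.2) * w z)
      ∂((volume.restrict (Ioo r s)).prod (volume.restrict (Ioo p q))) =
      ∫ z, ((α * z.1 + β) / Real.sqrt ((z.1 - r) * (s - z.1)) *
          (1 / Real.sqrt ((z.2 - p) * (q - z.2))) +
        1 / Real.sqrt ((z.1 - r) * (s - z.1)) *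
          (α * z.2 / Real.sqrt ((z.2 - p) * (q - z.2))))
      ∂((volume.restrict (Ioo r s)).prod (volume.restrict (Ioo p q))) := by
    rw [Measure.prod_restrict]
    refine setIntegral_congr_fun (measurableSet_Ioo.prod measurableSet_Ioo) fun z hz => ?_
    have h := hne z ⟨Ioo_subset_Icc_self hz.1, Ioo_subset_Icc_self hz.2⟩
    have h2 : f z.1 / (z.1 - z.2) - f z.2 / (z.1 - z.2) = α * (z.1 + z.2) + β := by
      simp only [hf]; field_simp; ring
    rw [← sub_mul, h2]
    simp only [hw]
    ring
  rw [integral_sub i1 i2, ← e1, ← e2, integral_add a1 a2,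
    integral_prod_mul (fun N => (α * N + β) / Real.sqrt ((N - r) * (s - N)))
      (fun N => 1 / Real.sqrt ((N - p) * (q - N))),
    integral_prod_mul (fun N => 1 / Real.sqrt ((N - r) * (s - N)))
      (fun N => α * N / Real.sqrt ((N - p) * (q - N))), integral_arc_one hpq, integral_arc_one hrs,
    integral_arc_affine hrs] at e3
  have e4 : ∫ N in Ioo p q, α * N / Real.sqrt ((N - p) * (q - N)) =
      Real.pi * (α * ((p + q) / 2)) := by simpa using integral_arc_affine hpq α 0
  rw [e4, ← mul_sub] at e3
  apply mul_left_cancel₀ hpi.ne'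
  rw [e3]
  ring

end TwoBand

/-! ### Vanishing gap periods -/

section Gap

variable {a b c : ℝ} (ha : 0 ≤ a) (hab : a < b) (hbc : b < c)
include ha hab hbc

theorem gap_integrableOn {f : ℝ → ℝ} (hf : Continuous f) :
    IntegrableOn (fun M => f M / Real.sqrt (c ^ 2 - M) /
      Real.sqrt ((M - a ^ 2) * (b ^ 2 - M))) (Ioo (a ^ 2) (b ^ 2)) := by
  have h1 := sq_lt_sq_of_nonneg ha hab
  have h2 := sq_lt_sq_of_nonneg (ha.trans hab.le) hbc
  refine integrableOn_arc h1 (g := fun M => f M / Real.sqrt (c ^ 2 - M))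
    (ContinuousOn.div (by fun_prop) (by fun_prop) fun M hM => ?_)
  exact (Real.sqrt_pos.2 (by linarith [hM.2])).ne'

/-- With M = a² + (b² − a²) sin² θ one has c² − M = (c² − a²)Δ², and the integral is proportional to
(c² − w²)K − (c² − a²)E. The number w² is defined so that this vanishes. -/
theorem gap_integral_linear : ∫ M in Ioo (a ^ 2) (b ^ 2), (M - wSq a b c) / Real.sqrt (c ^ 2 - M) /
    Real.sqrt ((M - a ^ 2) * (b ^ 2 - M)) = 0 := by
  have h1 := sq_lt_sq_of_nonneg ha hab
  have h2 := sq_lt_sq_of_nonneg (ha.trans hab.le) hbc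
  have hD : 0 < c ^ 2 - a ^ 2 := by linarith
  obtain ⟨m0, m1⟩ := modulus_mem ha hab hbc
  rw [integral_arc h1 (fun M => (M - wSq a b c) / Real.sqrt (c ^ 2 - M))]
  set m := (b ^ 2 - a ^ 2) / (c ^ 2 - a ^ 2) with hm
  have hsD : 0 < Real.sqrt (c ^ 2 - a ^ 2) := Real.sqrt_pos.2 hD
  have e : ∀ θ, 2 * ((arcParam (a ^ 2) (b ^ 2) θ - wSq a b c) /
      Real.sqrt (c ^ 2 - arcParam (a ^ 2) (b ^ 2) θ)) =
      2 / Real.sqrt (c ^ 2 - a ^ 2) * ((c ^ 2 - wSq a b c) * (1 / legendreDelta m θ) -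
        (c ^ 2 - a ^ 2) * legendreDelta m θ) := fun θ => by
    have e1 : c ^ 2 - arcParam (a ^ 2) (b ^ 2) θ = (c ^ 2 - a ^ 2) * (1 - m * Real.sin θ ^ 2) := by
      rw [hm]; unfold arcParam; field_simp; ring
    have e2 : arcParam (a ^ 2) (b ^ 2) θ - wSq a b c =
        (c ^ 2 - wSq a b c) - (c ^ 2 - a ^ 2) * legendreDelta m θ ^ 2 := by
      rw [legendreDelta_sq m0.le m1]; linarith
    have hp := legendreDelta_pos m0.le m1 θ
    have e3 : Real.sqrt (1 - m * Real.sin θ ^ 2) = legendreDelta m θ := rfl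
    rw [e1, Real.sqrt_mul hD.le, e2, e3]
    field_simp
  simp only [e]
  have c1 := (continuous_one_div_legendreDelta m0.le m1).intervalIntegrable
    (μ := volume) 0 (Real.pi / 2)
  have c2 := (continuous_legendreDelta m).intervalIntegrable (μ := volume) 0 (Real.pi / 2)
  rw [intervalIntegral.integral_const_mul, intervalIntegral.integral_sub (c1.const_mul _)
    (c2.const_mul _), intervalIntegral.integral_const_mul, intervalIntegral.integral_const_mul,
    ← ellipticK_eq, ← ellipticE_eq]
  have hK := (ellipticK_pos m0.le m1).ne'
  have e3 : c ^ 2 - wSq a b c = (c ^ 2 - a ^ 2) * (ellipticE m / ellipticK m) := by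
    simp only [wSq, muRatio, hm]; ring
  rw [e3]
  field_simp
  ring

/-- Let S be the sum of the squared edges. The numerator is one third of the derivative of (M −
a²)(M − b²)(M − c²), plus S/6 times M − w². The first part integrates to a square root that vanishes
at both gap edges. The second is the linear gap condition. The value of r² is exactly what makes
this decomposition work. -/
theorem gap_integral_quadratic :
    ∫ M in Ioo (a ^ 2) (b ^ 2), (M ^ 2 - hSq a b c * M - rSq a b c) / Real.sqrt (c ^ 2 - M) /
      Real.sqrt ((M - a ^ 2) * (b ^ 2 - M)) = 0 := by
  have h1 := sq_lt_sq_of_nonneg ha hab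
  have h2 := sq_lt_sq_of_nonneg (ha.trans hab.le) hbc
  set S := a ^ 2 + b ^ 2 + c ^ 2 with hS
  set e2 := a ^ 2 * b ^ 2 + b ^ 2 * c ^ 2 + c ^ 2 * a ^ 2 with he2
  have i1 := gap_integrableOn ha hab hbc (f := fun M => 3 * M ^ 2 - 2 * S * M + e2) (by fun_prop)
  have i2 := gap_integrableOn ha hab hbc (f := fun M => M - wSq a b c) (by fun_prop)
  have z1 : ∫ M in Ioo (a ^ 2) (b ^ 2), (3 * M ^ 2 - 2 * S * M + e2) / Real.sqrt (c ^ 2 - M) /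
      Real.sqrt ((M - a ^ 2) * (b ^ 2 - M)) = 0 := by
    rw [← integral_Ioc_eq_integral_Ioo, ← intervalIntegral.integral_of_le h1.le,
      intervalIntegral.integral_eq_sub_of_hasDerivAt_of_le h1.le
        (f := fun M => 2 * Real.sqrt ((M - a ^ 2) * (b ^ 2 - M) * (c ^ 2 - M)))]
    · simp
    · fun_prop
    · intro M hM
      have p1 : 0 < (M - a ^ 2) * (b ^ 2 - M) := mul_pos (by linarith [hM.1]) (by linarith [hM.2])
      have p2 : 0 < c ^ 2 - M := by linarith [hM.2]
      have d := (((((hasDerivAt_id M).sub_const (a ^ 2)).fun_mul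
        ((hasDerivAt_id M).const_sub (b ^ 2))).fun_mul
        ((hasDerivAt_id M).const_sub (c ^ 2))).sqrt (mul_pos p1 p2).ne').const_mul 2
      refine d.congr_deriv ?_
      simp only [id]
      rw [Real.sqrt_mul p1.le, div_div, mul_comm (Real.sqrt (c ^ 2 - M))]
      have q1 := Real.sqrt_pos.2 p1
      have q2 := Real.sqrt_pos.2 p2
      field_simp
      rw [hS, he2]
      ring
    · rw [intervalIntegrable_iff_integrableOn_Ioo_of_le h1.le]
      exact i1
  have e : ∀ M, (M ^ 2 - hSq a b c * M - rSq a b c) / Real.sqrt (c ^ 2 - M) /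
      Real.sqrt ((M - a ^ 2) * (b ^ 2 - M)) =
      1 / 3 * ((3 * M ^ 2 - 2 * S * M + e2) / Real.sqrt (c ^ 2 - M) /
      Real.sqrt ((M - a ^ 2) * (b ^ 2 - M))) + S / 6 * ((M - wSq a b c) / Real.sqrt (c ^ 2 - M) /
    Real.sqrt ((M - a ^ 2) * (b ^ 2 - M))) := fun M => by
    rw [rSq_eq, hSq, hS, he2]; ring
  simp only [e]
  rw [integral_add (i1.const_mul _) (i2.const_mul _), integral_const_mul, integral_const_mul, z1,
    gap_integral_linear ha hab hbc]
  simp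

end Gap

/-! ### The logarithmic kernel -/

/-- The kernel `log |(√M + √H)/(√M - √H)|`. -/
def logKernel (H M : ℝ) : ℝ :=
  Real.log |(Real.sqrt M + Real.sqrt H) / (Real.sqrt M - Real.sqrt H)|

theorem logKernel_eq {H M : ℝ} (hH : 0 < H) (hM : 0 < M) (hne : M ≠ H) :
    logKernel H M = 2 * Real.log (Real.sqrt M + Real.sqrt H) - Real.log |M - H| ∧
      0 < Real.sqrt M + Real.sqrt H ∧ 0 < |M - H| := by
  have h1 := Real.sqrt_pos.2 hH
  have h2 := Real.sqrt_pos.2 hM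
  have h3 : M - H = (Real.sqrt M - Real.sqrt H) * (Real.sqrt M + Real.sqrt H) := by
    have := Real.mul_self_sqrt hH.le
    have := Real.mul_self_sqrt hM.le
    linarith
  have h4 : Real.sqrt M - Real.sqrt H ≠ 0 := fun h0 => by
    rw [h0, zero_mul] at h3
    exact hne (by linarith)
  refine ⟨?_, by positivity, abs_pos.2 (sub_ne_zero.2 hne)⟩
  rw [logKernel, h3, Real.log_abs, Real.log_abs, Real.log_div (by positivity) h4,
    Real.log_mul h4 (by positivity)]
  ring

/-- For T < min(M, H) an antiderivative is −2 log(√(M − T) + √(H − T)). At T = min(M, H) one root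
vanishes and the other is √|M − H|. -/
theorem logKernel_integral {H M : ℝ} (hH : 0 < H) (hM : 0 < M) (hne : M ≠ H) :
    IntegrableOn (fun T => 1 / (Real.sqrt (M - T) * Real.sqrt (H - T))) (Ioo 0 H) ∧
      ∫ T in Ioo 0 H, 1 / (Real.sqrt (M - T) * Real.sqrt (H - T)) = logKernel H M := by
  obtain ⟨hk, h1, h2⟩ := logKernel_eq hH hM hne
  have hmin : 0 < min M H := lt_min hM hH
  have hpos : ∀ T ∈ Icc 0 (min M H), 0 < Real.sqrt (M - T) + Real.sqrt (H - T) := by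
    intro T hT
    have hT2 := le_min_iff.1 hT.2
    rcases hne.lt_or_gt with h | h
    · exact add_pos_of_nonneg_of_pos (Real.sqrt_nonneg _) (Real.sqrt_pos.2 (by linarith [hT2.1]))
    · exact add_pos_of_pos_of_nonneg (Real.sqrt_pos.2 (by linarith [hT2.2])) (Real.sqrt_nonneg _)
  have hc : ContinuousOn (fun T => -2 * Real.log (Real.sqrt (M - T) + Real.sqrt (H - T)))
      (Icc 0 (min M H)) :=
    continuousOn_const.mul (ContinuousOn.log (by fun_prop) fun T hT => (hpos T hT).ne')
  have hd : ∀ T ∈ Ioo 0 (min M H),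
      HasDerivAt (fun T => -2 * Real.log (Real.sqrt (M - T) + Real.sqrt (H - T)))
        (1 / (Real.sqrt (M - T) * Real.sqrt (H - T))) T := by
    intro T hT
    have hT2 := lt_min_iff.1 hT.2
    have p1 : 0 < M - T := by linarith [hT2.1]
    have p2 : 0 < H - T := by linarith [hT2.2]
    have q1 := Real.sqrt_pos.2 p1
    have q2 := Real.sqrt_pos.2 p2
    have d := (((((hasDerivAt_id T).const_sub M).sqrt p1.ne').fun_add
      (((hasDerivAt_id T).const_sub H).sqrt p2.ne')).log (add_pos q1 q2).ne').const_mul (-2)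
    refine d.congr_deriv ?_
    simp only [id]
    field_simp
    ring
  have hi := intervalIntegral.integrableOn_deriv_of_nonneg hc hd fun T _ => by positivity
  have hv := intervalIntegral.integral_eq_sub_of_hasDerivAt_of_le hmin.le hc hd
    ((intervalIntegrable_iff_integrableOn_Ioc_of_le hmin.le).2 hi)
  rw [intervalIntegral.integral_of_le hmin.le, integral_Ioc_eq_integral_Ioo] at hv
  rw [integrableOn_Ioc_iff_integrableOn_Ioo] at hi
  have hsub : Ioo 0 (min M H) ⊆ Ioo 0 H := Ioo_subset_Ioo_right (min_le_right _ _)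
  -- For M ≤ T the real square root of M − T is 0 and division by 0 gives 0, so the cut-off T < M is
  -- built into the integrand. The same convention serves throughout the half-range integrals below.
  have hz : ∀ T ∈ Ioo 0 H \ Ioo 0 (min M H), 1 / (Real.sqrt (M - T) * Real.sqrt (H - T)) = 0 := by
    intro T hT
    have h3 : M ≤ T := by
      by_contra! h4
      exact hT.2 ⟨hT.1.1, lt_min h4 hT.1.2⟩
    rw [Real.sqrt_eq_zero_of_nonpos (by linarith), zero_mul, div_zero]
  have hv2 : -2 * Real.log (Real.sqrt (M - min M H) + Real.sqrt (H - min M H)) =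
      -Real.log |M - H| := by
    have h5 : Real.sqrt (M - min M H) + Real.sqrt (H - min M H) = Real.sqrt |M - H| := by
      rcases hne.lt_or_gt with h | h
      · rw [min_eq_left h.le, abs_of_neg (by linarith)]; simp
      · rw [min_eq_right h.le, abs_of_pos (by linarith)]; simp
    rw [h5, Real.log_sqrt h2.le]
    ring
  refine ⟨hi.of_forall_sdiff_eq_zero measurableSet_Ioo hz, ?_⟩
  rw [setIntegral_eq_of_subset_of_forall_sdiff_eq_zero measurableSet_Ioo hsub hz, hv, hk, hv2]
  simp
  ring

theorem integral_inv_sqrt_sub {H : ℝ} (hH : 0 < H) :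
    IntegrableOn (fun T => 1 / Real.sqrt (H - T)) (Ioo 0 H) ∧
      ∫ T in Ioo 0 H, 1 / Real.sqrt (H - T) = 2 * Real.sqrt H := by
  have hc : ContinuousOn (fun T => -2 * Real.sqrt (H - T)) (Icc 0 H) := by fun_prop
  have hd : ∀ T ∈ Ioo 0 H, HasDerivAt (fun T => -2 * Real.sqrt (H - T))
      (1 / Real.sqrt (H - T)) T := by
    intro T hT
    have p2 : 0 < H - T := by linarith [hT.2]
    have d := (((hasDerivAt_id T).const_sub H).sqrt p2.ne').const_mul (-2)
    refine d.congr_deriv ?_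
    have q2 := Real.sqrt_pos.2 p2
    simp only [id]
    field_simp
  have hi := intervalIntegral.integrableOn_deriv_of_nonneg hc hd fun T _ => by positivity
  have hv := intervalIntegral.integral_eq_sub_of_hasDerivAt_of_le hH.le hc hd
    ((intervalIntegrable_iff_integrableOn_Ioc_of_le hH.le).2 hi)
  rw [intervalIntegral.integral_of_le hH.le, integral_Ioc_eq_integral_Ioo] at hv
  rw [integrableOn_Ioc_iff_integrableOn_Ioo] at hi
  exact ⟨hi, by rw [hv]; simp⟩

theorem integral_div_sqrt_sub {H : ℝ} (hH : 0 < H) :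
    IntegrableOn (fun T => T / Real.sqrt (H - T)) (Ioo 0 H) ∧
      ∫ T in Ioo 0 H, T / Real.sqrt (H - T) = 4 / 3 * (H * Real.sqrt H) := by
  have hc : ContinuousOn (fun T => -(2 / 3) * ((2 * H + T) * Real.sqrt (H - T))) (Icc 0 H) := by
    fun_prop
  have hd : ∀ T ∈ Ioo 0 H, HasDerivAt (fun T => -(2 / 3) * ((2 * H + T) * Real.sqrt (H - T)))
      (T / Real.sqrt (H - T)) T := by
    intro T hT
    have p2 : 0 < H - T := by linarith [hT.2]
    have d := (((hasDerivAt_id T).const_add (2 * H)).fun_mul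
      (((hasDerivAt_id T).const_sub H).sqrt p2.ne')).const_mul (-(2 / 3))
    refine d.congr_deriv ?_
    have q2 := Real.sqrt_pos.2 p2
    have q3 := Real.sq_sqrt p2.le
    simp only [id]
    field_simp
    rw [q3]
    ring
  have hi := intervalIntegral.integrableOn_deriv_of_nonneg hc hd fun T hT =>
    div_nonneg hT.1.le (Real.sqrt_nonneg _)
  have hv := intervalIntegral.integral_eq_sub_of_hasDerivAt_of_le hH.le hc hd
    ((intervalIntegrable_iff_integrableOn_Ioc_of_le hH.le).2 hi)
  rw [intervalIntegral.integral_of_le hH.le, integral_Ioc_eq_integral_Ioo] at hv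
  rw [integrableOn_Ioc_iff_integrableOn_Ioo] at hi
  refine ⟨hi, ?_⟩
  rw [hv]
  simp
  ring

/-! ### Integrability of the kernel against inverse square roots -/

theorem integrableOn_abs_sub_rpow {r : ℝ} (hr : -1 < r) (e u v : ℝ) :
    IntegrableOn (fun x => |x - e| ^ r) (Ioo u v) := by
  have h0 : ∀ y : ℝ, IntervalIntegrable (fun x : ℝ => |x| ^ r) volume 0 y := by
    have key : ∀ y : ℝ, 0 ≤ y → IntervalIntegrable (fun x : ℝ => |x| ^ r) volume 0 y :=
      fun y hy => (intervalIntegral.intervalIntegrable_rpow' (a := 0) (b := y) hr).congr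
        fun x hx => by
          rw [uIoc_of_le hy] at hx
          simp only [abs_of_pos hx.1]
    intro y
    rcases le_total 0 y with hy | hy
    · exact key y hy
    · have := (key (-y) (by linarith)).comp_sub_left 0
      simpa using this
  have h1 : IntervalIntegrable (fun x : ℝ => |x| ^ r) volume (u - e) (v - e) :=
    (h0 _).symm.trans (h0 _)
  have h2 := h1.comp_sub_right e
  rcases le_total u v with h | h
  · rw [sub_add_cancel, sub_add_cancel, intervalIntegrable_iff_integrableOn_Ioo_of_le h] at h2
    exact h2
  · rw [Ioo_eq_empty (not_lt.2 h)]; exact integrableOn_empty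

/-- The smaller of the two distances dominates, so the product is at most a sum of two powers of
exponent −3/4. The points d and e may coincide, as happens when H is a squared band edge. -/
theorem integrableOn_rpow_mul_rpow (e d u v : ℝ) :
    IntegrableOn (fun x => |x - d| ^ (-(1 / 4) : ℝ) * |x - e| ^ (-(1 / 2) : ℝ)) (Ioo u v) := by
  have h1 := integrableOn_abs_sub_rpow (r := -(3 / 4)) (by norm_num) d u v
  have h2 := integrableOn_abs_sub_rpow (r := -(3 / 4)) (by norm_num) e u v
  refine (h1.add h2).mono' (by fun_prop) ?_
  have hne : ∀ y : ℝ, ∀ᵐ x ∂(volume.restrict (Ioo u v)), x ≠ y := fun y =>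
    ae_restrict_of_ae (Measure.ae_ne volume y)
  filter_upwards [hne d, hne e] with x hxd hxe
  have p1 := abs_pos.2 (sub_ne_zero.2 hxd)
  have p2 := abs_pos.2 (sub_ne_zero.2 hxe)
  rw [Real.norm_of_nonneg (by positivity)]
  simp only [Pi.add_apply]
  rcases le_total |x - d| |x - e| with h | h
  · have h3 : |x - e| ^ (-(1 / 2) : ℝ) ≤ |x - d| ^ (-(1 / 2) : ℝ) :=
      Real.rpow_le_rpow_of_nonpos p1 h (by norm_num)
    have h4 : |x - d| ^ (-(1 / 4) : ℝ) * |x - d| ^ (-(1 / 2) : ℝ) = |x - d| ^ (-(3 / 4) : ℝ) := by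
      rw [← Real.rpow_add p1]; norm_num
    have h5 : 0 ≤ |x - e| ^ (-(3 / 4) : ℝ) := by positivity
    have h6 := mul_le_mul_of_nonneg_left h3 (by positivity : 0 ≤ |x - d| ^ (-(1 / 4) : ℝ))
    linarith
  · have h3 : |x - d| ^ (-(1 / 4) : ℝ) ≤ |x - e| ^ (-(1 / 4) : ℝ) :=
      Real.rpow_le_rpow_of_nonpos p2 h (by norm_num)
    have h4 : |x - e| ^ (-(1 / 4) : ℝ) * |x - e| ^ (-(1 / 2) : ℝ) = |x - e| ^ (-(3 / 4) : ℝ) := by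
      rw [← Real.rpow_add p2]; norm_num
    have h5 : 0 ≤ |x - d| ^ (-(3 / 4) : ℝ) := by positivity
    have h6 := mul_le_mul_of_nonneg_right h3 (by positivity : 0 ≤ |x - e| ^ (-(1 / 2) : ℝ))
    linarith

@[fun_prop]
theorem measurable_logKernel (H : ℝ) : Measurable (logKernel H) := by
  unfold logKernel
  fun_prop

/-- The inequality log z ≤ 4 z^(1/4) trades the logarithm for a power −1/4. This is weak enough to
stay integrable when multiplied by the singularity −1/2 of a band edge, even at the same point. -/
theorem abs_logKernel_le {H M X : ℝ} (hH : 0 < H) (hM : 0 < M) (hne : M ≠ H) (hHX : H ≤ X)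
    (hMX : M ≤ X) : |logKernel H M| ≤ 4 * (4 * X) ^ (1 / 4 : ℝ) * |M - H| ^ (-(1 / 4) : ℝ) := by
  obtain ⟨hk, h1, h2⟩ := logKernel_eq hH hM hne
  have hnn : 0 ≤ logKernel H M := by
    rw [← (logKernel_integral hH hM hne).2]
    exact integral_nonneg fun T => by positivity
  have hX : 0 < X := hH.trans_le hHX
  have hsq : (Real.sqrt M + Real.sqrt H) ^ 2 ≤ 4 * X := by
    have a1 := Real.sqrt_le_sqrt hHX
    have a2 := Real.sqrt_le_sqrt hMX
    have a3 := Real.sq_sqrt hX.le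
    nlinarith [Real.sqrt_nonneg M, Real.sqrt_nonneg H, Real.sqrt_nonneg X]
  have h3 : logKernel H M = Real.log ((Real.sqrt M + Real.sqrt H) ^ 2 / |M - H|) := by
    rw [Real.log_div (by positivity) h2.ne', Real.log_pow, hk]
    norm_num
  have h4 : Real.log ((Real.sqrt M + Real.sqrt H) ^ 2 / |M - H|) ≤
      ((Real.sqrt M + Real.sqrt H) ^ 2 / |M - H|) ^ (1 / 4 : ℝ) / (1 / 4) :=
    Real.log_le_rpow_div (by positivity) (by norm_num)
  have h5 : ((Real.sqrt M + Real.sqrt H) ^ 2 / |M - H|) ^ (1 / 4 : ℝ) ≤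
      (4 * X) ^ (1 / 4 : ℝ) * |M - H| ^ (-(1 / 4) : ℝ) := by
    rw [Real.rpow_neg h2.le, ← div_eq_mul_inv, ← Real.div_rpow (by positivity) h2.le]
    exact Real.rpow_le_rpow (by positivity) (by gcongr) (by norm_num)
  rw [abs_of_nonneg hnn, h3]
  linarith

theorem integrableOn_logKernel_mul {H : ℝ} (hH : 0 < H) {u v e : ℝ} (hu : 0 ≤ u) :
    IntegrableOn (fun M => logKernel H M * (1 / Real.sqrt |M - e|)) (Ioo u v) := by
  set X := max H v with hX
  have h := (integrableOn_rpow_mul_rpow e H u v).const_mul (4 * (4 * X) ^ (1 / 4 : ℝ))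
  refine h.mono' (by fun_prop) ?_
  filter_upwards [ae_restrict_mem measurableSet_Ioo, ae_restrict_of_ae (Measure.ae_ne volume H)]
    with M hM hne
  have h1 := abs_logKernel_le hH (hu.trans_lt hM.1) hne (le_max_left H v)
    (hM.2.le.trans (le_max_right H v))
  have h2 : 1 / Real.sqrt |M - e| = |M - e| ^ (-(1 / 2) : ℝ) := by
    rw [Real.rpow_neg (abs_nonneg _), Real.sqrt_eq_rpow, one_div]
  rw [h2, norm_mul, Real.norm_eq_abs, Real.norm_of_nonneg (by positivity)]
  calc _ ≤ _ := mul_le_mul_of_nonneg_right h1 (by positivity)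
    _ = _ := by ring

/-! ### Interchange of integrals -/

/-- As κ ≥ 0, integrating |κψ| in T gives |kψ|. Integrability of kψ is thus what Fubini requires,
and ψ may change sign. -/
theorem integral_mul_kernel_swap {S U : Set ℝ} {ψ : ℝ → ℝ} (hψ : Measurable ψ) {κ : ℝ → ℝ → ℝ}
    (hκ : Measurable (Function.uncurry κ)) (h0 : ∀ M T, 0 ≤ κ M T) {k : ℝ → ℝ}
    (hk : ∀ᵐ M ∂volume.restrict S, IntegrableOn (κ M) U ∧ ∫ T in U, κ M T = k M)
    (hint : IntegrableOn (fun M => k M * ψ M) S) :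
    IntegrableOn (fun T => ∫ M in S, κ M T * ψ M) U ∧
      ∫ M in S, k M * ψ M = ∫ T in U, ∫ M in S, κ M T * ψ M := by
  have hm : AEStronglyMeasurable (fun z : ℝ × ℝ => κ z.1 z.2 * ψ z.1)
      ((volume.restrict S).prod (volume.restrict U)) :=
    (hκ.mul (hψ.comp measurable_fst)).aestronglyMeasurable
  have hi : Integrable (fun z : ℝ × ℝ => κ z.1 z.2 * ψ z.1)
      ((volume.restrict S).prod (volume.restrict U)) := by
    rw [integrable_prod_iff hm]
    refine ⟨?_, ?_⟩
    · filter_upwards [hk] with M hM using hM.1.mul_const _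
    · refine hint.norm.congr ?_
      filter_upwards [hk] with M hM
      have hkn : 0 ≤ k M := by rw [← hM.2]; exact integral_nonneg fun T => h0 M T
      simp only [norm_mul, Real.norm_of_nonneg (h0 _ _), Real.norm_of_nonneg hkn]
      rw [integral_mul_const, hM.2]
  refine ⟨hi.integral_prod_right, ?_⟩
  rw [← integral_integral_swap hi]
  refine integral_congr_ae ?_
  filter_upwards [hk] with M hM
  rw [integral_mul_const, hM.2]

/-- From √(x + y) ≤ √x + √y. With x = M − p and y = q − M the sum is constant, so the two-edge
weight is dominated by two weights with one singularity each. -/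
theorem inv_sqrt_mul_le {x y : ℝ} (hx : 0 < x) (hy : 0 < y) :
    1 / Real.sqrt (x * y) ≤
      1 / Real.sqrt (x + y) * (1 / Real.sqrt x) + 1 / Real.sqrt (x + y) * (1 / Real.sqrt y) := by
  have h1 := Real.sqrt_pos.2 hx
  have h2 := Real.sqrt_pos.2 hy
  have h3 := Real.sqrt_pos.2 (add_pos hx hy)
  have h4 : Real.sqrt (x + y) ≤ Real.sqrt x + Real.sqrt y := by
    refine Real.sqrt_le_iff.2 ⟨by positivity, ?_⟩
    nlinarith [Real.sq_sqrt hx.le, Real.sq_sqrt hy.le, mul_pos h1 h2]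
  rw [Real.sqrt_mul hx.le]
  have e : 1 / Real.sqrt (x + y) * (1 / Real.sqrt x) + 1 / Real.sqrt (x + y) * (1 / Real.sqrt y) =
    (Real.sqrt x + Real.sqrt y) / Real.sqrt (x + y) * (1 / (Real.sqrt x * Real.sqrt y)) := by
    field_simp
    ring
  rw [e]
  have h5 : 1 ≤ (Real.sqrt x + Real.sqrt y) / Real.sqrt (x + y) := by rwa [one_le_div h3]
  exact le_mul_of_one_le_left (by positivity) h5

theorem integrableOn_logKernel_arc {H p q : ℝ} (hH : 0 < H) (hp : 0 ≤ p) {g : ℝ → ℝ}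
    (hg : ContinuousOn g (Icc p q)) :
    IntegrableOn (fun M => logKernel H M * (g M / Real.sqrt ((M - p) * (q - M)))) (Ioo p q) := by
  have h1 := (integrableOn_logKernel_mul hH (v := q) (e := p) hp).norm.const_mul
    (1 / Real.sqrt (q - p))
  have h2 := (integrableOn_logKernel_mul hH (v := q) (e := q) hp).norm.const_mul
    (1 / Real.sqrt (q - p))
  have h3 : IntegrableOn (fun M => logKernel H M * (1 / Real.sqrt ((M - p) * (q - M))))
      (Ioo p q) := by
    refine (h1.add h2).mono' (by fun_prop) ?_
    filter_upwards [ae_restrict_mem measurableSet_Ioo] with M hM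
    have a1 : 0 < M - p := by linarith [hM.1]
    have a2 : 0 < q - M := by linarith [hM.2]
    have h := inv_sqrt_mul_le a1 a2
    have e1 : M - p + (q - M) = q - p := by ring
    rw [e1] at h
    have h' := mul_le_mul_of_nonneg_left h (norm_nonneg (logKernel H M))
    simp only [Pi.add_apply, norm_mul, Real.norm_of_nonneg (one_div_nonneg.2 (Real.sqrt_nonneg _))]
    rw [abs_of_pos a1, abs_sub_comm, abs_of_pos a2]
    linarith
  obtain ⟨B, hB⟩ := isCompact_Icc.exists_bound_of_continuousOn hg
  have h4 := h3.bdd_mul (f := g) (c := B)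
    ((hg.mono Ioo_subset_Icc_self).aestronglyMeasurable measurableSet_Ioo)
    ((ae_restrict_iff' measurableSet_Ioo).2
      (Eventually.of_forall fun M hM => hB M (Ioo_subset_Icc_self hM)))
  exact h4.congr (Eventually.of_forall fun M => by ring)

/-- The reduced half-space integral of an affine function of `T`. -/
theorem integral_affine_div_sqrt_sub {H : ℝ} (hH : 0 < H) (x y : ℝ) :
    IntegrableOn (fun T => 1 / Real.sqrt (H - T) * (x + y * T)) (Ioo 0 H) ∧
      ∫ T in Ioo 0 H, 1 / Real.sqrt (H - T) * (x + y * T) =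
        (2 * x + 4 / 3 * y * H) * Real.sqrt H := by
  obtain ⟨i1, v1⟩ := integral_inv_sqrt_sub hH
  obtain ⟨i2, v2⟩ := integral_div_sqrt_sub hH
  have e : ∀ T, 1 / Real.sqrt (H - T) * (x + y * T) =
      x * (1 / Real.sqrt (H - T)) + y * (T / Real.sqrt (H - T)) := fun T => by ring
  simp only [e]
  refine ⟨(i1.const_mul x).add (i2.const_mul y), ?_⟩
  rw [integral_add (i1.const_mul x) (i2.const_mul y), integral_const_mul, integral_const_mul, v1, v2]
  ring

/-- The integral representation of the kernel is inserted and the order exchanged. By the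
square-root convention the inner integral sees only the part of S above T, so the dispersion
relation becomes an Abel integral over T. -/
theorem copson_swap {S : Set ℝ} (hS : ∀ᵐ M ∂volume.restrict S, 0 < M) {ψ : ℝ → ℝ}
    (hψ : Measurable ψ) {H : ℝ} (hH : 0 < H)
    (hint : IntegrableOn (fun M => logKernel H M * ψ M) S) :
    ∫ M in S, logKernel H M * ψ M =
      ∫ T in Ioo 0 H, 1 / Real.sqrt (H - T) * ∫ M in S, ψ M / Real.sqrt (M - T) := by
  have h := (integral_mul_kernel_swap (U := Ioo 0 H) hψ
    (κ := fun M T => 1 / (Real.sqrt (M - T) * Real.sqrt (H - T)))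
    (by simp only [Function.uncurry_def]; fun_prop) (fun M T => by positivity) (k := logKernel H) (by
      filter_upwards [hS, ae_restrict_of_ae (Measure.ae_ne volume H)] with M hM hne
      exact logKernel_integral hH hM hne) hint).2
  rw [h]
  refine integral_congr_ae (Eventually.of_forall fun T => ?_)
  simp only
  rw [← integral_const_mul]
  exact integral_congr_ae (Eventually.of_forall fun M => by simp only; ring)

/-! ### Genus 0 -/

/-- For T < H ≤ A the inner integral runs over (T, A) with the arcsine weight, so it is affine in T,
and the remaining Abel integral is elementary. -/
theorem genus0_logIntegral {A : ℝ} (α β : ℝ) {H : ℝ} (hH : 0 < H) (hHA : H ≤ A) :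
    IntegrableOn (fun M => logKernel H M * ((α * M + β) / Real.sqrt (A - M))) (Ioo 0 A) ∧
    ∫ M in Ioo 0 A, logKernel H M * ((α * M + β) / Real.sqrt (A - M)) =
      Real.pi * (2 * (α * A / 2 + β) + 2 / 3 * α * H) * Real.sqrt H := by
  have hi : IntegrableOn (fun M => logKernel H M * ((α * M + β) / Real.sqrt (A - M)))
      (Ioo 0 A) := by
    -- The factor √M in g cancels the artificial singularity at 0 of the two-edge weight.
    refine (integrableOn_logKernel_arc hH le_rfl (q := A)
      (g := fun M => Real.sqrt M * (α * M + β)) (by fun_prop)).congr_fun (fun M hM => ?_)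
      measurableSet_Ioo
    have h1 := Real.sqrt_pos.2 hM.1
    simp only [sub_zero]
    rw [Real.sqrt_mul hM.1.le, mul_div_mul_left _ _ h1.ne']
  refine ⟨hi, ?_⟩
  rw [copson_swap (by filter_upwards [ae_restrict_mem measurableSet_Ioo] with M hM using hM.1)
    (by fun_prop) hH hi]
  have e : ∀ T ∈ Ioo 0 H, 1 / Real.sqrt (H - T) *
      ∫ M in Ioo 0 A, (α * M + β) / Real.sqrt (A - M) / Real.sqrt (M - T) =
      1 / Real.sqrt (H - T) * (Real.pi * (α * A / 2 + β) + Real.pi * α / 2 * T) := by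
    intro T hT
    have hTA : T < A := hT.2.trans_le hHA
    have h2 := integral_arc_affine hTA α β
    rw [setIntegral_eq_of_subset_of_forall_sdiff_eq_zero measurableSet_Ioo
      (Ioo_subset_Ioo_left hT.1.le : Ioo T A ⊆ Ioo 0 A)]
    · congr 1
      trans ∫ N in Ioo T A, (α * N + β) / Real.sqrt ((N - T) * (A - N))
      · refine setIntegral_congr_fun measurableSet_Ioo fun M hM => ?_
        rw [Real.sqrt_mul (by linarith [hM.1]), div_div, mul_comm (Real.sqrt (A - M))]
      · rw [h2]; ring
    · intro M hM
      have h3 : M ≤ T := by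
        by_contra! h4
        exact hM.2 ⟨h4, hM.1.2⟩
      rw [Real.sqrt_eq_zero_of_nonpos (by linarith : M - T ≤ 0), div_zero]
  rw [setIntegral_congr_fun measurableSet_Ioo e, (integral_affine_div_sqrt_sub hH _ _).2]
  ring

/-! ### Genus 1 -/

/-- A density on the two bands `(0, A)`, `(B, C)` with quadratic numerator, in the variable
`M = μ²`. -/
def bandDensity (A B C α β γ M : ℝ) : ℝ :=
  (if M ≤ A then -1 else 1) * (α * M ^ 2 + β * M + γ) /
    Real.sqrt ((M - A) * (M - B) * (C - M))

/-- The continuation of the density to the gap `(A, B)`. -/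
def gapDensity (A B C α β γ M : ℝ) : ℝ :=
  (α * M ^ 2 + β * M + γ) / Real.sqrt (C - M) / Real.sqrt ((M - A) * (B - M))

theorem measurable_bandDensity (A B C α β γ : ℝ) : Measurable (bandDensity A B C α β γ) := by
  unfold bandDensity
  refine Measurable.div (Measurable.mul ?_ (by fun_prop)) (by fun_prop)
  exact Measurable.ite measurableSet_Iic measurable_const measurable_const

theorem measurable_gapDensity (A B C α β γ : ℝ) : Measurable (gapDensity A B C α β γ) := by
  unfold gapDensity
  fun_prop

theorem div_sqrt_div_sqrt {f x y z : ℝ} (hx : 0 ≤ x) (h : x * y = z) :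
    f / Real.sqrt x / Real.sqrt y = f / Real.sqrt z := by
  rw [div_div, ← Real.sqrt_mul hx, h]

section Genus1

variable {A B C : ℝ} (hA : 0 ≤ A) (hAB : A < B) (hBC : B < C) (α β γ : ℝ)
include hA hAB hBC

-- The two-band identity with branch points A, B, C and T. For T < A the intervals are (T, A), (B,
-- C) and the gap term vanishes. For A < T < B they are (A, T), (B, C), and for T > B they are (A,
-- B), (T, C), with one interval inside the gap. The affine part has the same form in all three
-- cases.
omit hA in
theorem bandDensity_inner {T : ℝ} (hT0 : 0 < T) (hTC : T < C) (hTA : T ≠ A) (hTB : T ≠ B) :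
    ∫ M in Ioo 0 A ∪ Ioo B C, bandDensity A B C α β γ M / Real.sqrt (M - T) =
      Real.pi * (β + α * ((A + B + C + T) / 2)) +
        ∫ M in Ioo A B, gapDensity A B C α β γ M / Real.sqrt (T - M) := by
  have hzero : ∀ M, M ≤ T → bandDensity A B C α β γ M / Real.sqrt (M - T) = 0 := fun M hM => by
    rw [Real.sqrt_eq_zero_of_nonpos (by linarith : M - T ≤ 0), div_zero]
  have hzero' : ∀ M, T ≤ M → gapDensity A B C α β γ M / Real.sqrt (T - M) = 0 := fun M hM => by
    rw [Real.sqrt_eq_zero_of_nonpos (by linarith : T - M ≤ 0), div_zero]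
  have hup : ∀ M, B < M → M < C → T < M →
      bandDensity A B C α β γ M / Real.sqrt (M - T) = (α * M ^ 2 + β * M + γ) /
        Real.sqrt ((M - A) * (M - B) * ((M - T) * (C - M))) := fun M h1 h2 h3 => by
    rw [bandDensity, if_neg (by linarith), one_mul]
    refine div_sqrt_div_sqrt ?_ (by ring)
    have := mul_pos (mul_pos (show 0 < M - A by linarith) (show 0 < M - B by linarith))
      (show 0 < C - M by linarith)
    exact this.le
  have hgap : ∀ M, A < M → M < B → gapDensity A B C α β γ M / Real.sqrt (T - M) =
      (α * M ^ 2 + β * M + γ) / Real.sqrt ((M - A) * (B - M) * ((T - M) * (C - M))) :=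
    fun M h1 h2 => by
      have p1 : 0 ≤ C - M := by linarith
      have p2 : 0 ≤ (M - A) * (B - M) := mul_nonneg (by linarith) (by linarith)
      rw [gapDensity, div_sqrt_div_sqrt p1 rfl]
      exact div_sqrt_div_sqrt (mul_nonneg p1 p2) (by ring)
  rcases hTA.lt_or_gt with h1 | h1
  · have hlow : ∀ M ∈ Ioo T A, bandDensity A B C α β γ M / Real.sqrt (M - T) =
        -((α * M ^ 2 + β * M + γ) / Real.sqrt ((M - T) * (A - M) * ((B - M) * (C - M)))) :=
      fun M hM => by
        rw [bandDensity, if_pos hM.2.le, neg_one_mul, ← neg_div]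
        refine div_sqrt_div_sqrt ?_ (by ring)
        have := mul_pos (mul_pos (show 0 < A - M by linarith [hM.2])
          (show 0 < B - M by linarith [hM.2])) (show 0 < C - M by linarith [hM.2])
        nlinarith
    have hlz : ∀ M ∈ Ioo 0 A \ Ioo T A, bandDensity A B C α β γ M / Real.sqrt (M - T) = 0 :=
      fun M hM => hzero M (by
        by_contra! h4
        exact hM.2 ⟨h4, hM.1.2⟩)
    have i1 : IntegrableOn (fun M => bandDensity A B C α β γ M / Real.sqrt (M - T)) (Ioo 0 A) := by
      refine IntegrableOn.of_forall_sdiff_eq_zero (s := Ioo T A) ?_ measurableSet_Ioo hlz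
      refine (integrableOn_arc h1
        (g := fun M => -((α * M ^ 2 + β * M + γ) / Real.sqrt ((B - M) * (C - M))))
        (ContinuousOn.neg (ContinuousOn.div (by fun_prop) (by fun_prop) fun M hM => ?_))).congr_fun
        (fun M hM => ?_) measurableSet_Ioo
      · exact (Real.sqrt_pos.2 (mul_pos (by linarith [hM.2]) (by linarith [hM.2]))).ne'
      · rw [hlow M hM]
        simp only
        rw [neg_div, div_sqrt_div_sqrt (mul_nonneg (by linarith [hM.2]) (by linarith [hM.2]))]
        ring
    have i2 : IntegrableOn (fun M => bandDensity A B C α β γ M / Real.sqrt (M - T)) (Ioo B C) := by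
      refine (integrableOn_arc hBC
        (g := fun M => (α * M ^ 2 + β * M + γ) / Real.sqrt ((M - A) * (M - T)))
        (ContinuousOn.div (by fun_prop) (by fun_prop) fun M hM => ?_)).congr_fun
        (fun M hM => ?_) measurableSet_Ioo
      · exact (Real.sqrt_pos.2 (mul_pos (by linarith [hM.1]) (by linarith [hM.1]))).ne'
      · simp only
        rw [hup M hM.1 hM.2 (by linarith [hM.1]),
          div_sqrt_div_sqrt (mul_nonneg (by linarith [hM.1]) (by linarith [hM.1]))]
        ring
    rw [setIntegral_union (by
        rw [Set.disjoint_left]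
        intro x hx hx2
        linarith [hx.2, hx2.1]) measurableSet_Ioo i1 i2,
      setIntegral_eq_of_subset_of_forall_sdiff_eq_zero measurableSet_Ioo
        (Ioo_subset_Ioo_left hT0.le : Ioo T A ⊆ Ioo 0 A) hlz,
      setIntegral_congr_fun measurableSet_Ioo hlow, integral_neg,
      setIntegral_eq_zero_of_forall_eq_zero fun M hM => hzero' M (by linarith [hM.1])]
    have h := two_band_identity h1 hAB hBC α β γ
    rw [setIntegral_congr_fun measurableSet_Ioo
      fun M hM => hup M hM.1 hM.2 (by linarith [hM.1])]
    have e : ∫ M in Ioo B C, (α * M ^ 2 + β * M + γ) /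
        Real.sqrt ((M - A) * (M - B) * ((M - T) * (C - M))) =
        ∫ M in Ioo B C, (α * M ^ 2 + β * M + γ) /
        Real.sqrt ((M - T) * (M - A) * ((M - B) * (C - M))) := by
      congr 1; ext M; congr 2; ring
    rw [e]
    linarith
  have hz2 : ∀ M ∈ (Ioo 0 A ∪ Ioo B C) \ Ioo B C,
      bandDensity A B C α β γ M / Real.sqrt (M - T) = 0 := fun M hM => by
    rcases hM.1 with h | h
    · exact hzero M (by linarith [h.2])
    · exact absurd h hM.2
  rw [setIntegral_eq_of_subset_of_forall_sdiff_eq_zero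
    (measurableSet_Ioo.union measurableSet_Ioo) subset_union_right hz2]
  rcases hTB.lt_or_gt with h2 | h2
  · have h := two_band_identity h1 h2 hBC α β γ
    rw [setIntegral_congr_fun measurableSet_Ioo
      fun M hM => hup M hM.1 hM.2 (by linarith [hM.1]),
      setIntegral_eq_of_subset_of_forall_sdiff_eq_zero measurableSet_Ioo
        (Ioo_subset_Ioo_right h2.le : Ioo A T ⊆ Ioo A B) (fun M hM => hzero' M (by
          by_contra! h4
          exact hM.2 ⟨hM.1.1, h4⟩)),
      setIntegral_congr_fun measurableSet_Ioo fun M hM => hgap M hM.1 (hM.2.trans h2)]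
    have e : ∫ M in Ioo B C, (α * M ^ 2 + β * M + γ) /
        Real.sqrt ((M - A) * (M - B) * ((M - T) * (C - M))) =
        ∫ M in Ioo B C, (α * M ^ 2 + β * M + γ) /
        Real.sqrt ((M - A) * (M - T) * ((M - B) * (C - M))) := by
      congr 1; ext M; congr 2; ring
    have e' : ∫ M in Ioo A T, (α * M ^ 2 + β * M + γ) /
        Real.sqrt ((M - A) * (B - M) * ((T - M) * (C - M))) =
        ∫ M in Ioo A T, (α * M ^ 2 + β * M + γ) /
        Real.sqrt ((M - A) * (T - M) * ((B - M) * (C - M))) := by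
      congr 1; ext M; congr 2; ring
    rw [e, e']
    linarith
  · have h := two_band_identity hAB h2 hTC α β γ
    rw [setIntegral_eq_of_subset_of_forall_sdiff_eq_zero measurableSet_Ioo
        (Ioo_subset_Ioo_left h2.le : Ioo T C ⊆ Ioo B C) (fun M hM => hzero M (by
          by_contra! h4
          exact hM.2 ⟨h4, hM.1.2⟩)),
      setIntegral_congr_fun measurableSet_Ioo fun M hM => hup M (h2.trans hM.1) hM.2 hM.1,
      setIntegral_congr_fun measurableSet_Ioo fun M hM => hgap M hM.1 hM.2]
    linarith

theorem integrableOn_logKernel_bandDensity {H : ℝ} (hH : 0 < H) :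
    IntegrableOn (fun M => logKernel H M * bandDensity A B C α β γ M) (Ioo 0 A ∪ Ioo B C) := by
  refine IntegrableOn.union ?_ ?_
  · refine (integrableOn_logKernel_arc hH le_rfl (q := A)
      (g := fun M => Real.sqrt M * -((α * M ^ 2 + β * M + γ) / Real.sqrt ((B - M) * (C - M))))
      (ContinuousOn.mul (by fun_prop) (ContinuousOn.neg (ContinuousOn.div (by fun_prop)
        (by fun_prop) fun M hM => ?_)))).congr_fun (fun M hM => ?_) measurableSet_Ioo
    · exact (Real.sqrt_pos.2 (mul_pos (by linarith [hM.2]) (by linarith [hM.2]))).ne'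
    · have h1 := Real.sqrt_pos.2 hM.1
      simp only [sub_zero]
      rw [Real.sqrt_mul hM.1.le, mul_div_mul_left _ _ h1.ne', bandDensity, if_pos hM.2.le, neg_div,
        div_sqrt_div_sqrt (z := (M - A) * (M - B) * (C - M))
          (mul_nonneg (by linarith [hM.2]) (by linarith [hM.2])) (by ring)]
      ring
  · refine (integrableOn_logKernel_arc hH (hA.trans hAB.le) (q := C)
      (g := fun M => (α * M ^ 2 + β * M + γ) / Real.sqrt (M - A))
      (ContinuousOn.div (by fun_prop) (by fun_prop) fun M hM => ?_)).congr_fun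
      (fun M hM => ?_) measurableSet_Ioo
    · exact (Real.sqrt_pos.2 (by linarith [hM.1])).ne'
    · simp only
      rw [bandDensity, if_neg (by linarith [hM.1]), one_mul,
        div_sqrt_div_sqrt (z := (M - A) * (M - B) * (C - M)) (by linarith [hM.1]) (by ring)]

omit hA in
theorem integrableOn_gapDensity : IntegrableOn (gapDensity A B C α β γ) (Ioo A B) := by
  refine integrableOn_arc hAB (g := fun M => (α * M ^ 2 + β * M + γ) / Real.sqrt (C - M))
    (ContinuousOn.div (by fun_prop) (by fun_prop) fun M hM => ?_)
  exact (Real.sqrt_pos.2 (by linarith [hM.2])).ne'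

/-- Exchange the integrals. If H ≤ A, then T < M throughout and the kernel is zero. If H ≥ B, the
integral of 1/√((T − M)(H − T)) over (M, H) is π whatever M is, so the result is π times the gap
period. The constant k below is 0 or π accordingly. -/
theorem gapDensity_abel (hgap : ∫ M in Ioo A B, gapDensity A B C α β γ M = 0) {H : ℝ}
    (hH : H ≤ A ∨ B ≤ H) :
    IntegrableOn (fun T => 1 / Real.sqrt (H - T) *
      ∫ M in Ioo A B, gapDensity A B C α β γ M / Real.sqrt (T - M)) (Ioo 0 H) ∧
    ∫ T in Ioo 0 H, 1 / Real.sqrt (H - T) *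
      ∫ M in Ioo A B, gapDensity A B C α β γ M / Real.sqrt (T - M) = 0 := by
  obtain ⟨k, hk⟩ : ∃ k : ℝ, ∀ M ∈ Ioo A B,
      IntegrableOn (fun T => 1 / (Real.sqrt (T - M) * Real.sqrt (H - T))) (Ioo 0 H) ∧
      ∫ T in Ioo 0 H, 1 / (Real.sqrt (T - M) * Real.sqrt (H - T)) = k := by
    rcases hH with hH | hH
    · refine ⟨0, fun M hM => ?_⟩
      have hz : ∀ T ∈ Ioo 0 H, 1 / (Real.sqrt (T - M) * Real.sqrt (H - T)) = 0 := fun T hT => by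
        rw [Real.sqrt_eq_zero_of_nonpos (by linarith [hT.2, hM.1]), zero_mul, div_zero]
      exact ⟨integrableOn_zero.congr_fun (fun T hT => (hz T hT).symm) measurableSet_Ioo,
        setIntegral_eq_zero_of_forall_eq_zero hz⟩
    · refine ⟨Real.pi, fun M hM => ?_⟩
      have hMH : M < H := hM.2.trans_le hH
      have hsub : Ioo M H ⊆ Ioo 0 H := Ioo_subset_Ioo_left (hA.trans hM.1.le)
      have hz : ∀ T ∈ Ioo 0 H \ Ioo M H, 1 / (Real.sqrt (T - M) * Real.sqrt (H - T)) = 0 := by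
        intro T hT
        have : T ≤ M := by
          by_contra! h4
          exact hT.2 ⟨h4, hT.1.2⟩
        rw [Real.sqrt_eq_zero_of_nonpos (by linarith), zero_mul, div_zero]
      have he : ∀ T ∈ Ioo M H, 1 / Real.sqrt ((T - M) * (H - T)) =
          1 / (Real.sqrt (T - M) * Real.sqrt (H - T)) := fun T hT => by
        rw [Real.sqrt_mul (by linarith [hT.1])]
      refine ⟨IntegrableOn.of_forall_sdiff_eq_zero ((integrableOn_arc hMH (g := fun _ => 1)
        continuousOn_const).congr_fun he measurableSet_Ioo) measurableSet_Ioo hz, ?_⟩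
      rw [setIntegral_eq_of_subset_of_forall_sdiff_eq_zero measurableSet_Ioo hsub hz,
        ← setIntegral_congr_fun measurableSet_Ioo he, integral_arc_one hMH]
  have h := integral_mul_kernel_swap (S := Ioo A B) (U := Ioo 0 H)
    (measurable_gapDensity A B C α β γ)
    (κ := fun M T => 1 / (Real.sqrt (T - M) * Real.sqrt (H - T)))
    (by simp only [Function.uncurry_def]; fun_prop) (fun M T => by positivity) (k := fun _ => k)
    ((ae_restrict_iff' measurableSet_Ioo).2 (Eventually.of_forall hk))
    ((integrableOn_gapDensity hAB hBC α β γ).const_mul k)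
  have e : ∀ T, ∫ M in Ioo A B, 1 / (Real.sqrt (T - M) * Real.sqrt (H - T)) *
      gapDensity A B C α β γ M = 1 / Real.sqrt (H - T) *
      ∫ M in Ioo A B, gapDensity A B C α β γ M / Real.sqrt (T - M) := fun T => by
    rw [← integral_const_mul]
    exact integral_congr_ae (Eventually.of_forall fun M => by simp only; ring)
  simp only [e] at h
  refine ⟨h.1, ?_⟩
  rw [← h.2, integral_const_mul, hgap, mul_zero]

/-- Only the affine part of `bandDensity_inner` contributes. The coefficient γ is absent from the
value: its sole role is to make the gap period vanish. -/
theorem genus1_logIntegral (hgap : ∫ M in Ioo A B, gapDensity A B C α β γ M = 0) {H : ℝ}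
    (hH : 0 < H) (hHb : H ≤ A ∨ B ≤ H) (hHC : H ≤ C) :
    ∫ M in Ioo 0 A ∪ Ioo B C, logKernel H M * bandDensity A B C α β γ M =
      Real.pi * (2 * (β + α * (A + B + C) / 2) + 2 / 3 * α * H) * Real.sqrt H := by
  rw [copson_swap (by
      filter_upwards [ae_restrict_mem (measurableSet_Ioo.union measurableSet_Ioo)] with M hM
      rcases hM with h | h
      · exact h.1
      · linarith [h.1]) (measurable_bandDensity A B C α β γ) hH
    (integrableOn_logKernel_bandDensity hA hAB hBC α β γ hH)]
  obtain ⟨i1, v1⟩ := integral_affine_div_sqrt_sub hH (Real.pi * (β + α * (A + B + C) / 2))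
    (Real.pi * α / 2)
  obtain ⟨i2, v2⟩ := gapDensity_abel hA hAB hBC α β γ hgap hHb
  trans ∫ T in Ioo 0 H, (1 / Real.sqrt (H - T) * (Real.pi * (β + α * (A + B + C) / 2) +
      Real.pi * α / 2 * T) + 1 / Real.sqrt (H - T) *
      ∫ M in Ioo A B, gapDensity A B C α β γ M / Real.sqrt (T - M))
  · refine integral_congr_ae ?_
    filter_upwards [ae_restrict_mem measurableSet_Ioo, ae_restrict_of_ae (Measure.ae_ne volume A),
      ae_restrict_of_ae (Measure.ae_ne volume B)] with T hT hTA hTB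
    rw [bandDensity_inner hAB hBC α β γ hT.1 (hT.2.trans_le hHC) hTA hTB]
    ring
  · rw [integral_add i1 i2, v1, v2]
    ring

end Genus1

/-! ### Condensates of genus 0 and 1 are in equilibrium -/

theorem image_sq_Ioo {u v : ℝ} (hu : 0 ≤ u) (hv : 0 ≤ v) :
    (fun x : ℝ => x ^ 2) '' Ioo u v = Ioo (u ^ 2) (v ^ 2) := by
  ext y
  constructor
  · rintro ⟨x, hx, rfl⟩
    exact ⟨sq_lt_sq_of_nonneg hu hx.1, sq_lt_sq_of_nonneg (hu.trans hx.1.le) hx.2⟩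
  · intro hy
    rcases lt_or_ge u v with huv | huv
    · refine ⟨Real.sqrt y, ⟨Real.lt_sqrt_of_sq_lt hy.1, ?_⟩, Real.sq_sqrt ?_⟩
      · exact (Real.sqrt_lt' (hu.trans_lt huv)).2 hy.2
      · nlinarith [hy.1]
    · have := pow_le_pow_left₀ hv huv 2
      linarith [hy.1, hy.2]

namespace Condensate

theorem dos_genus0_of_mem {a η : ℝ} (h : η ∈ Icc 0 a) :
    (genus0 a).dos η = η / (Real.pi * Real.sqrt (a ^ 2 - η ^ 2)) := by
  rw [dos]; exact indicator_of_mem h _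

theorem dos_genus0_of_notMem {a η : ℝ} (h : η ∉ Icc 0 a) : (genus0 a).dos η = 0 := by
  rw [dos]; exact indicator_of_notMem h _

theorem dos_genus1_of_mem {a b c η : ℝ} (h : η ∈ Icc 0 a ∪ Icc b c) :
    (genus1 a b c).dos η = (if η ≤ a then -1 else 1) * (η * (η ^ 2 - wSq a b c)) /
      (Real.pi * Real.sqrt ((η ^ 2 - a ^ 2) * (η ^ 2 - b ^ 2) * (c ^ 2 - η ^ 2))) := by
  rw [dos]; exact indicator_of_mem h _

theorem dos_genus1_of_notMem {a b c η : ℝ} (h : η ∉ Icc 0 a ∪ Icc b c) :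
    (genus1 a b c).dos η = 0 := by
  rw [dos]; exact indicator_of_notMem h _

/-- The substitution M = μ², with 2μ as Jacobian. The set S is the support without a null set, so
that 0 and the band edges need not be considered. -/
theorem hasLogIntegral_of_sq {C : Condensate} {S : Set ℝ} (hS : MeasurableSet S)
    (hS0 : ∀ μ ∈ S, 0 < μ) (hsupp : C.support =ᵐ[volume] S) {f ψ : ℝ → ℝ}
    (hf : ∀ μ ∈ S, f μ = 2 * μ * ψ (μ ^ 2)) {η : ℝ} (hη : 0 ≤ η) {v : ℝ}
    (hi : IntegrableOn (fun M => logKernel (η ^ 2) M * ψ M) ((fun x : ℝ => x ^ 2) '' S))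
    (hv : ∫ M in (fun x : ℝ => x ^ 2) '' S, logKernel (η ^ 2) M * ψ M = v) :
    C.HasLogIntegral η f v := by
  have hd : ∀ x ∈ S, HasDerivWithinAt (fun x : ℝ => x ^ 2) (2 * x) S x := fun x _ => by
    simpa using (hasDerivAt_pow 2 x).hasDerivWithinAt
  have hinj : InjOn (fun x : ℝ => x ^ 2) S := fun x hx y hy h =>
    (pow_left_inj₀ (hS0 x hx).le (hS0 y hy).le two_ne_zero).1 h
  have e : ∀ x ∈ S, |2 * x| • (logKernel (η ^ 2) (x ^ 2) * ψ (x ^ 2)) =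
      Real.log |(x + η) / (x - η)| * f x := fun x hx => by
    have h0 := hS0 x hx
    rw [logKernel, Real.sqrt_sq h0.le, Real.sqrt_sq hη, hf x hx, abs_of_pos (by positivity),
      smul_eq_mul]
    ring
  rw [integrableOn_image_iff_integrableOn_abs_deriv_smul hS hd hinj] at hi
  rw [integral_image_eq_integral_abs_deriv_smul hS hd hinj] at hv
  refine ⟨(hi.congr_fun e hS).congr_set_ae hsupp, ?_⟩
  rw [setIntegral_congr_set hsupp, ← hv]
  exact (setIntegral_congr_fun hS e).symm

theorem hasLogIntegral_zero (C : Condensate) (f : ℝ → ℝ) : C.HasLogIntegral 0 f 0 := by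
  have e : ∀ μ : ℝ, Real.log |(μ + 0) / (μ - 0)| * f μ = 0 := fun μ => by
    rcases eq_or_ne μ 0 with h | h <;> simp [h]
  simp only [HasLogIntegral, e]
  simp

/-- The equation of state follows from the two dispersion relations. -/
theorem IsEquilibrium.of_dispersion {C : Condensate} (ho : C.Ordered) (hn : ∀ η, 0 ≤ C.dos η)
    (hu : ∀ η ∈ C.support, 0 < η → C.HasLogIntegral η C.dos η)
    (hv : ∀ η ∈ C.support, 0 < η → C.HasLogIntegral η C.flux (4 * η ^ 3))
    (h0 : ∀ η ∈ C.support, 0 ≤ η) : C.IsEquilibrium := by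
  refine ⟨ho, hn, fun η hη => ?_, fun η hη => ?_, fun η hη hpos => ?_⟩
  · rcases (h0 η hη).eq_or_lt with h | h
    · rw [← h]; exact hasLogIntegral_zero C _
    · exact hu η hη h
  · rcases (h0 η hη).eq_or_lt with h | h
    · rw [← h]; simpa using hasLogIntegral_zero C C.flux
    · exact hv η hη h
  · obtain ⟨i1, v1⟩ := hu η hη hpos
    obtain ⟨i2, v2⟩ := hv η hη hpos
    have e : ∀ μ, Real.log |(μ + η) / (μ - η)| * (C.dos μ * (C.velocity η - C.velocity μ)) =
        C.velocity η * (Real.log |(μ + η) / (μ - η)| * C.dos μ) -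
          Real.log |(μ + η) / (μ - η)| * C.flux μ := fun μ => by rw [flux]; ring
    refine ⟨C.velocity η * η - 4 * η ^ 3, ⟨?_, ?_⟩, ?_⟩
    · simp only [e]
      exact (i1.const_mul _).sub i2
    · simp only [e]
      rw [integral_sub (i1.const_mul _) i2, integral_const_mul, v1, v2]
    · field_simp
      ring

theorem isEquilibrium_genus0 {a : ℝ} (ha : 0 ≤ a) : (genus0 a).IsEquilibrium := by
  have hsupp : (genus0 a).support =ᵐ[volume] Ioo 0 a := Ioo_ae_eq_Icc.symm
  have hsq : (fun x : ℝ => x ^ 2) '' Ioo 0 a = Ioo 0 (a ^ 2) := by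
    simpa using image_sq_Ioo (u := 0) (v := a) le_rfl ha
  have hdos : ∀ μ ∈ Ioo 0 a, (genus0 a).dos μ = μ / (Real.pi * Real.sqrt (a ^ 2 - μ ^ 2)) :=
    fun μ hμ => dos_genus0_of_mem (Ioo_subset_Icc_self hμ)
  have hpi := Real.pi_pos
  refine IsEquilibrium.of_dispersion ha (fun η => ?_) (fun η hη hpos => ?_) (fun η hη hpos => ?_)
    fun η hη => hη.1
  · by_cases hη : η ∈ Icc 0 a
    · rw [dos_genus0_of_mem hη]
      exact div_nonneg hη.1 (by positivity)
    · rw [dos_genus0_of_notMem hη]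
  -- The density is 2μ times 1/(2π√(a² − M)), which fixes the coefficients.
  · obtain ⟨i, v⟩ := genus0_logIntegral 0 (1 / (2 * Real.pi)) (A := a ^ 2) (pow_pos hpos 2)
      (pow_le_pow_left₀ hpos.le hη.2 2)
    refine hasLogIntegral_of_sq measurableSet_Ioo (fun μ hμ => hμ.1) hsupp
      (ψ := fun M => (0 * M + 1 / (2 * Real.pi)) / Real.sqrt (a ^ 2 - M)) (fun μ hμ => ?_) hpos.le
      (by rwa [hsq]) ?_
    · rw [hdos μ hμ]
      field_simp
      ring
    · rw [hsq, v, Real.sqrt_sq hpos.le]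
      field_simp
      ring
  -- The flux is 2μ(6M − 3a²)/(π√(a² − M)). The terms not containing H cancel in the value, and 4H√H
  -- = 4η³ is left.
  · obtain ⟨i, v⟩ := genus0_logIntegral (6 / Real.pi) (-(3 * a ^ 2 / Real.pi)) (A := a ^ 2)
      (pow_pos hpos 2) (pow_le_pow_left₀ hpos.le hη.2 2)
    refine hasLogIntegral_of_sq measurableSet_Ioo (fun μ hμ => hμ.1) hsupp
      (ψ := fun M => (6 / Real.pi * M + -(3 * a ^ 2 / Real.pi)) / Real.sqrt (a ^ 2 - M))
      (fun μ hμ => ?_) hpos.le (by rwa [hsq]) ?_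
    · rw [flux, hdos μ hμ, velocity]
      field_simp
      ring
    · rw [hsq, v, Real.sqrt_sq hpos.le]
      field_simp
      ring

section Genus1

variable {a b c : ℝ} (ha : 0 ≤ a) (hab : a < b) (hbc : b < c)
include ha hab hbc

theorem velocity_den_ne {η : ℝ} (h0 : 0 ≤ η) (h : η ≤ a ∨ b ≤ η) : η ^ 2 - wSq a b c ≠ 0 := by
  have h1 := lt_wSq ha hab hbc
  have h2 := wSq_lt ha hab hbc
  rcases h with h | h
  · have := pow_le_pow_left₀ h0 h 2
    linarith
  · have := pow_le_pow_left₀ (ha.trans hab.le) h 2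
    linarith

theorem isEquilibrium_genus1 : (genus1 a b c).IsEquilibrium := by
  have hb := ha.trans hab.le
  have hA : 0 ≤ a ^ 2 := by positivity
  have hAB := sq_lt_sq_of_nonneg ha hab
  have hBC := sq_lt_sq_of_nonneg hb hbc
  have hw1 := lt_wSq ha hab hbc
  have hw2 := wSq_lt ha hab hbc
  have hsupp : (genus1 a b c).support =ᵐ[volume] (Ioo 0 a ∪ Ioo b c : Set ℝ) :=
    (ae_eq_set_union Ioo_ae_eq_Icc Ioo_ae_eq_Icc).symm
  have hsq : (fun x : ℝ => x ^ 2) '' (Ioo 0 a ∪ Ioo b c) =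
      Ioo 0 (a ^ 2) ∪ Ioo (b ^ 2) (c ^ 2) := by
    rw [image_union, image_sq_Ioo le_rfl ha, image_sq_Ioo hb (hb.trans hbc.le)]
    simp
  have hsub : Ioo 0 a ∪ Ioo b c ⊆ (Icc 0 a ∪ Icc b c : Set ℝ) :=
    union_subset_union Ioo_subset_Icc_self Ioo_subset_Icc_self
  have hdos : ∀ μ ∈ Ioo 0 a ∪ Ioo b c, (genus1 a b c).dos μ =
      (if μ ≤ a then -1 else 1) * (μ * (μ ^ 2 - wSq a b c)) /
        (Real.pi * Real.sqrt ((μ ^ 2 - a ^ 2) * (μ ^ 2 - b ^ 2) * (c ^ 2 - μ ^ 2))) :=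
    fun μ hμ => dos_genus1_of_mem (hsub hμ)
  have hpi := Real.pi_pos
  have hSpos : ∀ μ ∈ (Ioo 0 a ∪ Ioo b c : Set ℝ), 0 < μ := fun μ hμ => by
    rcases hμ with h | h
    · exact h.1
    · exact hb.trans_lt h.1
  have hif : ∀ μ ∈ (Ioo 0 a ∪ Ioo b c : Set ℝ), (if μ ^ 2 ≤ a ^ 2 then (-1 : ℝ) else 1) =
      if μ ≤ a then -1 else 1 := fun μ hμ => by
    simp only [pow_le_pow_iff_left₀ (hSpos μ hμ).le ha two_ne_zero]
  have hsplit : ∀ η ∈ (genus1 a b c).support, η ^ 2 ≤ a ^ 2 ∨ b ^ 2 ≤ η ^ 2 := fun η hη => by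
    rcases hη with h | h
    · exact Or.inl (pow_le_pow_left₀ h.1 h.2 2)
    · exact Or.inr (pow_le_pow_left₀ hb h.1 2)
  have hle : ∀ η ∈ (genus1 a b c).support, η ^ 2 ≤ c ^ 2 := fun η hη => by
    rcases hη with h | h
    · exact pow_le_pow_left₀ h.1 (h.2.trans (hab.trans hbc).le) 2
    · exact pow_le_pow_left₀ (hb.trans h.1) h.2 2
  refine IsEquilibrium.of_dispersion ⟨ha, hab, hbc⟩ (fun η => ?_) (fun η hη hpos => ?_)
    (fun η hη hpos => ?_) fun η hη => ?_
  · by_cases hη : η ∈ Icc 0 a ∪ Icc b c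
    swap
    · rw [dos_genus1_of_notMem hη]
    rw [dos_genus1_of_mem hη]
    refine div_nonneg ?_ (by positivity)
    rcases hη with h | h
    · rw [if_pos h.2]
      have h2 := pow_le_pow_left₀ h.1 h.2 2
      nlinarith [mul_nonneg h.1 (show 0 ≤ wSq a b c - η ^ 2 by linarith)]
    · rw [if_neg (by linarith [h.1]), one_mul]
      have h2 := pow_le_pow_left₀ hb h.1 2
      exact mul_nonneg (hb.trans h.1) (by linarith)
  · have hgap : ∫ M in Ioo (a ^ 2) (b ^ 2), gapDensity (a ^ 2) (b ^ 2) (c ^ 2) 0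
        (1 / (2 * Real.pi)) (-(wSq a b c / (2 * Real.pi))) M = 0 := by
      refine Eq.trans ?_ (mul_eq_zero_of_right (1 / (2 * Real.pi)) (gap_integral_linear ha hab hbc))
      rw [← integral_const_mul]
      refine integral_congr_ae (Eventually.of_forall fun M => ?_)
      simp only [gapDensity]
      ring
    have v := genus1_logIntegral hA hAB hBC _ _ _ hgap (pow_pos hpos 2) (hsplit η hη) (hle η hη)
    refine hasLogIntegral_of_sq (measurableSet_Ioo.union measurableSet_Ioo) hSpos hsupp
      (ψ := bandDensity (a ^ 2) (b ^ 2) (c ^ 2) 0 (1 / (2 * Real.pi))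
        (-(wSq a b c / (2 * Real.pi)))) (fun μ hμ => ?_) hpos.le ?_ ?_
    · rw [hdos μ hμ, bandDensity, hif μ hμ]
      field_simp
      ring
    · rw [hsq]
      exact integrableOn_logKernel_bandDensity hA hAB hBC _ _ _ (pow_pos hpos 2)
    · rw [hsq, v, Real.sqrt_sq hpos.le]
      field_simp
      ring
  -- Here β + α(A + B + C)/2 = 0 precisely because h² is half the sum of the squared edges. Only the
  -- term 4η³ survives.
  · have hgap : ∫ M in Ioo (a ^ 2) (b ^ 2), gapDensity (a ^ 2) (b ^ 2) (c ^ 2) (6 / Real.pi)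
        (-(6 / Real.pi * hSq a b c)) (-(6 / Real.pi * rSq a b c)) M = 0 := by
      refine Eq.trans ?_ (mul_eq_zero_of_right (6 / Real.pi) (gap_integral_quadratic ha hab hbc))
      rw [← integral_const_mul]
      refine integral_congr_ae (Eventually.of_forall fun M => ?_)
      simp only [gapDensity]
      ring
    have v := genus1_logIntegral hA hAB hBC _ _ _ hgap (pow_pos hpos 2) (hsplit η hη) (hle η hη)
    refine hasLogIntegral_of_sq (measurableSet_Ioo.union measurableSet_Ioo) hSpos hsupp
      (ψ := bandDensity (a ^ 2) (b ^ 2) (c ^ 2) (6 / Real.pi)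
        (-(6 / Real.pi * hSq a b c)) (-(6 / Real.pi * rSq a b c))) (fun μ hμ => ?_) hpos.le ?_ ?_
    · have hne := velocity_den_ne ha hab hbc (hSpos μ hμ).le
        (by rcases hμ with h | h
            · exact Or.inl h.2.le
            · exact Or.inr h.1.le)
      rw [flux, hdos μ hμ, bandDensity, hif μ hμ, velocity]
      field_simp
      ring
    · rw [hsq]
      exact integrableOn_logKernel_bandDensity hA hAB hBC _ _ _ (pow_pos hpos 2)
    · rw [hsq, v, Real.sqrt_sq hpos.le, hSq]
      field_simp
      ring
  · rcases hη with h | h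
    · exact h.1
    · exact hb.trans h.1

end Genus1

end Condensate

/-! ### Self-similar weak solutions of a balance law -/

/-- Boundedness of G is replaced by its sign: a nonnegative derivative of a continuous function is
integrable. The interval is split at each exceptional point in turn. -/
theorem intervalIntegrable_of_hasDerivAt_off_finset (S : Finset ℝ) {P G : ℝ → ℝ}
    (hP : Continuous P) (hG : ∀ x, 0 ≤ G x) {u v : ℝ} (huv : u ≤ v)
    (hd : ∀ x ∈ Ioo u v, x ∉ S → HasDerivAt P (-G x) x) : IntervalIntegrable G volume u v := by
  classical
  induction S using Finset.induction_on generalizing u v with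
  | empty =>
    rw [intervalIntegrable_iff_integrableOn_Ioc_of_le huv]
    refine intervalIntegral.integrableOn_deriv_of_nonneg (g := fun x => -P x)
      hP.neg.continuousOn (fun x hx => ?_) fun x _ => hG x
    exact (hd x hx (by simp)).neg.congr_deriv (neg_neg _)
  | insert e S he ih =>
    by_cases h : e ∈ Ioo u v
    · refine (ih h.1.le fun x hx hxS => hd x ⟨hx.1, hx.2.trans h.2⟩ ?_).trans
        (ih h.2.le fun x hx hxS => hd x ⟨h.1.trans hx.1, hx.2⟩ ?_)
      · simp only [Finset.mem_insert, not_or]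
        exact ⟨hx.2.ne, hxS⟩
      · simp only [Finset.mem_insert, not_or]
        exact ⟨hx.1.ne', hxS⟩
    · refine ih huv fun x hx hxS => hd x hx ?_
      simp only [Finset.mem_insert, not_or]
      exact ⟨fun hxe => h (hxe ▸ hx), hxS⟩

theorem hasDerivAt_slice_fst {ψ : ℝ × ℝ → ℝ} (hψ : Differentiable ℝ ψ) (x t : ℝ) :
    HasDerivAt (fun y => ψ (y, t)) (fderiv ℝ ψ (x, t) (1, 0)) x :=
  (hψ (x, t)).hasFDerivAt.comp_hasDerivAt x ((hasDerivAt_id x).prodMk (hasDerivAt_const x t))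

theorem hasDerivAt_slice_snd {ψ : ℝ × ℝ → ℝ} (hψ : Differentiable ℝ ψ) (x t : ℝ) :
    HasDerivAt (fun τ => ψ (x, τ)) (fderiv ℝ ψ (x, t) (0, 1)) t :=
  (hψ (x, t)).hasFDerivAt.comp_hasDerivAt t ((hasDerivAt_const t x).prodMk (hasDerivAt_id t))

theorem fderiv_fderiv_comm {φ : ℝ × ℝ → ℝ} (hφ : ContDiff ℝ ((⊤ : ℕ∞) : WithTop ℕ∞) φ)
    (p v w : ℝ × ℝ) :
    fderiv ℝ (fun q => fderiv ℝ φ q v) p w = fderiv ℝ (fun q => fderiv ℝ φ q w) p v := by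
  have hd : DifferentiableAt ℝ (fderiv ℝ φ) p :=
    ((hφ.fderiv_right (m := 1) (by norm_cast)).differentiable (by norm_num)) p
  have e : ∀ v w : ℝ × ℝ, fderiv ℝ (fun q => fderiv ℝ φ q v) p w =
      fderiv ℝ (fderiv ℝ φ) p w v := fun v w => by
    rw [fderiv_clm_apply hd (differentiableAt_const v)]
    simp
  rw [e, e]
  exact (hφ.contDiffAt.isSymmSndFDerivAt (by
    rw [minSmoothness_of_isRCLikeNormedField]
    exact WithTop.coe_le_coe.2 (le_top : (2 : ℕ∞) ≤ ⊤))).eq w v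

/-- The primitive `Q` of `g dx - f dt` for a self-similar solution with profile `P = F - ξ G`,
with the value at `t = 0` given by `q`. -/
def selfSimilarPotential (P : ℝ → ℝ) (q x t : ℝ) : ℝ := if t = 0 then x * q else -(t * P (x / t))

section SelfSimilar

variable {G F : ℝ → ℝ} {s₁ s₂ gL gR fL fR : ℝ} {S : Finset ℝ}

/-- Off a finite set G is minus a derivative, and derivatives are measurable. -/
theorem profile_measurable (hP : Continuous fun ξ => F ξ - ξ * G ξ)
    (hd : ∀ ξ ∉ S, HasDerivAt (fun ξ => F ξ - ξ * G ξ) (-G ξ) ξ) : Measurable G ∧ Measurable F := by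
  have hG : Measurable G := by
    have h1 : Measurable fun ξ => -deriv (fun ξ => F ξ - ξ * G ξ) ξ := (measurable_deriv _).neg
    refine h1.measurable_of_countable_ne (S.countable_toSet.mono fun ξ hξ => ?_)
    by_contra hS
    exact hξ (by rw [(hd ξ hS).deriv, neg_neg])
  refine ⟨hG, ?_⟩
  have : F = fun ξ => (F ξ - ξ * G ξ) + ξ * G ξ := by ext; ring
  rw [this]
  exact hP.measurable.add (measurable_id.mul hG)

variable (hL : ∀ ξ < s₁, G ξ = gL ∧ F ξ = fL) (hR : ∀ ξ > s₂, G ξ = gR ∧ F ξ = fR)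
  (hP : Continuous fun ξ => F ξ - ξ * G ξ)
include hL hR hP

theorem profile_bound : ∃ B, 0 ≤ B ∧ ∀ ξ, |F ξ - ξ * G ξ| ≤ B * (1 + |ξ|) := by
  obtain ⟨B, hB⟩ := (isCompact_Icc (a := s₁) (b := s₂)).exists_bound_of_continuousOn hP.continuousOn
  have key : ∀ f g ξ B' : ℝ, |f| ≤ B' → |g| ≤ B' → |f - ξ * g| ≤ B' * (1 + |ξ|) :=
    fun f g ξ B' h1 h2 => by
      have h3 := abs_sub f (ξ * g)
      rw [abs_mul] at h3
      have := mul_le_mul_of_nonneg_left h2 (abs_nonneg ξ)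
      linarith
  refine ⟨|B| + |gL| + |fL| + |gR| + |fR|, by positivity, fun ξ => ?_⟩
  have p0 := abs_nonneg B
  have p1 := abs_nonneg gL
  have p2 := abs_nonneg fL
  have p3 := abs_nonneg gR
  have p4 := abs_nonneg fR
  rcases lt_or_ge ξ s₁ with h | h
  · rw [(hL ξ h).1, (hL ξ h).2]
    exact key _ _ _ _ (by linarith) (by linarith)
  rcases lt_or_ge s₂ ξ with h' | h'
  · rw [(hR ξ h').1, (hR ξ h').2]
    exact key _ _ _ _ (by linarith) (by linarith)
  · have h1 := (hB ξ ⟨h, h'⟩).trans (le_abs_self B)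
    rw [Real.norm_eq_abs] at h1
    have h2 := abs_nonneg ξ
    nlinarith

/-- F = P + ξG with P = F − ξG. On [s₁, s₂] both P and ξ are bounded, and outside F is constant.
Hence F is integrable where G is. -/
theorem flux_bound (hG : ∀ ξ, 0 ≤ G ξ) : ∃ B, 0 ≤ B ∧ ∀ ξ, |F ξ| ≤ B + B * G ξ := by
  obtain ⟨B, hB⟩ := (isCompact_Icc (a := s₁) (b := s₂)).exists_bound_of_continuousOn hP.continuousOn
  refine ⟨|B| + |fL| + |fR| + |s₁| + |s₂|, by positivity, fun ξ => ?_⟩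
  have p0 := abs_nonneg B
  have p2 := abs_nonneg fL
  have p4 := abs_nonneg fR
  have p5 := abs_nonneg s₁
  have p6 := abs_nonneg s₂
  have p7 := mul_nonneg (show 0 ≤ |B| + |fL| + |fR| + |s₁| + |s₂| by positivity) (hG ξ)
  rcases lt_or_ge ξ s₁ with h | h
  · rw [(hL ξ h).2]; linarith
  rcases lt_or_ge s₂ ξ with h' | h'
  · rw [(hR ξ h').2]; linarith
  · have h1 := (hB ξ ⟨h, h'⟩).trans (le_abs_self B)
    rw [Real.norm_eq_abs] at h1
    have h2 : |ξ| ≤ |s₁| + |s₂| := by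
      refine abs_le.2 ⟨?_, ?_⟩
      · linarith [neg_abs_le s₁]
      · linarith [le_abs_self s₂]
    have h3 : |F ξ| ≤ |F ξ - ξ * G ξ| + |ξ * G ξ| := by
      have := abs_add_le (F ξ - ξ * G ξ) (ξ * G ξ)
      rwa [sub_add_cancel] at this
    rw [abs_mul, abs_of_nonneg (hG ξ)] at h3
    have h4 := mul_le_mul_of_nonneg_right h2 (hG ξ)
    have h5 := mul_nonneg (show 0 ≤ |B| + |fL| + |fR| by positivity) (hG ξ)
    nlinarith

omit hL hR hP in
theorem hasDerivAt_potential_fst (hd : ∀ ξ ∉ S, HasDerivAt (fun ξ => F ξ - ξ * G ξ) (-G ξ) ξ)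
    {q x t : ℝ} (ht : 0 < t) (hx : x / t ∉ S) :
    HasDerivAt (fun y => selfSimilarPotential (fun ξ => F ξ - ξ * G ξ) q y t) (G (x / t)) x := by
  have h := (((hd _ hx).comp x ((hasDerivAt_id x).div_const t)).const_mul t).neg
  simp only [selfSimilarPotential, if_neg ht.ne']
  refine h.congr_deriv ?_
  field_simp

omit hL hR in
theorem continuous_potential_fst {q t : ℝ} (ht : 0 < t) :
    Continuous fun y => selfSimilarPotential (fun ξ => F ξ - ξ * G ξ) q y t := by
  simp only [selfSimilarPotential, if_neg ht.ne']
  exact (continuous_const.mul (hP.comp (continuous_id.div_const t))).neg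

omit hL hR hP in
theorem hasDerivAt_potential_snd (hd : ∀ ξ ∉ S, HasDerivAt (fun ξ => F ξ - ξ * G ξ) (-G ξ) ξ)
    {q x t : ℝ} (ht : 0 < t) (hx : x / t ∉ S) :
    HasDerivAt (selfSimilarPotential (fun ξ => F ξ - ξ * G ξ) q x) (-F (x / t)) t := by
  have h1 : HasDerivAt (fun τ => x / τ) (-(x / t ^ 2)) t := by
    have := (hasDerivAt_inv ht.ne').const_mul x
    simp only [div_eq_mul_inv]
    exact this.congr_deriv (by field_simp)
  have h := ((hasDerivAt_id t).mul ((hd _ hx).comp t h1)).neg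
  refine (h.congr_deriv ?_).congr_of_eventuallyEq ?_
  · simp only [Function.comp, id]
    field_simp
    ring
  · filter_upwards [lt_mem_nhds ht] with τ hτ
    simp [selfSimilarPotential, hτ.ne']

/-- As t → 0 with x ≠ 0, the ratio x/t leaves [s₁, s₂], so the potential equals x g − t f with the
constants of one side. Its limit x g is the value prescribed at t = 0. -/
theorem continuousOn_potential_snd {x : ℝ} (hx : x ≠ 0) :
    ContinuousOn (selfSimilarPotential (fun ξ => F ξ - ξ * G ξ) (if x < 0 then gL else gR) x)
      (Ici 0) := by
  intro t ht
  rcases (mem_Ici.1 ht).eq_or_lt with h | h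
  · subst h
    have h1 : ContinuousWithinAt (fun t => x * (if x < 0 then gL else gR) -
        t * (if x < 0 then fL else fR)) (Ici 0) 0 := by fun_prop
    refine h1.congr_of_eventuallyEq ?_ (by simp [selfSimilarPotential])
    have hev : ∀ᶠ t in 𝓝[≥] (0 : ℝ), 0 < t →
        (G (x / t) = (if x < 0 then gL else gR) ∧ F (x / t) = (if x < 0 then fL else fR)) := by
      rcases hx.lt_or_gt with hneg | hpos
      · have : ∀ᶠ t in 𝓝 (0 : ℝ), x < s₁ * t := by
          have hc : Continuous fun t : ℝ => s₁ * t := by fun_prop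
          exact hc.continuousAt.eventually (lt_mem_nhds (by simpa using hneg))
        filter_upwards [nhdsWithin_le_nhds this] with t h3 h4
        rw [if_pos hneg, if_pos hneg]
        exact hL _ ((div_lt_iff₀ h4).2 h3)
      · have : ∀ᶠ t in 𝓝 (0 : ℝ), s₂ * t < x := by
          have hc : Continuous fun t : ℝ => s₂ * t := by fun_prop
          exact hc.continuousAt.eventually (gt_mem_nhds (by simpa using hpos))
        filter_upwards [nhdsWithin_le_nhds this] with t h3 h4
        rw [if_neg hpos.not_gt, if_neg hpos.not_gt]
        exact hR _ ((lt_div_iff₀ h4).2 h3)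
    filter_upwards [hev, self_mem_nhdsWithin] with t h3 h4
    rcases (mem_Ici.1 h4).eq_or_lt with h5 | h5
    · subst h5; simp [selfSimilarPotential]
    · obtain ⟨h6, h7⟩ := h3 h5
      simp only [selfSimilarPotential, if_neg h5.ne', h6, h7]
      field_simp
      ring
  · refine ContinuousAt.continuousWithinAt ?_
    have h1 : ContinuousAt (fun τ => -(τ * (F (x / τ) - x / τ * G (x / τ)))) t := by
      have h2 : ContinuousAt (fun τ => x / τ) t := continuousAt_const.div continuousAt_id h.ne'
      exact (continuousAt_id.mul (ContinuousAt.comp (f := fun τ => x / τ) hP.continuousAt h2)).neg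
    refine h1.congr ?_
    filter_upwards [lt_mem_nhds h] with τ hτ
    simp [selfSimilarPotential, hτ.ne']

omit hL hR hP in
theorem abs_potential_le {B : ℝ} (hB : ∀ ξ, |F ξ - ξ * G ξ| ≤ B * (1 + |ξ|)) {q x t : ℝ}
    (ht : 0 < t) : |selfSimilarPotential (fun ξ => F ξ - ξ * G ξ) q x t| ≤ B * (t + |x|) := by
  rw [selfSimilarPotential, if_neg ht.ne', abs_neg, abs_mul, abs_of_pos ht]
  have h := mul_le_mul_of_nonneg_left (hB (x / t)) ht.le
  rw [abs_div, abs_of_pos ht] at h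
  refine h.trans (le_of_eq ?_)
  field_simp

omit hL hR in
theorem integral_profile_slice (hG : ∀ ξ, 0 ≤ G ξ)
    (hd : ∀ ξ ∉ S, HasDerivAt (fun ξ => F ξ - ξ * G ξ) (-G ξ) ξ) {R t : ℝ} (hR0 : 0 ≤ R)
    (ht : 0 < t) : IntervalIntegrable (fun x => G (x / t)) volume (-R) R ∧
      ∫ x in (-R)..R, G (x / t) = selfSimilarPotential (fun ξ => F ξ - ξ * G ξ) 0 R t -
        selfSimilarPotential (fun ξ => F ξ - ξ * G ξ) 0 (-R) t := by
  classical
  have hc := continuous_potential_fst hP (q := 0) ht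
  have hS : ∀ x, x ∉ S.image (· * t) → x / t ∉ S := fun x hx h =>
    hx (Finset.mem_image.2 ⟨x / t, h, by field_simp⟩)
  have hi := intervalIntegrable_of_hasDerivAt_off_finset (S.image (· * t)) hc.neg
    (G := fun x => G (x / t)) (fun x => hG _) (show -R ≤ R by linarith)
    fun x _ hx => (hasDerivAt_potential_fst hd ht (hS x hx)).neg
  refine ⟨hi, ?_⟩
  exact integral_eq_of_hasDerivAt_off_countable_of_le _ _ (by linarith)
    (S.image (· * t)).countable_toSet hc.continuousOn
    (fun x hx => hasDerivAt_potential_fst hd ht (hS x hx.2)) hi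

theorem integrableOn_profile (hG : ∀ ξ, 0 ≤ G ξ)
    (hd : ∀ ξ ∉ S, HasDerivAt (fun ξ => F ξ - ξ * G ξ) (-G ξ) ξ) {R : ℝ} (hR0 : 0 ≤ R) :
    IntegrableOn (fun z : ℝ × ℝ => G (z.1 / z.2)) (Ioc (-R) R ×ˢ Ioc 0 R) ∧
    IntegrableOn (fun z : ℝ × ℝ => F (z.1 / z.2)) (Ioc (-R) R ×ˢ Ioc 0 R) := by
  obtain ⟨mG, mF⟩ := profile_measurable hP hd
  obtain ⟨B, hB0, hB⟩ := profile_bound hL hR hP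
  obtain ⟨B', hB0', hB'⟩ := flux_bound hL hR hP hG
  have h1 : IntegrableOn (fun z : ℝ × ℝ => G (z.1 / z.2)) (Ioc (-R) R ×ˢ Ioc 0 R) := by
    have hm : AEStronglyMeasurable (fun z : ℝ × ℝ => G (z.1 / z.2))
        ((volume.restrict (Ioc (-R) R)).prod (volume.restrict (Ioc 0 R))) :=
      (mG.comp (measurable_fst.div measurable_snd)).aestronglyMeasurable
    rw [IntegrableOn, Measure.volume_eq_prod, ← Measure.prod_restrict, integrable_prod_iff' hm]
    refine ⟨?_, ?_⟩
    · filter_upwards [ae_restrict_mem measurableSet_Ioc] with t ht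
      have := (integral_profile_slice hP hG hd hR0 ht.1).1
      rwa [intervalIntegrable_iff_integrableOn_Ioc_of_le (by linarith)] at this
    -- The integral of G over a slice is a difference of two values of the potential, each at most
    -- B(t + R) ≤ 2BR. It is bounded uniformly in t even if G is unbounded.
    · refine Integrable.mono' (g := fun _ => 4 * B * R) (integrable_const _)
        hm.norm.prod_swap.integral_prod_right' ?_
      filter_upwards [ae_restrict_mem measurableSet_Ioc] with t ht
      have h2 := (integral_profile_slice hP hG hd hR0 ht.1).2
      rw [intervalIntegral.integral_of_le (by linarith)] at h2
      simp only [Real.norm_of_nonneg (hG _)]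
      rw [h2]
      refine (abs_sub _ _).trans ?_
      have h3 := abs_potential_le hB (q := 0) (x := R) ht.1
      have h4 := abs_potential_le hB (q := 0) (x := -R) ht.1
      rw [abs_neg, abs_of_nonneg hR0] at h4
      rw [abs_of_nonneg hR0] at h3
      have := mul_le_mul_of_nonneg_left ht.2 hB0
      linarith
  have hfin : IntegrableOn (fun _ : ℝ × ℝ => B') (Ioc (-R) R ×ˢ Ioc 0 R) := by
    refine integrableOn_const ?_
    have : volume (Ioc (-R) R ×ˢ Ioc 0 R) ≤ volume (Icc (-R) R ×ˢ Icc 0 R) :=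
      measure_mono (prod_mono Ioc_subset_Icc_self Ioc_subset_Icc_self)
    exact (this.trans_lt (isCompact_Icc.prod isCompact_Icc).measure_lt_top).ne
  refine ⟨h1, ?_⟩
  refine (hfin.add (h1.const_mul B')).mono'
    (mF.comp (measurable_fst.div measurable_snd)).aestronglyMeasurable
    (Eventually.of_forall fun z => hB' _)

/-- The potential Q has Q_x = G and Q_t = −F. Adding and subtracting Qφ_xt splits the integrand into
∂ₓ(Qφ_t) and −∂ₜ(Qφ_x), each integrated along single lines. The first gives 0, the second the
boundary term Qφ_x at t = 0. Each line meets only finitely many exceptional points. -/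
theorem selfSimilar_integral_identity (hG : ∀ ξ, 0 ≤ G ξ)
    (hd : ∀ ξ ∉ S, HasDerivAt (fun ξ => F ξ - ξ * G ξ) (-G ξ) ξ) {φ : ℝ × ℝ → ℝ}
    (hφ : ContDiff ℝ ((⊤ : ℕ∞) : WithTop ℕ∞) φ) {R : ℝ} (hR0 : 0 < R)
    (hsupp : ∀ z ∉ Ioo (-R) R ×ˢ Ioo (-R) R, z ∉ tsupport φ) :
    ∫ z in Ioc (-R) R ×ˢ Ioc 0 R, (G (z.1 / z.2) * fderiv ℝ φ z (0, 1) +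
      F (z.1 / z.2) * fderiv ℝ φ z (1, 0)) =
    ∫ x in Ioc (-R) R, x * (if x < 0 then gL else gR) * fderiv ℝ φ (x, 0) (1, 0) := by
  classical
  obtain ⟨mG, mF⟩ := profile_measurable hP hd
  obtain ⟨B, hB0, hB⟩ := profile_bound hL hR hP
  obtain ⟨iG, iF⟩ := integrableOn_profile hL hR hP hG hd hR0.le
  set D := Ioc (-R) R ×ˢ Ioc 0 R with hD
  have hDm : MeasurableSet D := measurableSet_Ioc.prod measurableSet_Ioc
  have hDc : D ⊆ Icc (-R) R ×ˢ Icc 0 R := prod_mono Ioc_subset_Icc_self Ioc_subset_Icc_self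
  have hDfin : volume D ≠ ⊤ :=
    ((measure_mono hDc).trans_lt (isCompact_Icc.prod isCompact_Icc).measure_lt_top).ne
  set φt : ℝ × ℝ → ℝ := fun z => fderiv ℝ φ z (0, 1) with hφt
  set φx : ℝ × ℝ → ℝ := fun z => fderiv ℝ φ z (1, 0) with hφx
  set φxt : ℝ × ℝ → ℝ := fun z => fderiv ℝ φx z (0, 1) with hφxt
  have hφtx : ∀ z, fderiv ℝ φt z (1, 0) = φxt z := fun z => fderiv_fderiv_comm hφ z _ _
  have cdt : ContDiff ℝ 1 φt := (hφ.fderiv_right (m := 1) (by norm_cast)).clm_apply contDiff_const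
  have cdx : ContDiff ℝ 1 φx := (hφ.fderiv_right (m := 1) (by norm_cast)).clm_apply contDiff_const
  have cxt : Continuous φxt := (cdx.continuous_fderiv (by norm_num)).clm_apply continuous_const
  have dt := cdt.differentiable (by norm_num)
  have dx := cdx.differentiable (by norm_num)
  have zt : ∀ z ∉ Ioo (-R) R ×ˢ Ioo (-R) R, φt z = 0 := fun z hz => by
    simp only [hφt, fderiv_of_notMem_tsupport ℝ (hsupp z hz)]; simp
  have zx : ∀ z ∉ Ioo (-R) R ×ˢ Ioo (-R) R, φx z = 0 := fun z hz => by
    simp only [hφx, fderiv_of_notMem_tsupport ℝ (hsupp z hz)]; simp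
  have mulcont : ∀ {g w : ℝ × ℝ → ℝ}, IntegrableOn g D → Continuous w →
      IntegrableOn (fun z => g z * w z) D := fun {g w} hg hw => by
    obtain ⟨b, hb⟩ := (isCompact_Icc.prod isCompact_Icc).exists_bound_of_continuousOn
      (s := Icc (-R) R ×ˢ Icc 0 R) hw.continuousOn
    exact hg.mul_bdd (c := b) hw.aestronglyMeasurable
      ((ae_restrict_iff' hDm).2 (Eventually.of_forall fun z hz => hb z (hDc hz)))
  set Q : ℝ → ℝ → ℝ := fun x t => selfSimilarPotential (fun ξ => F ξ - ξ * G ξ)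
    (if x < 0 then gL else gR) x t with hQ
  have iQ : IntegrableOn (fun z : ℝ × ℝ => Q z.1 z.2) D := by
    have h1 : IntegrableOn (fun z : ℝ × ℝ => -(z.2 * (F (z.1 / z.2) - z.1 / z.2 * G (z.1 / z.2))))
        D := by
      refine Measure.integrableOn_of_bounded (M := B * (R + R)) hDfin ?_ ?_
      · have := measurable_fst.div (measurable_snd (α := ℝ) (β := ℝ))
        exact (measurable_snd.mul ((mF.comp this).sub
          (this.mul (mG.comp this)))).neg.aestronglyMeasurable
      · refine (ae_restrict_iff' hDm).2 (Eventually.of_forall fun z hz => ?_)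
        have h2 := abs_potential_le hB (q := 0) (x := z.1) hz.2.1
        rw [selfSimilarPotential, if_neg hz.2.1.ne'] at h2
        refine h2.trans (mul_le_mul_of_nonneg_left (add_le_add hz.2.2 ?_) hB0)
        exact abs_le.2 ⟨hz.1.1.le, hz.1.2⟩
    refine h1.congr_fun (fun z hz => ?_) hDm
    simp only [hQ, selfSimilarPotential, if_neg hz.2.1.ne']
  have i1 : IntegrableOn (fun z : ℝ × ℝ => G (z.1 / z.2) * φt z + Q z.1 z.2 * φxt z) D :=
    (mulcont iG cdt.continuous).add (mulcont iQ cxt)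
  have i2 : IntegrableOn (fun z : ℝ × ℝ => F (z.1 / z.2) * φx z - Q z.1 z.2 * φxt z) D :=
    (mulcont iF cdx.continuous).sub (mulcont iQ cxt)
  have v1 : ∫ z in D, (G (z.1 / z.2) * φt z + Q z.1 z.2 * φxt z) = 0 := by
    rw [IntegrableOn, hD, Measure.volume_eq_prod, ← Measure.prod_restrict] at i1
    rw [hD, Measure.volume_eq_prod, ← Measure.prod_restrict, integral_prod_symm _ i1]
    refine integral_eq_zero_of_ae ?_
    filter_upwards [i1.prod_left_ae, ae_restrict_mem measurableSet_Ioc] with t hi ht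
    simp only [Pi.zero_apply]
    -- For t > 0 the potential does not depend on its prescribed initial slope, so 0 can be used
    -- there and the jump at x = 0 is harmless.
    set q : ℝ → ℝ := fun x => selfSimilarPotential (fun ξ => F ξ - ξ * G ξ) 0 x t with hq
    have eq : ∀ x, Q x t = q x := fun x => by
      simp only [hQ, hq, selfSimilarPotential, if_neg ht.1.ne']
    simp only [eq] at hi ⊢
    rw [← intervalIntegral.integral_of_le (by linarith),
      integral_eq_of_hasDerivAt_off_countable_of_le (fun x => q x * φt (x, t)) _ (by linarith)
      (S.image (· * t)).countable_toSet
      ((continuous_potential_fst hP ht.1).mul (cdt.continuous.comp (by fun_prop))).continuousOn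
      (fun x hx => ?_)
      ((intervalIntegrable_iff_integrableOn_Ioc_of_le (by linarith)).2 hi)]
    · rw [zt (R, t) (fun h => lt_irrefl _ h.1.2), zt (-R, t) (fun h => lt_irrefl _ h.1.1)]
      ring
    · have hS : x / t ∉ S := fun h =>
        hx.2 (Finset.mem_coe.2 (Finset.mem_image.2 ⟨x / t, h, by
          have := ht.1.ne'
          field_simp⟩))
      have := (hasDerivAt_potential_fst hd (q := 0) ht.1 hS).fun_mul (hasDerivAt_slice_fst dt x t)
      rwa [hφtx] at this
  have v2 : ∫ z in D, (F (z.1 / z.2) * φx z - Q z.1 z.2 * φxt z) =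
      ∫ x in Ioc (-R) R, x * (if x < 0 then gL else gR) * φx (x, 0) := by
    rw [IntegrableOn, hD, Measure.volume_eq_prod, ← Measure.prod_restrict] at i2
    rw [hD, Measure.volume_eq_prod, ← Measure.prod_restrict, integral_prod _ i2]
    refine integral_congr_ae ?_
    filter_upwards [i2.prod_right_ae, ae_restrict_of_ae (Measure.ae_ne volume 0)] with x hi hx
    rw [← intervalIntegral.integral_of_le hR0.le,
      integral_eq_of_hasDerivAt_off_countable_of_le (fun t => -(Q x t * φx (x, t))) _ hR0.le
      (S.image (x / ·)).countable_toSet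
      (((continuousOn_potential_snd hL hR hP hx).mono Icc_subset_Ici_self).mul
        (cdx.continuous.comp (by fun_prop)).continuousOn).neg
      (fun t ht => ?_)
      ((intervalIntegrable_iff_integrableOn_Ioc_of_le hR0.le).2 hi)]
    · rw [zx (x, R) (fun h => lt_irrefl _ h.2.2)]
      simp [hQ, selfSimilarPotential]
    · have hS : x / t ∉ S := fun h =>
        ht.2 (Finset.mem_coe.2 (Finset.mem_image.2 ⟨x / t, h, by
          have := ht.1.1.ne'
          field_simp⟩))
      have := ((hasDerivAt_potential_snd hd (q := if x < 0 then gL else gR) ht.1.1 hS).fun_mul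
        (hasDerivAt_slice_snd dx x t)).neg
      refine this.congr_deriv ?_
      simp only [hQ, hφxt]
      ring
  have v3 := integral_add i1 i2
  rw [v1, v2, zero_add] at v3
  rw [← v3]
  refine integral_congr_ae (Eventually.of_forall fun z => ?_)
  simp only
  ring

/-- A self-similar pair `(g, f)` whose profile `F - ξ G` is continuous with derivative `-G` off a
finite set solves the balance law weakly. -/
theorem isWeakSolution_selfSimilar (hG : ∀ ξ, 0 ≤ G ξ)
    (hd : ∀ ξ ∉ S, HasDerivAt (fun ξ => F ξ - ξ * G ξ) (-G ξ) ξ) {g f : ℝ → ℝ → ℝ}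
    (hg : ∀ x t, 0 < t → g x t = G (x / t)) (hf : ∀ x t, 0 < t → f x t = F (x / t)) :
    IsWeakSolution g f fun x => if x < 0 then gL else gR := by
  have hsub : ∀ K : Set (ℝ × ℝ), IsCompact K → ∃ R, 0 < R ∧ K ⊆ Ioo (-R) R ×ˢ Ioo (-R) R := by
    intro K hK
    obtain ⟨r, hr0, hr⟩ := hK.isBounded.subset_ball_lt 0 0
    refine ⟨r, hr0, hr.trans fun z hz => ?_⟩
    rw [mem_ball_zero_iff, Prod.norm_def, max_lt_iff, Real.norm_eq_abs, Real.norm_eq_abs, abs_lt,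
      abs_lt] at hz
    exact hz
  have hpos : MeasurableSet {p : ℝ × ℝ | 0 < p.2} := measurableSet_lt measurable_const measurable_snd
  refine ⟨fun K hK => ?_, fun φ hφ hc => ?_⟩
  · obtain ⟨R, hR0, hKR⟩ := hsub K hK
    obtain ⟨iG, iF⟩ := integrableOn_profile hL hR hP hG hd hR0.le
    have hs : K ∩ {p | 0 < p.2} ⊆ Ioc (-R) R ×ˢ Ioc 0 R := fun z hz =>
      ⟨Ioo_subset_Ioc_self (hKR hz.1).1, hz.2, (hKR hz.1).2.2.le⟩
    have hm : MeasurableSet (K ∩ {p : ℝ × ℝ | 0 < p.2}) := hK.measurableSet.inter hpos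
    exact ⟨(iG.mono_set hs).congr_fun (fun z hz => (hg _ _ hz.2).symm) hm,
      (iF.mono_set hs).congr_fun (fun z hz => (hf _ _ hz.2).symm) hm⟩
  · obtain ⟨R, hR0, hKR⟩ := hsub _ hc
    have hsupp : ∀ z ∉ Ioo (-R) R ×ˢ Ioo (-R) R, z ∉ tsupport φ := fun z hz h => hz (hKR h)
    have h := selfSimilar_integral_identity hL hR hP hG hd hφ hR0 hsupp
    have e1 : ∫ p in {p : ℝ × ℝ | 0 < p.2},
        (g p.1 p.2 * fderiv ℝ φ p (0, 1) + f p.1 p.2 * fderiv ℝ φ p (1, 0)) =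
        ∫ z in Ioc (-R) R ×ˢ Ioc 0 R, (G (z.1 / z.2) * fderiv ℝ φ z (0, 1) +
          F (z.1 / z.2) * fderiv ℝ φ z (1, 0)) := by
      rw [setIntegral_congr_fun hpos fun p hp => by rw [hg _ _ hp, hf _ _ hp]]
      refine setIntegral_eq_of_subset_of_forall_sdiff_eq_zero hpos (fun z hz => hz.2.1)
        fun z hz => ?_
      have hz2 : z ∉ Ioo (-R) R ×ˢ Ioo (-R) R := fun h3 =>
        hz.2 ⟨Ioo_subset_Ioc_self h3.1, hz.1, h3.2.2.le⟩
      rw [fderiv_of_notMem_tsupport ℝ (hsupp z hz2)]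
      simp
    have hz0 : ∀ x ∉ Ioo (-R) R, φ (x, 0) = 0 := fun x hx =>
      image_eq_zero_of_notMem_tsupport (hsupp _ fun h => hx h.1)
    have e2 : ∫ x, (if x < 0 then gL else gR) * φ (x, 0) =
        ∫ x in Ioc (-R) R, (if x < 0 then gL else gR) * φ (x, 0) := by
      rw [← setIntegral_univ]
      exact setIntegral_eq_of_subset_of_forall_sdiff_eq_zero MeasurableSet.univ (subset_univ _)
        fun x hx => by rw [hz0 x fun h => hx.2 (Ioo_subset_Ioc_self h), mul_zero]
    have hφd : Differentiable ℝ φ := hφ.differentiable (by simp)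
    have c0 : Continuous fun x : ℝ => φ (x, 0) := hφ.continuous.comp (by fun_prop)
    have cx : Continuous fun x : ℝ => fderiv ℝ φ (x, 0) (1, 0) :=
      ((hφ.continuous_fderiv (by simp)).clm_apply continuous_const).comp
        (by fun_prop : Continuous fun x : ℝ => ((x, 0) : ℝ × ℝ))
    have hint : ∀ w : ℝ → ℝ, Continuous w →
        IntegrableOn (fun x => (if x < 0 then gL else gR) * w x) (Ioc (-R) R) := fun w hw => by
      refine Integrable.bdd_mul (c := |gL| + |gR|)
        (hw.integrableOn_Icc.mono_set Ioc_subset_Icc_self) ?_ (Eventually.of_forall fun x => ?_)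
      · exact (Measurable.ite measurableSet_Iio measurable_const
          measurable_const).aestronglyMeasurable
      · have := abs_nonneg gL
        have := abs_nonneg gR
        split_ifs <;> rw [Real.norm_eq_abs] <;> linarith
    have j1 := hint _ c0
    have j2 : IntegrableOn (fun x => (if x < 0 then gL else gR) *
        (x * fderiv ℝ φ (x, 0) (1, 0))) (Ioc (-R) R) := hint _ (continuous_id.mul cx)
    have j3 : IntegrableOn (fun x => (if x < 0 then gL else gR) * φ (x, 0) +
        (if x < 0 then gL else gR) * (x * fderiv ℝ φ (x, 0) (1, 0))) (Ioc (-R) R) := j1.add j2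
    -- The derivative of x g₀(x) φ(x, 0), with compact support, integrates to 0. This exchanges the
    -- boundary term in φ_x for the initial-data term in φ. The factor x removes the jump of g₀.
    have e3 : ∫ x in Ioc (-R) R, ((if x < 0 then gL else gR) * φ (x, 0) +
        (if x < 0 then gL else gR) * (x * fderiv ℝ φ (x, 0) (1, 0))) = 0 := by
      have hcont : Continuous fun x : ℝ => x * (if x < 0 then gL else gR) := by
        have : (fun x : ℝ => x * (if x < 0 then gL else gR)) =
            fun x => gL * min x 0 + gR * max x 0 := by
          ext x
          split_ifs with h0
          · rw [min_eq_left h0.le, max_eq_right h0.le]; ring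
          · rw [min_eq_right (not_lt.1 h0), max_eq_left (not_lt.1 h0)]; ring
        rw [this]
        fun_prop
      rw [← intervalIntegral.integral_of_le (by linarith),
        integral_eq_of_hasDerivAt_off_countable_of_le
          (fun x => x * (if x < 0 then gL else gR) * φ (x, 0)) _ (by linarith)
          (countable_singleton 0) (hcont.mul c0).continuousOn (fun x hx => ?_)
          ((intervalIntegrable_iff_integrableOn_Ioc_of_le (by linarith)).2 j3)]
      · rw [hz0 R (fun h => lt_irrefl _ h.2), hz0 (-R) (fun h => lt_irrefl _ h.1)]
        ring
      · have hx0 : x ≠ 0 := hx.2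
        have hloc : HasDerivAt (fun x : ℝ => x * (if x < 0 then gL else gR))
            (if x < 0 then gL else gR) x := by
          have h2 : HasDerivAt (fun y : ℝ => y * (if x < 0 then gL else gR))
              (if x < 0 then gL else gR) x := by
            simpa using (hasDerivAt_id x).mul_const (if x < 0 then gL else gR)
          refine h2.congr_of_eventuallyEq ?_
          rcases hx0.lt_or_gt with h0 | h0
          · filter_upwards [gt_mem_nhds h0] with y hy
            rw [if_pos hy, if_pos h0]
          · filter_upwards [lt_mem_nhds h0] with y hy
            rw [if_neg hy.not_gt, if_neg h0.not_gt]
        refine (hloc.fun_mul (hasDerivAt_slice_fst hφd x 0)).congr_deriv ?_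
        ring
    rw [integral_add j1 j2] at e3
    have e4 : ∫ x in Ioc (-R) R, x * (if x < 0 then gL else gR) * fderiv ℝ φ (x, 0) (1, 0) =
        ∫ x in Ioc (-R) R, (if x < 0 then gL else gR) * (x * fderiv ℝ φ (x, 0) (1, 0)) :=
      integral_congr_ae (Eventually.of_forall fun x => by simp only; ring)
    rw [e1, h, e2, e4]
    linarith

end SelfSimilar

/-! ### Simple waves connecting two condensates -/

/-- V is strictly increasing and its limits at the ends are not attained, so it is a bijection onto
(sL, sR). Continuity and end limits of the inverse follow by comparing V y with ξ. The derivative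
formula is that of a local inverse. -/
theorem exists_isWaveProfile {V V' : ℝ → ℝ} {lo hi sL sR : ℝ} (hlt : lo < hi)
    (hd : ∀ y ∈ Ioo lo hi, HasDerivAt V (V' y) y) (hpos : ∀ y ∈ Ioo lo hi, 0 < V' y)
    (tl : Tendsto V (𝓝[>] lo) (𝓝 sL)) (tr : Tendsto V (𝓝[<] hi) (𝓝 sR)) :
    sL < sR ∧ ∃ ℓ, IsWaveProfile V lo hi sL sR ℓ ∧
      ∀ ξ ∈ Ioo sL sR, HasDerivAt ℓ (V' (ℓ ξ))⁻¹ ξ := by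
  have hc : ContinuousOn V (Ioo lo hi) := fun y hy => (hd y hy).continuousAt.continuousWithinAt
  have mono : StrictMonoOn V (Ioo lo hi) := by
    refine strictMonoOn_of_deriv_pos (convex_Ioo lo hi) hc fun y hy => ?_
    rw [interior_Ioo] at hy
    rw [(hd y hy).deriv]
    exact hpos y hy
  have hlow : ∀ y ∈ Ioo lo hi, sL < V y := fun y hy => by
    obtain ⟨z, hz1, hz2⟩ := exists_between hy.1
    have hz : z ∈ Ioo lo hi := ⟨hz1, hz2.trans hy.2⟩
    refine lt_of_le_of_lt (le_of_tendsto tl ?_) (mono hz hy hz2)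
    filter_upwards [Ioo_mem_nhdsGT hz1] with u hu
    exact (mono ⟨hu.1, hu.2.trans hz.2⟩ hz hu.2).le
  have hhigh : ∀ y ∈ Ioo lo hi, V y < sR := fun y hy => by
    obtain ⟨z, hz1, hz2⟩ := exists_between hy.2
    have hz : z ∈ Ioo lo hi := ⟨hy.1.trans hz1, hz2⟩
    refine lt_of_lt_of_le (mono hy hz hz1) (ge_of_tendsto tr ?_)
    filter_upwards [Ioo_mem_nhdsLT hz2] with u hu
    exact (mono hz ⟨hz.1.trans hu.1, hu.2⟩ hu.1).le
  have hsurj : ∀ ξ, ∃ y, ξ ∈ Ioo sL sR → y ∈ Ioo lo hi ∧ V y = ξ := fun ξ => by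
    by_cases hξ : ξ ∈ Ioo sL sR
    · obtain ⟨u, hu, huI⟩ := ((tl.eventually (gt_mem_nhds hξ.1)).and (Ioo_mem_nhdsGT hlt)).exists
      obtain ⟨v, hv, hvI⟩ := ((tr.eventually (lt_mem_nhds hξ.2)).and (Ioo_mem_nhdsLT hlt)).exists
      have huv : u < v := (mono.lt_iff_lt huI hvI).1 (hu.trans hv)
      obtain ⟨y, hy, hVy⟩ := intermediate_value_Icc huv.le
        (hc.mono (Icc_subset_Ioo huI.1 hvI.2)) ⟨hu.le, hv.le⟩
      exact ⟨y, fun _ => ⟨Icc_subset_Ioo huI.1 hvI.2 hy, hVy⟩⟩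
    · exact ⟨0, fun h => absurd h hξ⟩
  choose ℓ hℓ using hsurj
  have lt_iff : ∀ ξ ∈ Ioo sL sR, ∀ y ∈ Ioo lo hi, (y < ℓ ξ ↔ V y < ξ) := fun ξ hξ y hy => by
    rw [← mono.lt_iff_lt hy (hℓ ξ hξ).1, (hℓ ξ hξ).2]
  have gt_iff : ∀ ξ ∈ Ioo sL sR, ∀ y ∈ Ioo lo hi, (ℓ ξ < y ↔ ξ < V y) := fun ξ hξ y hy => by
    rw [← mono.lt_iff_lt (hℓ ξ hξ).1 hy, (hℓ ξ hξ).2]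
  have hcont : ∀ ξ ∈ Ioo sL sR, ContinuousAt ℓ ξ := fun ξ hξ => by
    obtain ⟨hm, he⟩ := hℓ ξ hξ
    refine tendsto_order.2 ⟨fun b hb => ?_, fun b hb => ?_⟩
    · obtain ⟨y, hy1, hy2⟩ := exists_between (max_lt hb hm.1)
      have hy : y ∈ Ioo lo hi := ⟨(le_max_right _ _).trans_lt hy1, hy2.trans hm.2⟩
      filter_upwards [isOpen_Ioo.mem_nhds hξ, lt_mem_nhds ((lt_iff ξ hξ y hy).1 hy2)] with z hz h
      exact ((le_max_left _ _).trans_lt hy1).trans ((lt_iff z hz y hy).2 h)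
    · obtain ⟨y, hy1, hy2⟩ := exists_between (lt_min hb hm.2)
      have hy : y ∈ Ioo lo hi := ⟨hm.1.trans hy1, hy2.trans_le (min_le_right _ _)⟩
      filter_upwards [isOpen_Ioo.mem_nhds hξ, gt_mem_nhds ((gt_iff ξ hξ y hy).1 hy1)] with z hz h
      exact ((gt_iff z hz y hy).2 h).trans (hy2.trans_le (min_le_left _ _))
  have hs : sL < sR := by
    obtain ⟨y, hy⟩ := nonempty_Ioo.2 hlt
    exact (hlow y hy).trans (hhigh y hy)
  refine ⟨hs, ℓ, ⟨tl, tr, fun ξ hξ => (hℓ ξ hξ).1, fun ξ hξ => (hℓ ξ hξ).2,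
    fun ξ hξ y hy h => mono.injOn hy (hℓ ξ hξ).1 (h.trans (hℓ ξ hξ).2.symm),
    fun ξ hξ => (hcont ξ hξ).continuousWithinAt, ?_, ?_⟩, fun ξ hξ => ?_⟩
  · refine tendsto_order.2 ⟨fun b hb => ?_, fun b hb => ?_⟩
    · filter_upwards [Ioo_mem_nhdsGT hs] with z hz using hb.trans (hℓ z hz).1.1
    · obtain ⟨y, hy1, hy2⟩ := exists_between (lt_min hb hlt)
      have hy : y ∈ Ioo lo hi := ⟨hy1, hy2.trans_le (min_le_right _ _)⟩
      filter_upwards [Ioo_mem_nhdsGT hs, Ioo_mem_nhdsGT (hlow y hy)] with z hz h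
      exact ((gt_iff z hz y hy).2 h.2).trans (hy2.trans_le (min_le_left _ _))
  · refine tendsto_order.2 ⟨fun b hb => ?_, fun b hb => ?_⟩
    · obtain ⟨y, hy1, hy2⟩ := exists_between (max_lt hb hlt)
      have hy : y ∈ Ioo lo hi := ⟨(le_max_right _ _).trans_lt hy1, hy2⟩
      filter_upwards [Ioo_mem_nhdsLT hs, Ioo_mem_nhdsLT (hhigh y hy)] with z hz h
      exact ((le_max_left _ _).trans_lt hy1).trans ((lt_iff z hz y hy).2 h.1)
    · filter_upwards [Ioo_mem_nhdsLT hs] with z hz using (hℓ z hz).1.2.trans hb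
  · have hm := (hℓ ξ hξ).1
    refine HasDerivAt.of_local_left_inverse (hcont ξ hξ) (hd _ hm) (hpos _ hm).ne' ?_
    filter_upwards [isOpen_Ioo.mem_nhds hξ] with z hz using (hℓ z hz).2

theorem hasDerivAt_similarity_time {G : ℝ → ℝ} {d x t : ℝ} (ht : t ≠ 0)
    (h : HasDerivAt G d (x / t)) : HasDerivAt (fun τ => G (x / τ)) (-(d * x / t ^ 2)) t := by
  have h1 : HasDerivAt (fun τ => x / τ) (-(x / t ^ 2)) t := by
    simp only [div_eq_mul_inv]
    exact ((hasDerivAt_inv ht).const_mul x).congr_deriv (by field_simp)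
  exact (HasDerivAt.comp t h h1).congr_deriv (by ring)

theorem hasDerivAt_similarity_space {G : ℝ → ℝ} {d x t : ℝ} (h : HasDerivAt G d (x / t)) :
    HasDerivAt (fun y => G (y / t)) (d / t) x :=
  (HasDerivAt.comp x h ((hasDerivAt_id x).div_const t)).congr_deriv (by ring)

theorem transportAt_similarity {ℓ : ℝ → ℝ} {d x t : ℝ} (ht : t ≠ 0) (h : HasDerivAt ℓ d (x / t)) :
    TransportAt (fun y τ => ℓ (y / τ)) (x / t) x t :=
  ⟨_, _, hasDerivAt_similarity_time ht h, hasDerivAt_similarity_space h, by field_simp; ring⟩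

theorem transportAt_const (k V x t : ℝ) : TransportAt (fun _ _ => k) V x t :=
  ⟨0, 0, hasDerivAt_const t k, hasDerivAt_const x k, by ring⟩

/-- ∂ₜ G(x/t) = −(x/t²) G′ and ∂ₓ F(x/t) = F′/t, which cancel exactly when F′ = ξG′. -/
theorem balanceAt_similarity {g f : ℝ → ℝ → ℝ} {G F : ℝ → ℝ} {d x t : ℝ} (ht : 0 < t)
    (hg : ∀ x t, 0 < t → g x t = G (x / t)) (hf : ∀ x t, 0 < t → f x t = F (x / t))
    (hG : HasDerivAt G d (x / t)) (hF : HasDerivAt F (x / t * d) (x / t)) : BalanceAt g f x t := by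
  refine ⟨_, _, (hasDerivAt_similarity_time ht.ne' hG).congr_of_eventuallyEq ?_,
    (hasDerivAt_similarity_space hF).congr_of_eventuallyEq
      (Eventually.of_forall fun y => hf y t ht), by field_simp; ring⟩
  filter_upwards [lt_mem_nhds ht] with τ hτ using hg x τ hτ

/-- The point 0 and every band edge border an open interval that misses the support, so none of them
is interior. The derivative formulas for u and us therefore apply at every interior η. -/
theorem Condensate.interior_support {C : Condensate} (ho : C.Ordered) {η : ℝ}
    (h : η ∈ interior C.support) : 0 < η ∧ η ∉ C.edges := by
  have key : ∀ {u v : ℝ} {S : Set ℝ}, u < v → (Ioo u v ∩ S = ∅) → u ∉ interior S ∧ v ∉ interior S := by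
    intro u v S huv hS
    refine ⟨fun hu => ?_, fun hv => ?_⟩
    · have hu' : ∀ᶠ z in 𝓝 u, z ∈ S := mem_interior_iff_mem_nhds.1 hu
      obtain ⟨z, hz, hzI⟩ :=
        ((hu'.filter_mono nhdsWithin_le_nhds).and (Ioo_mem_nhdsGT huv)).exists
      exact (hS ▸ (⟨hzI, hz⟩ : z ∈ Ioo u v ∩ S) : z ∈ (∅ : Set ℝ))
    · have hv' : ∀ᶠ z in 𝓝 v, z ∈ S := mem_interior_iff_mem_nhds.1 hv
      obtain ⟨z, hz, hzI⟩ :=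
        ((hv'.filter_mono nhdsWithin_le_nhds).and (Ioo_mem_nhdsLT huv)).exists
      exact (hS ▸ (⟨hzI, hz⟩ : z ∈ Ioo u v ∩ S) : z ∈ (∅ : Set ℝ))
  have ne_of : ∀ {u v : ℝ}, u < v → Ioo u v ∩ C.support = ∅ → η ≠ u ∧ η ≠ v := fun huv hS =>
    ⟨fun e => (key huv hS).1 (e ▸ h), fun e => (key huv hS).2 (e ▸ h)⟩
  have h0 := interior_subset h
  cases C with
  | genus0 a =>
    have ho' : 0 ≤ a := ho
    have e1 := (ne_of (u := -1) (v := 0) (by norm_num) (by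
      ext z; simp only [support, mem_inter_iff, mem_Ioo, mem_Icc, mem_empty_iff_false, iff_false]
      intro hz; linarith [hz.1.2, hz.2.1])).2
    have e2 := (ne_of (u := a) (v := a + 1) (by linarith) (by
      ext z; simp only [support, mem_inter_iff, mem_Ioo, mem_Icc, mem_empty_iff_false, iff_false]
      intro hz; linarith [hz.1.1, hz.2.2])).1
    exact ⟨lt_of_le_of_ne h0.1 e1.symm, e2⟩
  | genus1 a b c =>
    obtain ⟨ha, hab, hbc⟩ : 0 ≤ a ∧ a < b ∧ b < c := ho
    have e1 := (ne_of (u := -1) (v := 0) (by norm_num) (by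
      ext z; simp only [support, mem_inter_iff, mem_Ioo, mem_union, mem_Icc, mem_empty_iff_false,
        iff_false]
      rintro ⟨hz, hz1 | hz1⟩ <;> linarith [hz.2, hz1.1])).2
    have e2 := ne_of hab (by
      ext z; simp only [support, mem_inter_iff, mem_Ioo, mem_union, mem_Icc, mem_empty_iff_false,
        iff_false]
      rintro ⟨hz, hz1 | hz1⟩ <;> linarith [hz.1, hz.2, hz1.1, hz1.2])
    have e3 := (ne_of (u := c) (v := c + 1) (by linarith) (by
      ext z; simp only [support, mem_inter_iff, mem_Ioo, mem_union, mem_Icc, mem_empty_iff_false,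
        iff_false]
      rintro ⟨hz, hz1 | hz1⟩ <;> linarith [hz.1, hz1.2])).1
    refine ⟨lt_of_le_of_ne ?_ e1.symm, ?_⟩
    · rcases h0 with h0 | h0
      · exact h0.1
      · linarith [h0.1]
    · simp only [edges, mem_insert_iff, mem_singleton_iff, not_or]
      exact ⟨e2.1, e2.2, e3⟩

/-- A one-parameter family `M y`, `y ∈ (lo, hi)`, of condensates from `L` to `R` along which the flux
density has the characteristic velocity `V`: `∂(us)/∂y = V ∂u/∂y`. -/
structure IsSimpleWave (M : ℝ → Condensate) (L R : Condensate) (V V' : ℝ → ℝ)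
    (lo hi sL sR : ℝ) : Prop where
  lt : lo < hi
  hasDerivAt : ∀ y ∈ Ioo lo hi, HasDerivAt V (V' y) y
  deriv_pos : ∀ y ∈ Ioo lo hi, 0 < V' y
  speed_left : Tendsto V (𝓝[>] lo) (𝓝 sL)
  speed_right : Tendsto V (𝓝[<] hi) (𝓝 sR)
  equilibrium_left : L.IsEquilibrium
  equilibrium_right : R.IsEquilibrium
  equilibrium : ∀ y ∈ Ioo lo hi, (M y).IsEquilibrium
  edges : ∀ y ∈ Ioo lo hi, (M y).edges ⊆ L.edges ∪ R.edges ∪ {y}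
  characteristic : ∀ y ∈ Ioo lo hi, ∀ η, 0 < η → η ∉ (M y).edges → ∃ d : ℝ,
    HasDerivAt (fun y => (M y).dos η) d y ∧ HasDerivAt (fun y => (M y).flux η) (V y * d) y
  -- This concerns the moment when the moving edge passes through η. There u itself is unbounded,
  -- and only this combination is continuous.
  continuousAt : ∀ η ∈ Ioo lo hi, 0 < η → η ∉ L.edges ∪ R.edges →
    ContinuousAt (fun y => (M y).flux η - V y * (M y).dos η) η
  left : ∀ η, 0 < η → η ∉ L.edges ∪ R.edges →
    Tendsto (fun y => (M y).dos η) (𝓝[>] lo) (𝓝 (L.dos η)) ∧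
    Tendsto (fun y => (M y).flux η) (𝓝[>] lo) (𝓝 (L.flux η))
  right : ∀ η, 0 < η → η ∉ L.edges ∪ R.edges →
    Tendsto (fun y => (M y).dos η) (𝓝[<] hi) (𝓝 (R.dos η)) ∧
    Tendsto (fun y => (M y).flux η) (𝓝[<] hi) (𝓝 (R.flux η))

theorem centeredWave_eq (L : Condensate) (N : ℝ → Condensate) (R : Condensate) (sL sR x : ℝ)
    {t : ℝ} (ht : 0 < t) : centeredWave L N R sL sR x t =
      if x / t ≤ sL then L else if x / t < sR then N (x / t) else R := by
  simp only [centeredWave, div_le_iff₀ ht, div_lt_iff₀ ht]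

/-- The profile at `t = 1` of a centered wave. -/
def waveState (L : Condensate) (N : ℝ → Condensate) (R : Condensate) (sL sR ξ : ℝ) : Condensate :=
  if ξ ≤ sL then L else if ξ < sR then N ξ else R

section WaveState

variable {L R : Condensate} {N : ℝ → Condensate} {sL sR ξ : ℝ}

theorem waveState_of_le (h : ξ ≤ sL) : waveState L N R sL sR ξ = L := if_pos h

theorem waveState_of_mem (h : ξ ∈ Ioo sL sR) : waveState L N R sL sR ξ = N ξ := by
  rw [waveState, if_neg h.1.not_ge, if_pos h.2]

theorem waveState_of_ge (hs : sL < sR) (h : sR ≤ ξ) : waveState L N R sL sR ξ = R := by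
  rw [waveState, if_neg (hs.trans_le h).not_ge, if_neg h.not_gt]

theorem tendsto_waveState_left (hs : sL < sR) {g : Condensate → ℝ}
    (h : Tendsto (fun ξ => g (N ξ)) (𝓝[>] sL) (𝓝 (g L))) :
    Tendsto (fun ξ => g (waveState L N R sL sR ξ)) (𝓝 sL) (𝓝 (g L)) := by
  rw [← nhdsLE_sup_nhdsGT]
  refine Tendsto.sup ?_ ?_
  · refine tendsto_const_nhds.congr' ?_
    filter_upwards [self_mem_nhdsWithin] with z hz
    rw [waveState_of_le hz]
  · refine h.congr' ?_
    filter_upwards [Ioo_mem_nhdsGT hs] with z hz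
    rw [waveState_of_mem hz]

theorem tendsto_waveState_right (hs : sL < sR) {g : Condensate → ℝ}
    (h : Tendsto (fun ξ => g (N ξ)) (𝓝[<] sR) (𝓝 (g R))) :
    Tendsto (fun ξ => g (waveState L N R sL sR ξ)) (𝓝 sR) (𝓝 (g R)) := by
  rw [← nhdsLT_sup_nhdsGE]
  refine Tendsto.sup ?_ ?_
  · refine h.congr' ?_
    filter_upwards [Ioo_mem_nhdsLT hs] with z hz
    rw [waveState_of_mem hz]
  · refine tendsto_const_nhds.congr' ?_
    filter_upwards [self_mem_nhdsWithin] with z hz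
    rw [waveState_of_ge hs hz]

end WaveState

namespace IsSimpleWave

variable {M : ℝ → Condensate} {L R : Condensate} {V V' ℓ : ℝ → ℝ} {lo hi sL sR : ℝ}
  (h : IsSimpleWave M L R V V' lo hi sL sR) (hs : sL < sR) (hp : IsWaveProfile V lo hi sL sR ℓ)
  (hd : ∀ ξ ∈ Ioo sL sR, HasDerivAt ℓ (V' (ℓ ξ))⁻¹ ξ)
include h hs hp

theorem isEquilibrium_waveState (ξ : ℝ) :
    (waveState L (fun ξ => M (ℓ ξ)) R sL sR ξ).IsEquilibrium := by
  rcases le_or_gt ξ sL with h1 | h1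
  · rw [waveState_of_le h1]; exact h.equilibrium_left
  rcases lt_or_ge ξ sR with h2 | h2
  · rw [waveState_of_mem ⟨h1, h2⟩]; exact h.equilibrium _ (hp.mem ξ ⟨h1, h2⟩)
  · rw [waveState_of_ge hs h2]; exact h.equilibrium_right

theorem tendsto_left {η : ℝ} (hη : 0 < η) (he : η ∉ L.edges ∪ R.edges) :
    Tendsto (fun ξ => (waveState L (fun ξ => M (ℓ ξ)) R sL sR ξ).dos η) (𝓝 sL) (𝓝 (L.dos η)) ∧
    Tendsto (fun ξ => (waveState L (fun ξ => M (ℓ ξ)) R sL sR ξ).flux η) (𝓝 sL)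
      (𝓝 (L.flux η)) := by
  have t : Tendsto ℓ (𝓝[>] sL) (𝓝[>] lo) := tendsto_nhdsWithin_iff.2 ⟨hp.edge_left, by
    filter_upwards [Ioo_mem_nhdsGT hs] with z hz using (hp.mem z hz).1⟩
  exact ⟨tendsto_waveState_left hs (g := fun C => C.dos η) ((h.left η hη he).1.comp t),
    tendsto_waveState_left hs (g := fun C => C.flux η) ((h.left η hη he).2.comp t)⟩

theorem tendsto_right {η : ℝ} (hη : 0 < η) (he : η ∉ L.edges ∪ R.edges) :
    Tendsto (fun ξ => (waveState L (fun ξ => M (ℓ ξ)) R sL sR ξ).dos η) (𝓝 sR) (𝓝 (R.dos η)) ∧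
    Tendsto (fun ξ => (waveState L (fun ξ => M (ℓ ξ)) R sL sR ξ).flux η) (𝓝 sR)
      (𝓝 (R.flux η)) := by
  have t : Tendsto ℓ (𝓝[<] sR) (𝓝[<] hi) := tendsto_nhdsWithin_iff.2 ⟨hp.edge_right, by
    filter_upwards [Ioo_mem_nhdsLT hs] with z hz using (hp.mem z hz).2⟩
  exact ⟨tendsto_waveState_right hs (g := fun C => C.dos η) ((h.right η hη he).1.comp t),
    tendsto_waveState_right hs (g := fun C => C.flux η) ((h.right η hη he).2.comp t)⟩

include hd

theorem hasDerivAt_waveState {ξ : ℝ} (h1 : ξ ≠ sL) (h2 : ξ ≠ sR) {η : ℝ} (hη : 0 < η)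
    (he : η ∉ (waveState L (fun ξ => M (ℓ ξ)) R sL sR ξ).edges ∨ ξ ∉ Ioo sL sR) : ∃ d : ℝ,
    HasDerivAt (fun ξ => (waveState L (fun ξ => M (ℓ ξ)) R sL sR ξ).dos η) d ξ ∧
    HasDerivAt (fun ξ => (waveState L (fun ξ => M (ℓ ξ)) R sL sR ξ).flux η) (ξ * d) ξ := by
  rcases h1.lt_or_gt with h1 | h1
  · have ev : ∀ᶠ z in 𝓝 ξ, waveState L (fun ξ => M (ℓ ξ)) R sL sR z = L := by
      filter_upwards [gt_mem_nhds h1] with z hz using waveState_of_le (le_of_lt hz)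
    refine ⟨0, (hasDerivAt_const ξ (L.dos η)).congr_of_eventuallyEq ?_,
      ((hasDerivAt_const ξ (L.flux η)).congr_of_eventuallyEq ?_).congr_deriv (by ring)⟩ <;>
    filter_upwards [ev] with z hz using by rw [hz]
  rcases h2.lt_or_gt with h2 | h2
  · have hξ : ξ ∈ Ioo sL sR := ⟨h1, h2⟩
    have he' := he.resolve_right (not_not.2 hξ)
    rw [waveState_of_mem hξ] at he'
    have ev : ∀ᶠ z in 𝓝 ξ, waveState L (fun ξ => M (ℓ ξ)) R sL sR z = M (ℓ z) := by
      filter_upwards [isOpen_Ioo.mem_nhds hξ] with z hz using waveState_of_mem hz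
    obtain ⟨d, d1, d2⟩ := h.characteristic _ (hp.mem ξ hξ) η hη he'
    rw [hp.eq ξ hξ] at d2
    refine ⟨_, (HasDerivAt.comp ξ d1 (hd ξ hξ)).congr_of_eventuallyEq ?_,
      ((HasDerivAt.comp ξ d2 (hd ξ hξ)).congr_of_eventuallyEq ?_).congr_deriv (by ring)⟩ <;>
    filter_upwards [ev] with z hz using by rw [hz]; rfl
  · have ev : ∀ᶠ z in 𝓝 ξ, waveState L (fun ξ => M (ℓ ξ)) R sL sR z = R := by
      filter_upwards [lt_mem_nhds h2] with z hz using waveState_of_ge hs (le_of_lt hz)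
    refine ⟨0, (hasDerivAt_const ξ (R.dos η)).congr_of_eventuallyEq ?_,
      ((hasDerivAt_const ξ (R.flux η)).congr_of_eventuallyEq ?_).congr_deriv (by ring)⟩ <;>
    filter_upwards [ev] with z hz using by rw [hz]

theorem solvesRiemannProblem :
    SolvesRiemannProblem L R sL sR (centeredWave L (fun ξ => M (ℓ ξ)) R sL sR) := by
  have e : ∀ x t, 0 < t → centeredWave L (fun ξ => M (ℓ ξ)) R sL sR x t =
      waveState L (fun ξ => M (ℓ ξ)) R sL sR (x / t) := fun x t ht =>
    centeredWave_eq _ _ _ _ _ _ ht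
  have tdiv : ∀ s t : ℝ, 0 < t → Tendsto (fun x => x / t) (𝓝 (s * t)) (𝓝 s) := fun s t ht => by
    have : Tendsto (fun x => x / t) (𝓝 (s * t)) (𝓝 (s * t / t)) :=
      (continuous_id.div_const t).continuousAt
    rwa [mul_div_cancel_right₀ _ ht.ne'] at this
  refine ⟨hs, fun x hx η => ?_, fun x hx η => ?_, fun x t ht => ?_,
    fun x t ht hxL hxR η hη => ?_, fun η hη he => ?_, fun t ht η hη he => ?_,
    fun t ht η hη he => ?_⟩
  · have ev : ∀ᶠ t in 𝓝 (0 : ℝ), x < sL * t := by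
      have hc : Continuous fun t : ℝ => sL * t := by fun_prop
      exact hc.continuousAt.eventually (lt_mem_nhds (by simpa using hx))
    refine tendsto_const_nhds.congr' ?_
    filter_upwards [nhdsWithin_le_nhds ev] with t ht
    rw [centeredWave, if_pos ht.le]
  · have ev : ∀ᶠ t in 𝓝 (0 : ℝ), sR * t < x := by
      have hc : Continuous fun t : ℝ => sR * t := by fun_prop
      exact hc.continuousAt.eventually (gt_mem_nhds (by simpa using hx))
    refine tendsto_const_nhds.congr' ?_
    filter_upwards [nhdsWithin_le_nhds ev, self_mem_nhdsWithin] with t ht ht0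
    rw [e x t ht0, waveState_of_ge hs ((le_div_iff₀ ht0).2 ht.le)]
  · rw [e x t ht]
    exact h.isEquilibrium_waveState hs hp _
  · rw [e x t ht] at hη
    obtain ⟨h0, hedge⟩ :=
      Condensate.interior_support (h.isEquilibrium_waveState hs hp (x / t)).ordered hη
    have n1 : x / t ≠ sL := fun h1 => hxL (by rw [← h1]; field_simp)
    have n2 : x / t ≠ sR := fun h1 => hxR (by rw [← h1]; field_simp)
    obtain ⟨d, d1, d2⟩ := h.hasDerivAt_waveState hs hp hd n1 n2 h0 (Or.inl hedge)
    exact balanceAt_similarity ht (fun x t ht => by rw [e x t ht]) (fun x t ht => by rw [e x t ht])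
      d1 d2
  -- Since F′ = ξG′, the profile F − ξG has derivative −G wherever G and F are differentiable.
  · have der : ∀ ξ, ξ ≠ sL → ξ ≠ sR → (ξ ∈ Ioo sL sR → ℓ ξ ≠ η) → HasDerivAt (fun ξ =>
        (waveState L (fun ξ => M (ℓ ξ)) R sL sR ξ).flux η -
          ξ * (waveState L (fun ξ => M (ℓ ξ)) R sL sR ξ).dos η)
        (-(waveState L (fun ξ => M (ℓ ξ)) R sL sR ξ).dos η) ξ := fun ξ n1 n2 n3 => by
      have hedge : η ∉ (waveState L (fun ξ => M (ℓ ξ)) R sL sR ξ).edges ∨ ξ ∉ Ioo sL sR := by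
        by_cases hξ : ξ ∈ Ioo sL sR
        · refine Or.inl fun h1 => ?_
          rw [waveState_of_mem hξ] at h1
          rcases h.edges _ (hp.mem ξ hξ) h1 with h2 | h2
          · exact he h2
          · exact n3 hξ (mem_singleton_iff.1 h2).symm
        · exact Or.inr hξ
      obtain ⟨d, d1, d2⟩ := h.hasDerivAt_waveState hs hp hd n1 n2 hη hedge
      refine (d2.sub ((hasDerivAt_id ξ).mul d1)).congr_deriv ?_
      simp only [id]
      ring
    -- The exceptional rays are the two wave edges and the ray on which the moving band edge equals
    -- η: by V(ℓ ξ) = ξ this ray is ξ = V η.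
    refine isWeakSolution_selfSimilar (S := {sL, sR, V η})
      (G := fun ξ => (waveState L (fun ξ => M (ℓ ξ)) R sL sR ξ).dos η)
      (F := fun ξ => (waveState L (fun ξ => M (ℓ ξ)) R sL sR ξ).flux η) (s₁ := sL) (s₂ := sR)
      (fun ξ hξ => ?_) (fun ξ hξ => ?_) (continuous_iff_continuousAt.2 fun ξ => ?_)
      (fun ξ => (h.isEquilibrium_waveState hs hp ξ).dos_nonneg η) (fun ξ hξ => ?_)
      (fun x t ht => by rw [e x t ht]) (fun x t ht => by rw [e x t ht])
      (fL := L.flux η) (fR := R.flux η)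
    · rw [waveState_of_le (le_of_lt hξ)]; exact ⟨rfl, rfl⟩
    · rw [waveState_of_ge hs (le_of_lt hξ)]; exact ⟨rfl, rfl⟩
    · rcases eq_or_ne ξ sL with rfl | n1
      · obtain ⟨t1, t2⟩ := h.tendsto_left hs hp hη he
        have := t2.sub (tendsto_id.mul t1)
        simp only [ContinuousAt, waveState_of_le le_rfl]
        exact this
      rcases eq_or_ne ξ sR with rfl | n2
      · obtain ⟨t1, t2⟩ := h.tendsto_right hs hp hη he
        have := t2.sub (tendsto_id.mul t1)
        simp only [ContinuousAt, waveState_of_ge hs le_rfl]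
        exact this
      -- On the crossing ray, F − ξG is the continuous combination flux − V · dos composed with ℓ,
      -- as V(ℓ ξ) = ξ.
      by_cases hξ : ξ ∈ Ioo sL sR ∧ ℓ ξ = η
      · obtain ⟨hξ, rfl⟩ := hξ
        have c1 := h.continuousAt _ (hp.mem ξ hξ) hη he
        have c2 := ContinuousAt.comp (f := ℓ) c1 (hd ξ hξ).continuousAt
        refine c2.congr ?_
        filter_upwards [isOpen_Ioo.mem_nhds hξ] with z hz
        simp only [Function.comp]
        rw [waveState_of_mem hz, hp.eq z hz]
      · exact (der ξ n1 n2 fun h1 h2 => hξ ⟨h1, h2⟩).continuousAt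
    · simp only [Finset.mem_insert, Finset.mem_singleton, not_or] at hξ
      exact der ξ hξ.1 hξ.2.1 fun h1 h2 => hξ.2.2 (by rw [← h2, hp.eq ξ h1])
  · refine ((h.tendsto_left hs hp hη he).1.comp (tdiv sL t ht)).congr fun x => ?_
    rw [e x t ht]; rfl
  · refine ((h.tendsto_right hs hp hη he).1.comp (tdiv sR t ht)).congr fun x => ?_
    rw [e x t ht]; rfl

end IsSimpleWave

/-- A simple wave has a profile, which moves with its characteristic velocity, and the centered wave
solves the Riemann problem. -/
theorem IsSimpleWave.exists_profile {M : ℝ → Condensate} {L R : Condensate} {V V' : ℝ → ℝ}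
    {lo hi sL sR : ℝ} (h : IsSimpleWave M L R V V' lo hi sL sR) :
    ∃ ℓ, IsWaveProfile V lo hi sL sR ℓ ∧
      (∀ x t, 0 < t → sL * t < x → x < sR * t →
        TransportAt (fun y τ => ℓ (y / τ)) (V (ℓ (x / t))) x t) ∧
      SolvesRiemannProblem L R sL sR (centeredWave L (fun ξ => M (ℓ ξ)) R sL sR) := by
  obtain ⟨hs, ℓ, hp, hd⟩ :=
    exists_isWaveProfile h.lt h.hasDerivAt h.deriv_pos h.speed_left h.speed_right
  refine ⟨ℓ, hp, fun x t ht h1 h2 => ?_, h.solvesRiemannProblem hs hp hd⟩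
  have hξ : x / t ∈ Ioo sL sR := ⟨(lt_div_iff₀ ht).2 h1, (div_lt_iff₀ ht).2 h2⟩
  rw [hp.eq _ hξ]
  exact transportAt_similarity ht.ne' (hd _ hξ)

/-! ### Derivatives of the density of states with respect to the band edges -/

/-- Up to a common factor the two sides are ∂(us)/∂Y and V ∂u/∂Y. As functions of H both are a
constant plus a simple pole at H = Y. The residues agree because V is the value of s at the edge,
and the constants because of the formula for ∂W/∂Y. -/
theorem flux_slope_eq {H W Y X₁ X₂ : ℝ} (h1 : Y - X₁ ≠ 0) (h2 : Y - X₂ ≠ 0) (hW : Y - W ≠ 0)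
    (hH : H - Y ≠ 0) :
    12 * ((H ^ 2 - (Y + X₁ + X₂) / 2 * H -
        ((Y + X₁ + X₂) * W / 6 - (Y * X₁ + Y * X₂ + X₁ * X₂) / 3)) / (2 * (H - Y)) - H / 2 -
        (W / 6 + (Y + X₁ + X₂) / 6 * wSqSlope W Y X₁ X₂ - (X₁ + X₂) / 3)) =
      edgeVelocity W Y X₁ X₂ * ((H - W) / (2 * (H - Y)) - wSqSlope W Y X₁ X₂) := by
  have e : W - Y = -(Y - W) := by ring
  simp only [wSqSlope, edgeVelocity]
  rw [e]
  field_simp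
  ring

theorem hasDerivAt_div_sqrt {N P : ℝ → ℝ} {N' P' y : ℝ} (hN : HasDerivAt N N' y)
    (hP : HasDerivAt P P' y) (h : 0 < P y) :
    HasDerivAt (fun y => N y / Real.sqrt (P y))
      ((N' - N y * P' / (2 * P y)) / Real.sqrt (P y)) y := by
  have hs := Real.sqrt_pos.2 h
  refine (hN.div (hP.sqrt h.ne') hs.ne').congr_deriv ?_
  have e : P y = Real.sqrt (P y) ^ 2 := (Real.sq_sqrt h.le).symm
  generalize Real.sqrt (P y) = s at *
  rw [e]
  field_simp

namespace Condensate

theorem dos_genus1_eq {a b c η ε : ℝ} (h0 : 0 ≤ η)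
    (h : (η ≤ a ∧ ε = -1) ∨ (a < η ∧ b ≤ η ∧ η ≤ c ∧ ε = 1)) :
    (genus1 a b c).dos η = ε * η / Real.pi * ((η ^ 2 - wSq a b c) /
      Real.sqrt ((η ^ 2 - a ^ 2) * (η ^ 2 - b ^ 2) * (c ^ 2 - η ^ 2))) := by
  rcases h with ⟨h1, rfl⟩ | ⟨h1, h2, h3, rfl⟩
  · rw [dos_genus1_of_mem (Or.inl ⟨h0, h1⟩), if_pos h1, div_mul_div_comm, mul_assoc (-1) η]
  · rw [dos_genus1_of_mem (Or.inr ⟨h2, h3⟩), if_neg h1.not_ge, div_mul_div_comm, mul_assoc 1 η]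

theorem flux_genus1_eq {a b c η ε : ℝ} (ha : 0 ≤ a) (hab : a < b) (hbc : b < c) (h0 : 0 ≤ η)
    (h : (η ≤ a ∧ ε = -1) ∨ (a < η ∧ b ≤ η ∧ η ≤ c ∧ ε = 1)) :
    (genus1 a b c).flux η = ε * η / Real.pi *
      (12 * (η ^ 4 - hSq a b c * η ^ 2 - rSq a b c) /
        Real.sqrt ((η ^ 2 - a ^ 2) * (η ^ 2 - b ^ 2) * (c ^ 2 - η ^ 2))) := by
  have hd : η ^ 2 - wSq a b c ≠ 0 := velocity_den_ne ha hab hbc h0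
    (h.imp (fun h => h.1) fun h => h.2.1)
  rw [flux, dos_genus1_eq h0 h, velocity]
  generalize Real.sqrt ((η ^ 2 - a ^ 2) * (η ^ 2 - b ^ 2) * (c ^ 2 - η ^ 2)) = s
  rcases eq_or_ne s 0 with rfl | hs
  · simp
  · field_simp

theorem flux_eq_zero {C : Condensate} {η : ℝ} (h : C.dos η = 0) : C.flux η = 0 := by
  rw [flux, h, zero_mul]

/-- Off the band edges, `η` is in the interior of a band or of a gap. -/
theorem band_or_gap {a b c η : ℝ} (h : η ∉ (genus1 a b c).edges) :
    η < a ∨ (b < η ∧ η < c) ∨ (a < η ∧ η < b) ∨ (a < η ∧ c < η) := by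
  simp only [edges, mem_insert_iff, mem_singleton_iff, not_or] at h
  rcases lt_or_gt_of_ne h.1 with h1 | h1
  · exact Or.inl h1
  rcases lt_or_gt_of_ne h.2.1 with h2 | h2
  · exact Or.inr (Or.inr (Or.inl ⟨h1, h2⟩))
  rcases lt_or_gt_of_ne h.2.2 with h3 | h3
  · exact Or.inr (Or.inl ⟨h2, h3⟩)
  · exact Or.inr (Or.inr (Or.inr ⟨h1, h3⟩))

theorem dos_genus1_gap {a b c η : ℝ} (h : (a < η ∧ η < b) ∨ (a < η ∧ c < η)) :
    (genus1 a b c).dos η = 0 := by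
  refine dos_genus1_of_notMem ?_
  rintro (h1 | h1)
  · rcases h with h | h <;> linarith [h1.2, h.1]
  · rcases h with h | h <;> linarith [h1.1, h1.2, h.2]

theorem radicand_pos {a b c η : ℝ} (ha : 0 ≤ a) (hab : a < b) (hbc : b < c) (h0 : 0 ≤ η)
    (h : η < a ∨ (b < η ∧ η < c)) :
    0 < (η ^ 2 - a ^ 2) * (η ^ 2 - b ^ 2) * (c ^ 2 - η ^ 2) := by
  have h1 := sq_lt_sq_of_nonneg ha hab
  have h2 := sq_lt_sq_of_nonneg (ha.trans hab.le) hbc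
  rcases h with h | h
  · have := sq_lt_sq_of_nonneg h0 h
    exact mul_pos (mul_pos_of_neg_of_neg (by linarith) (by linarith)) (by linarith)
  · have h3 := sq_lt_sq_of_nonneg (ha.trans hab.le) h.1
    have h4 := sq_lt_sq_of_nonneg h0 h.2
    exact mul_pos (mul_pos (by linarith) (by linarith)) (by linarith)

/-- The edges contribute additively, each with its own Whitham velocity: the Whitham system is the
kinetic equation in diagonal form. With arbitrary edge curves, every single-edge wave is the case
where two of the derivatives a′, b′, c′ vanish. -/
theorem hasDerivAt_dos_flux_genus1 {a b c : ℝ → ℝ} {a' b' c' y η : ℝ}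
    (ho : ∀ᶠ z in 𝓝 y, 0 ≤ a z ∧ a z < b z ∧ b z < c z) (da : HasDerivAt a a' y)
    (db : HasDerivAt b b' y) (dc : HasDerivAt c c' y) (h0 : 0 < η)
    (hη : η ∉ (genus1 (a y) (b y) (c y)).edges) : ∃ p q r : ℝ,
      HasDerivAt (fun y => (genus1 (a y) (b y) (c y)).dos η) (p * a' + q * b' + r * c') y ∧
      HasDerivAt (fun y => (genus1 (a y) (b y) (c y)).flux η)
        (whithamV1 (a y) (b y) (c y) * (p * a') + whithamV2 (a y) (b y) (c y) * (q * b')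
          + whithamV3 (a y) (b y) (c y) * (r * c')) y := by
  obtain ⟨ha, hab, hbc⟩ := ho.self_of_nhds
  have ca := da.continuousAt
  have cb := db.continuousAt
  have cc := dc.continuousAt
  -- The sign ε is −1 on the lower band and 1 on the upper one. It is constant nearby as long as η
  -- avoids the edges. In the gap and above the upper band the density is locally zero.
  have main : ∀ ε : ℝ, (η < a y ∨ (b y < η ∧ η < c y)) →
      (∀ᶠ z in 𝓝 y, (η ≤ a z ∧ ε = -1) ∨ (a z < η ∧ b z ≤ η ∧ η ≤ c z ∧ ε = 1)) →
      ∃ p q r : ℝ,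
        HasDerivAt (fun y => (genus1 (a y) (b y) (c y)).dos η) (p * a' + q * b' + r * c') y ∧
        HasDerivAt (fun y => (genus1 (a y) (b y) (c y)).flux η)
          (whithamV1 (a y) (b y) (c y) * (p * a') + whithamV2 (a y) (b y) (c y) * (q * b')
            + whithamV3 (a y) (b y) (c y) * (r * c')) y := by
    intro ε hη' hev
    have h1 := sq_lt_sq_of_nonneg ha hab
    have h2 := sq_lt_sq_of_nonneg (ha.trans hab.le) hbc
    have hw1 := lt_wSq ha hab hbc
    have hw2 := wSq_lt ha hab hbc
    have hpos := radicand_pos ha hab hbc h0.le hη'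
    have nA : η ^ 2 - a y ^ 2 ≠ 0 := fun h => by rw [h] at hpos; simp at hpos
    have nB : η ^ 2 - b y ^ 2 ≠ 0 := fun h => by rw [h] at hpos; simp at hpos
    have nC : η ^ 2 - c y ^ 2 ≠ 0 := fun h => by
      rw [← neg_sub (η ^ 2), h] at hpos; simp at hpos
    have dW := hasDerivAt_wSq ha hab hbc da db dc
    have dA := da.fun_pow 2
    have dB := db.fun_pow 2
    have dC := dc.fun_pow 2
    have dR : HasDerivAt (fun y => rSq (a y) (b y) (c y)) _ y :=
      (((((dA.add dB).add dC).mul dW).div_const 6).sub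
        ((((dA.mul dB).add (dB.mul dC)).add (dC.mul dA)).div_const 3)).congr_of_eventuallyEq
        (Eventually.of_forall fun z => by simp only [rSq_eq, Pi.add_apply, Pi.mul_apply, Pi.sub_apply])
    have dH : HasDerivAt (fun y => hSq (a y) (b y) (c y)) _ y := ((dA.add dB).add dC).div_const 2
    have dP := ((dA.const_sub (η ^ 2)).mul (dB.const_sub (η ^ 2))).mul (dC.sub_const (η ^ 2))
    have d1 := (hasDerivAt_div_sqrt (dW.const_sub (η ^ 2)) dP hpos).const_mul (ε * η / Real.pi)
    have d2 := (hasDerivAt_div_sqrt ((((dH.mul_const (η ^ 2)).const_sub (η ^ 4)).sub dR).const_mul 12)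
      dP hpos).const_mul (ε * η / Real.pi)
    have k1 := flux_slope_eq (H := η ^ 2) (W := wSq (a y) (b y) (c y)) (Y := a y ^ 2)
      (X₁ := b y ^ 2) (X₂ := c y ^ 2) (by linarith) (by linarith) (by linarith) (nA)
    have k2 := flux_slope_eq (H := η ^ 2) (W := wSq (a y) (b y) (c y)) (Y := b y ^ 2)
      (X₁ := a y ^ 2) (X₂ := c y ^ 2) (by linarith) (by linarith) (by linarith) (nB)
    have k3 := flux_slope_eq (H := η ^ 2) (W := wSq (a y) (b y) (c y)) (Y := c y ^ 2)
      (X₁ := a y ^ 2) (X₂ := b y ^ 2) (by linarith) (by linarith) (by linarith) (nC)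
    rw [← whithamV1_eq ha hab hbc] at k1
    rw [← whithamV2_eq ha hab hbc] at k2
    rw [← whithamV3_eq ha hab hbc] at k3
    refine ⟨ε * η / Real.pi * ((((η ^ 2 - wSq (a y) (b y) (c y)) / (2 * (η ^ 2 - a y ^ 2)) -
      wSqSlope (wSq (a y) (b y) (c y)) (a y ^ 2) (b y ^ 2) (c y ^ 2)) * (2 * a y)) /
        Real.sqrt ((η ^ 2 - a y ^ 2) * (η ^ 2 - b y ^ 2) * (c y ^ 2 - η ^ 2))),
      ε * η / Real.pi * ((((η ^ 2 - wSq (a y) (b y) (c y)) / (2 * (η ^ 2 - b y ^ 2)) -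
      wSqSlope (wSq (a y) (b y) (c y)) (b y ^ 2) (a y ^ 2) (c y ^ 2)) * (2 * b y)) /
        Real.sqrt ((η ^ 2 - a y ^ 2) * (η ^ 2 - b y ^ 2) * (c y ^ 2 - η ^ 2))),
      ε * η / Real.pi * ((((η ^ 2 - wSq (a y) (b y) (c y)) / (2 * (η ^ 2 - c y ^ 2)) -
      wSqSlope (wSq (a y) (b y) (c y)) (c y ^ 2) (a y ^ 2) (b y ^ 2)) * (2 * c y)) /
        Real.sqrt ((η ^ 2 - a y ^ 2) * (η ^ 2 - b y ^ 2) * (c y ^ 2 - η ^ 2))),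
      (d1.congr_of_eventuallyEq ?_).congr_deriv ?_, (d2.congr_of_eventuallyEq ?_).congr_deriv ?_⟩
    · filter_upwards [hev] with z hz using dos_genus1_eq h0.le hz
    · simp only [Pi.mul_apply]
      generalize wSqSlope (wSq (a y) (b y) (c y)) (a y ^ 2) (b y ^ 2) (c y ^ 2) = sA
      generalize wSqSlope (wSq (a y) (b y) (c y)) (b y ^ 2) (a y ^ 2) (c y ^ 2) = sB
      generalize wSqSlope (wSq (a y) (b y) (c y)) (c y ^ 2) (a y ^ 2) (b y ^ 2) = sC
      have nC' : c y ^ 2 - η ^ 2 ≠ 0 := fun h => nC (by linarith)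
      have e : η ^ 2 - c y ^ 2 = -(c y ^ 2 - η ^ 2) := by ring
      rw [e]
      push_cast
      field_simp
      ring
    · filter_upwards [hev, ho] with z hz hz' using
        flux_genus1_eq hz'.1 hz'.2.1 hz'.2.2 h0.le hz
    -- The logarithmic derivative of the radicand separates the three edges, so that `flux_slope_eq`
    -- can be applied to each of them.
    · have eP : ∀ N u v w : ℝ, N * (((-u) * (η ^ 2 - b y ^ 2) + (η ^ 2 - a y ^ 2) * (-v)) *
          (c y ^ 2 - η ^ 2) + (η ^ 2 - a y ^ 2) * (η ^ 2 - b y ^ 2) * w) /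
          (2 * ((η ^ 2 - a y ^ 2) * (η ^ 2 - b y ^ 2) * (c y ^ 2 - η ^ 2))) =
          -(N / (2 * (η ^ 2 - a y ^ 2)) * u + N / (2 * (η ^ 2 - b y ^ 2)) * v +
            N / (2 * (η ^ 2 - c y ^ 2)) * w) := fun N u v w => by
        have nC' : c y ^ 2 - η ^ 2 ≠ 0 := fun h => nC (by linarith)
        have e : η ^ 2 - c y ^ 2 = -(c y ^ 2 - η ^ 2) := by ring
        rw [e]
        field_simp
        ring
      simp only [Pi.mul_apply, Pi.add_apply, Pi.sub_apply, eP]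
      simp only [hSq, rSq_eq]
      generalize whithamV1 (a y) (b y) (c y) = V1 at *
      generalize whithamV2 (a y) (b y) (c y) = V2 at *
      generalize whithamV3 (a y) (b y) (c y) = V3 at *
      generalize wSqSlope (wSq (a y) (b y) (c y)) (a y ^ 2) (b y ^ 2) (c y ^ 2) = sA at *
      generalize wSqSlope (wSq (a y) (b y) (c y)) (b y ^ 2) (a y ^ 2) (c y ^ 2) = sB at *
      generalize wSqSlope (wSq (a y) (b y) (c y)) (c y ^ 2) (a y ^ 2) (b y ^ 2) = sC at *
      generalize Real.sqrt ((η ^ 2 - a y ^ 2) * (η ^ 2 - b y ^ 2) * (c y ^ 2 - η ^ 2)) = s at *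
      push_cast
      linear_combination (ε * η / Real.pi / s * (2 * a y * a')) * k1 +
        (ε * η / Real.pi / s * (2 * b y * b')) * k2 + (ε * η / Real.pi / s * (2 * c y * c')) * k3
  rcases band_or_gap hη with h | h | h
  · refine main (-1) (Or.inl h) ?_
    filter_upwards [ca.eventually (lt_mem_nhds h)] with z hz using Or.inl ⟨hz.le, rfl⟩
  · refine main 1 (Or.inr h) ?_
    filter_upwards [ca.eventually (gt_mem_nhds (hab.trans h.1)), cb.eventually (gt_mem_nhds h.1),
      cc.eventually (lt_mem_nhds h.2)] with z h1 h2 h3 using Or.inr ⟨h1, h2.le, h3.le, rfl⟩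
  · have hev : ∀ᶠ z in 𝓝 y, (genus1 (a z) (b z) (c z)).dos η = 0 := by
      rcases h with h | h
      · filter_upwards [ca.eventually (gt_mem_nhds h.1), cb.eventually (lt_mem_nhds h.2)]
          with z h1 h2 using dos_genus1_gap (Or.inl ⟨h1, h2⟩)
      · filter_upwards [ca.eventually (gt_mem_nhds h.1), cc.eventually (gt_mem_nhds h.2)]
          with z h1 h2 using dos_genus1_gap (Or.inr ⟨h1, h2⟩)
    refine ⟨0, 0, 0, ((hasDerivAt_const y (0 : ℝ)).congr_of_eventuallyEq ?_).congr_deriv (by ring),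
      ((hasDerivAt_const y (0 : ℝ)).congr_of_eventuallyEq ?_).congr_deriv (by ring)⟩
    · filter_upwards [hev] with z hz using hz
    · filter_upwards [hev] with z hz using flux_eq_zero hz

end Condensate

/-! ### Limits of the density of states -/

namespace Condensate

theorem dos_genus0_eq {a η : ℝ} (h0 : 0 ≤ η) (h : η ≤ a) :
    (genus0 a).dos η = η / Real.pi * (1 / Real.sqrt (a ^ 2 - η ^ 2)) := by
  rw [dos_genus0_of_mem ⟨h0, h⟩, div_mul_div_comm, mul_one]

theorem flux_genus0_eq {a η : ℝ} (h0 : 0 ≤ η) (h : η ≤ a) :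
    (genus0 a).flux η = η / Real.pi * (6 * (2 * η ^ 2 - a ^ 2) / Real.sqrt (a ^ 2 - η ^ 2)) := by
  rw [flux, dos_genus0_eq h0 h, velocity]
  ring

theorem dos_genus0_of_lt {a η : ℝ} (h : a < η) : (genus0 a).dos η = 0 :=
  dos_genus0_of_notMem fun h1 => absurd h1.2 h.not_ge

section Limits

variable {ι : Type*} {l : Filter ι} {a b c : ι → ℝ} {a₀ b₀ c₀ η : ℝ}
  (ho : ∀ᶠ i in l, 0 ≤ a i ∧ a i < b i ∧ b i < c i) (h0 : 0 < η)
  (ta : Tendsto a l (𝓝 a₀)) (tb : Tendsto b l (𝓝 b₀)) (tc : Tendsto c l (𝓝 c₀))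

theorem tendsto_dos_flux_of_eventually_zero {M : ι → Condensate} {C : Condensate}
    (h : ∀ᶠ i in l, (M i).dos η = 0) (hC : C.dos η = 0) :
    Tendsto (fun i => (M i).dos η) l (𝓝 (C.dos η)) ∧
    Tendsto (fun i => (M i).flux η) l (𝓝 (C.flux η)) := by
  rw [hC, flux_eq_zero hC]
  refine ⟨tendsto_const_nhds.congr' ?_, tendsto_const_nhds.congr' ?_⟩
  · filter_upwards [h] with i hi using hi.symm
  · filter_upwards [h] with i hi using (flux_eq_zero hi).symm

include ta tb tc

theorem eventually_gap (h : (a₀ < η ∧ η < b₀) ∨ (a₀ < η ∧ c₀ < η)) :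
    ∀ᶠ i in l, (genus1 (a i) (b i) (c i)).dos η = 0 := by
  rcases h with h | h
  · filter_upwards [ta.eventually (gt_mem_nhds h.1), tb.eventually (lt_mem_nhds h.2)]
      with z h1 h2 using dos_genus1_gap (Or.inl ⟨h1, h2⟩)
  · filter_upwards [ta.eventually (gt_mem_nhds h.1), tc.eventually (gt_mem_nhds h.2)]
      with z h1 h2 using dos_genus1_gap (Or.inr ⟨h1, h2⟩)

theorem eventually_band {ε : ℝ}
    (h : (η < a₀ ∧ ε = -1) ∨ (a₀ < η ∧ b₀ < η ∧ η < c₀ ∧ ε = 1)) :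
    ∀ᶠ i in l, (η ≤ a i ∧ ε = -1) ∨ (a i < η ∧ b i ≤ η ∧ η ≤ c i ∧ ε = 1) := by
  rcases h with h | h
  · filter_upwards [ta.eventually (lt_mem_nhds h.1)] with z h1 using Or.inl ⟨h1.le, h.2⟩
  · filter_upwards [ta.eventually (gt_mem_nhds h.1), tb.eventually (gt_mem_nhds h.2.1),
      tc.eventually (lt_mem_nhds h.2.2.1)] with z h1 h2 h3
      using Or.inr ⟨h1, h2.le, h3.le, h.2.2.2⟩

include ho h0

/-- The limits of the edges and of w² enter independently, and two edges may merge. Only positivity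
of the limiting radicand is needed, so the degenerate ends of the waves are included. -/
theorem tendsto_dos_flux_of_band {W₀ ε : ℝ}
    (tW : Tendsto (fun i => wSq (a i) (b i) (c i)) l (𝓝 W₀))
    (h : (η < a₀ ∧ ε = -1) ∨ (a₀ < η ∧ b₀ < η ∧ η < c₀ ∧ ε = 1))
    (hpos : 0 < (η ^ 2 - a₀ ^ 2) * (η ^ 2 - b₀ ^ 2) * (c₀ ^ 2 - η ^ 2)) :
    Tendsto (fun i => (genus1 (a i) (b i) (c i)).dos η) l (𝓝 (ε * η / Real.pi *
      ((η ^ 2 - W₀) / Real.sqrt ((η ^ 2 - a₀ ^ 2) * (η ^ 2 - b₀ ^ 2) * (c₀ ^ 2 - η ^ 2))))) ∧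
    Tendsto (fun i => (genus1 (a i) (b i) (c i)).flux η) l (𝓝 (ε * η / Real.pi *
      (12 * (η ^ 4 - (a₀ ^ 2 + b₀ ^ 2 + c₀ ^ 2) / 2 * η ^ 2 - ((a₀ ^ 2 + b₀ ^ 2 + c₀ ^ 2) * W₀ / 6
          - (a₀ ^ 2 * b₀ ^ 2 + b₀ ^ 2 * c₀ ^ 2 + c₀ ^ 2 * a₀ ^ 2) / 3)) /
        Real.sqrt ((η ^ 2 - a₀ ^ 2) * (η ^ 2 - b₀ ^ 2) * (c₀ ^ 2 - η ^ 2))))) := by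
  have hev := eventually_band ta tb tc h
  have tA := ta.pow 2
  have tB := tb.pow 2
  have tC := tc.pow 2
  have tP := (((tA.const_sub (η ^ 2)).mul (tB.const_sub (η ^ 2))).mul (tC.sub_const (η ^ 2))).sqrt
  have hs := (Real.sqrt_pos.2 hpos).ne'
  refine ⟨(((tW.const_sub (η ^ 2)).div tP hs).const_mul (ε * η / Real.pi)).congr' ?_,
    (((((((((tA.add tB).add tC).div_const 2).mul_const (η ^ 2)).const_sub (η ^ 4)).sub
      (((((tA.add tB).add tC).mul tW).div_const 6).sub
        ((((tA.mul tB).add (tB.mul tC)).add (tC.mul tA)).div_const 3))).const_mul 12).div tP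
      hs).const_mul (ε * η / Real.pi)).congr' ?_⟩
  · filter_upwards [hev] with i hi using (dos_genus1_eq h0.le hi).symm
  · filter_upwards [hev, ho] with i hi hi'
    rw [flux_genus1_eq hi'.1 hi'.2.1 hi'.2.2 h0.le hi, hSq, rSq_eq]
    rfl

theorem tendsto_dos_flux_genus1 (ha : 0 ≤ a₀) (hab : a₀ < b₀) (hbc : b₀ < c₀)
    (hη : η ∉ (genus1 a₀ b₀ c₀).edges) :
    Tendsto (fun i => (genus1 (a i) (b i) (c i)).dos η) l (𝓝 ((genus1 a₀ b₀ c₀).dos η)) ∧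
    Tendsto (fun i => (genus1 (a i) (b i) (c i)).flux η) l (𝓝 ((genus1 a₀ b₀ c₀).flux η)) := by
  have main : ∀ ε : ℝ, (η < a₀ ∧ ε = -1) ∨ (a₀ < η ∧ b₀ < η ∧ η < c₀ ∧ ε = 1) →
      Tendsto (fun i => (genus1 (a i) (b i) (c i)).dos η) l (𝓝 ((genus1 a₀ b₀ c₀).dos η)) ∧
      Tendsto (fun i => (genus1 (a i) (b i) (c i)).flux η) l
        (𝓝 ((genus1 a₀ b₀ c₀).flux η)) := fun ε h => by
    have h' : (η ≤ a₀ ∧ ε = -1) ∨ (a₀ < η ∧ b₀ ≤ η ∧ η ≤ c₀ ∧ ε = 1) :=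
      h.imp (fun h => ⟨h.1.le, h.2⟩) fun h => ⟨h.1, h.2.1.le, h.2.2.1.le, h.2.2.2⟩
    have := tendsto_dos_flux_of_band ho h0 ta tb tc (tendsto_wSq ha hab hbc ta tb tc) h
      (radicand_pos ha hab hbc h0.le (h.imp (fun h => h.1) fun h => ⟨h.2.1, h.2.2.1⟩))
    rw [← rSq_eq] at this
    rwa [dos_genus1_eq h0.le h', flux_genus1_eq ha hab hbc h0.le h']
  rcases band_or_gap hη with h | h | h
  · exact main (-1) (Or.inl ⟨h, rfl⟩)
  · exact main 1 (Or.inr ⟨hab.trans h.1, h.1, h.2, rfl⟩)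
  · exact tendsto_dos_flux_of_eventually_zero (eventually_gap ta tb tc h) (dos_genus1_gap h)

-- When a and b merge, w² tends to the same square. The factor η² − w² then cancels the double root
-- of the radicand, and the band sign ε matches the sign of η² − a₀², leaving the genus 0 density of
-- the remaining edge.
omit tb in
theorem tendsto_dos_flux_of_lower_gap (tb : Tendsto b l (𝓝 a₀)) (ha : 0 ≤ a₀) (hac : a₀ < c₀)
    (h1 : η ≠ a₀) (h2 : η ≠ c₀) :
    Tendsto (fun i => (genus1 (a i) (b i) (c i)).dos η) l (𝓝 ((genus0 c₀).dos η)) ∧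
    Tendsto (fun i => (genus1 (a i) (b i) (c i)).flux η) l (𝓝 ((genus0 c₀).flux η)) := by
  rcases h2.lt_or_gt with h2 | h2
  · obtain ⟨ε, h, hε⟩ : ∃ ε : ℝ, ((η < a₀ ∧ ε = -1) ∨ (a₀ < η ∧ a₀ < η ∧ η < c₀ ∧ ε = 1)) ∧
        |η ^ 2 - a₀ ^ 2| = ε * (η ^ 2 - a₀ ^ 2) := by
      rcases h1.lt_or_gt with h1 | h1
      · refine ⟨-1, Or.inl ⟨h1, rfl⟩, ?_⟩
        rw [abs_of_neg (by linarith [sq_lt_sq_of_nonneg h0.le h1]), neg_one_mul]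
      · refine ⟨1, Or.inr ⟨h1, h1, h2, rfl⟩, ?_⟩
        rw [abs_of_pos (by linarith [sq_lt_sq_of_nonneg ha h1]), one_mul]
    have hE : η ^ 2 - a₀ ^ 2 ≠ 0 := fun h =>
      h1 ((pow_left_inj₀ h0.le ha two_ne_zero).1 (sub_eq_zero.1 h))
    have hC := sq_lt_sq_of_nonneg h0.le h2
    have hpos : 0 < (η ^ 2 - a₀ ^ 2) * (η ^ 2 - a₀ ^ 2) * (c₀ ^ 2 - η ^ 2) :=
      mul_pos (mul_self_pos.2 hE) (by linarith)
    have := tendsto_dos_flux_of_band ho h0 ta tb tc (tendsto_wSq_of_lower_gap ho ta tb) h hpos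
    have hs : Real.sqrt ((η ^ 2 - a₀ ^ 2) * (η ^ 2 - a₀ ^ 2) * (c₀ ^ 2 - η ^ 2)) =
        ε * (η ^ 2 - a₀ ^ 2) * Real.sqrt (c₀ ^ 2 - η ^ 2) := by
      rw [Real.sqrt_mul (mul_self_nonneg _), Real.sqrt_mul_self_eq_abs, hε]
    have hε0 : ε ≠ 0 := fun h0 => by
      rw [h0, zero_mul, abs_eq_zero] at hε; exact hE hε
    have hs0 := (Real.sqrt_pos.2 (sub_pos.2 hC)).ne'
    rw [hs] at this
    rw [dos_genus0_eq h0.le h2.le, flux_genus0_eq h0.le h2.le]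
    convert this using 3 <;> (field_simp; try ring)
  · refine tendsto_dos_flux_of_eventually_zero (eventually_gap ta tb tc (Or.inr ⟨hac.trans h2, h2⟩))
      (dos_genus0_of_lt h2)

-- For η below a₀ the factor w² − η² tends to b₀² − η² and cancels the double root left by the
-- collapsed band. For η above a₀, away from b₀, the density is eventually zero.
omit tc in
theorem tendsto_dos_flux_of_upper_band (tc : Tendsto c l (𝓝 b₀)) (ha : 0 ≤ a₀) (hab : a₀ < b₀)
    (h1 : η ≠ a₀) (h2 : η ≠ b₀) :
    Tendsto (fun i => (genus1 (a i) (b i) (c i)).dos η) l (𝓝 ((genus0 a₀).dos η)) ∧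
    Tendsto (fun i => (genus1 (a i) (b i) (c i)).flux η) l (𝓝 ((genus0 a₀).flux η)) := by
  rcases h1.lt_or_gt with h1 | h1
  · have hA := sq_lt_sq_of_nonneg h0.le h1
    have hB := sq_lt_sq_of_nonneg ha hab
    have e : (η ^ 2 - a₀ ^ 2) * (η ^ 2 - b₀ ^ 2) * (b₀ ^ 2 - η ^ 2) =
        (b₀ ^ 2 - η ^ 2) * (b₀ ^ 2 - η ^ 2) * (a₀ ^ 2 - η ^ 2) := by ring
    have hb0 : 0 < b₀ ^ 2 - η ^ 2 := by linarith
    have hpos : 0 < (η ^ 2 - a₀ ^ 2) * (η ^ 2 - b₀ ^ 2) * (b₀ ^ 2 - η ^ 2) := by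
      rw [e]
      exact mul_pos (mul_pos hb0 hb0) (by linarith)
    have := tendsto_dos_flux_of_band ho h0 ta tb tc
      (tendsto_wSq_of_upper_band ho ha hab ta tb tc) (Or.inl ⟨h1, rfl⟩) hpos
    have hs : Real.sqrt ((η ^ 2 - a₀ ^ 2) * (η ^ 2 - b₀ ^ 2) * (b₀ ^ 2 - η ^ 2)) =
        (b₀ ^ 2 - η ^ 2) * Real.sqrt (a₀ ^ 2 - η ^ 2) := by
      rw [e, Real.sqrt_mul (mul_self_nonneg _), Real.sqrt_mul_self hb0.le]
    have hs0 := (Real.sqrt_pos.2 (sub_pos.2 hA)).ne'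
    rw [hs] at this
    rw [dos_genus0_eq h0.le h1.le, flux_genus0_eq h0.le h1.le]
    convert this using 3 <;> (field_simp; try ring)
  · refine tendsto_dos_flux_of_eventually_zero (eventually_gap ta tb tc ?_) (dos_genus0_of_lt h1)
    exact h2.lt_or_gt.imp (fun h => ⟨h1, h⟩) fun h => ⟨h1, h⟩

end Limits

/-! ### Passage of a band edge through a spectral value -/

/-- At y = η the bound is 0, so it forces P η = 0 and tends to the same value. This agrees with the
convention that a density with vanishing denominator is 0. -/
theorem continuousAt_of_abs_le_sqrt {P k : ℝ → ℝ} {η D : ℝ} (hk : ContinuousAt k η)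
    (h : ∀ᶠ y in 𝓝 η, |P y| ≤ |k y| * Real.sqrt |η ^ 2 - y ^ 2| / D) : ContinuousAt P η := by
  have e : P η = 0 := by simpa using h.self_of_nhds
  have t : Tendsto (fun y => |k y| * Real.sqrt |η ^ 2 - y ^ 2| / D) (𝓝 η) (𝓝 0) := by
    have c1 : ContinuousAt (fun y : ℝ => Real.sqrt |η ^ 2 - y ^ 2|) η := by fun_prop
    have := (hk.abs.mul c1).div_const D
    simpa [ContinuousAt] using this.tendsto
  rw [ContinuousAt, e]
  exact squeeze_zero_norm' h t

/-- The numerator of us − Vu vanishes at η² = Y, because V is the velocity s there. Its factor η² −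
Y over √|η² − Y| leaves √|η² − Y|. The symmetric-function hypotheses allow Y to be any of the three
squared edges. -/
theorem abs_flux_sub_dos_le {a b c η Y X₁ X₂ V : ℝ} (ha : 0 ≤ a) (hab : a < b) (hbc : b < c)
    (h0 : 0 < η) (hY : Y - wSq a b c ≠ 0) (hV : V = edgeVelocity (wSq a b c) Y X₁ X₂)
    (hs : a ^ 2 + b ^ 2 + c ^ 2 = Y + X₁ + X₂)
    (he : a ^ 2 * b ^ 2 + b ^ 2 * c ^ 2 + c ^ 2 * a ^ 2 = Y * X₁ + Y * X₂ + X₁ * X₂)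
    (hp : |(η ^ 2 - a ^ 2) * (η ^ 2 - b ^ 2) * (c ^ 2 - η ^ 2)| =
      |η ^ 2 - Y| * (|η ^ 2 - X₁| * |η ^ 2 - X₂|)) :
    |(genus1 a b c).flux η - V * (genus1 a b c).dos η| ≤
      |η * (12 * (η ^ 2 + Y - (Y + X₁ + X₂) / 2) - V)| * Real.sqrt |η ^ 2 - Y| /
        (Real.pi * Real.sqrt (|η ^ 2 - X₁| * |η ^ 2 - X₂|)) := by
  have main : ∀ ε : ℝ, |ε| = 1 → (η ≤ a ∧ ε = -1) ∨ (a < η ∧ b ≤ η ∧ η ≤ c ∧ ε = 1) →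
      |(genus1 a b c).flux η - V * (genus1 a b c).dos η| ≤
      |η * (12 * (η ^ 2 + Y - (Y + X₁ + X₂) / 2) - V)| * Real.sqrt |η ^ 2 - Y| /
        (Real.pi * Real.sqrt (|η ^ 2 - X₁| * |η ^ 2 - X₂|)) := fun ε hε h => by
    have h1 := sq_lt_sq_of_nonneg ha hab
    have h2 := sq_lt_sq_of_nonneg (ha.trans hab.le) hbc
    have hnn : 0 ≤ (η ^ 2 - a ^ 2) * (η ^ 2 - b ^ 2) * (c ^ 2 - η ^ 2) := by
      rcases h with h | h
      · have := pow_le_pow_left₀ h0.le h.1 2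
        exact mul_nonneg (mul_nonneg_of_nonpos_of_nonpos (by linarith) (by linarith)) (by linarith)
      · have h3 := pow_le_pow_left₀ (ha.trans hab.le) h.2.1 2
        have h4 := pow_le_pow_left₀ h0.le h.2.2.1 2
        exact mul_nonneg (mul_nonneg (by linarith) (by linarith)) (by linarith)
    rw [abs_of_nonneg hnn] at hp
    rw [dos_genus1_eq h0.le h, flux_genus1_eq ha hab hbc h0.le h, hp,
      Real.sqrt_mul (abs_nonneg _), hSq, rSq_eq, hs, he]
    have e : 12 * (η ^ 4 - (Y + X₁ + X₂) / 2 * η ^ 2 - ((Y + X₁ + X₂) * wSq a b c / 6 -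
        (Y * X₁ + Y * X₂ + X₁ * X₂) / 3)) - V * (η ^ 2 - wSq a b c) =
        (η ^ 2 - Y) * (12 * (η ^ 2 + Y - (Y + X₁ + X₂) / 2) - V) := by
      rw [hV, edgeVelocity]
      field_simp
      ring
    have hs0 := Real.sqrt_nonneg (|η ^ 2 - X₁| * |η ^ 2 - X₂|)
    generalize Real.sqrt (|η ^ 2 - X₁| * |η ^ 2 - X₂|) = s at *
    have e2 : ∀ N₁ N₂ u : ℝ, ε * η / Real.pi * (N₁ / (u * s)) - V * (ε * η / Real.pi *
        (N₂ / (u * s))) = ε * η / Real.pi * ((N₁ - V * N₂) / (u * s)) := fun N₁ N₂ u => by ring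
    rw [e2, e, abs_mul, abs_div, abs_mul ε, hε, abs_div (_ * _), abs_mul (η ^ 2 - Y),
      abs_mul (Real.sqrt _), abs_of_pos Real.pi_pos, abs_of_nonneg hs0,
      abs_of_nonneg (Real.sqrt_nonneg _), abs_mul η]
    refine le_of_eq ?_
    conv_rhs => rw [← Real.div_sqrt (x := |η ^ 2 - Y|)]
    ring
  have nonneg : 0 ≤ |η * (12 * (η ^ 2 + Y - (Y + X₁ + X₂) / 2) - V)| * Real.sqrt |η ^ 2 - Y| /
      (Real.pi * Real.sqrt (|η ^ 2 - X₁| * |η ^ 2 - X₂|)) := by positivity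
  by_cases hm : η ∈ Icc 0 a ∪ Icc b c
  · rcases le_or_gt η a with h | h
    · exact main (-1) (by simp) (Or.inl ⟨h, rfl⟩)
    · rcases hm with hm | hm
      · exact absurd hm.2 h.not_ge
      · exact main 1 (by simp) (Or.inr ⟨h, hm.1, hm.2, rfl⟩)
  · have := dos_genus1_of_notMem hm
    rw [flux_eq_zero this, this]
    simpa using nonneg

/-! ### Simple waves of genus 0 -/

theorem hasDerivAt_dos_flux_genus0 {y η : ℝ} (h0 : 0 < η) (hη : η ≠ y) : ∃ d : ℝ,
    HasDerivAt (fun y => (genus0 y).dos η) d y ∧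
    HasDerivAt (fun y => (genus0 y).flux η) (6 * y ^ 2 * d) y := by
  rcases hη.lt_or_gt with h | h
  · have hpos : 0 < y ^ 2 - η ^ 2 := by linarith [sq_lt_sq_of_nonneg h0.le h]
    have d : HasDerivAt (fun y : ℝ => y ^ 2) (2 * y) y := by simpa using hasDerivAt_pow 2 y
    have d1 := (hasDerivAt_div_sqrt (hasDerivAt_const y (1 : ℝ)) (d.sub_const (η ^ 2))
      hpos).const_mul (η / Real.pi)
    have d2 := (hasDerivAt_div_sqrt ((d.const_sub (2 * η ^ 2)).const_mul 6) (d.sub_const (η ^ 2))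
      hpos).const_mul (η / Real.pi)
    refine ⟨_, d1.congr_of_eventuallyEq ?_, (d2.congr_of_eventuallyEq ?_).congr_deriv ?_⟩
    · filter_upwards [lt_mem_nhds h] with z hz using dos_genus0_eq h0.le hz.le
    · filter_upwards [lt_mem_nhds h] with z hz using flux_genus0_eq h0.le hz.le
    · field_simp
      ring
  · refine ⟨0, (hasDerivAt_const y (0 : ℝ)).congr_of_eventuallyEq ?_,
      ((hasDerivAt_const y (0 : ℝ)).congr_of_eventuallyEq ?_).congr_deriv (by ring)⟩
    · filter_upwards [gt_mem_nhds h] with z hz using dos_genus0_of_lt hz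
    · filter_upwards [gt_mem_nhds h] with z hz using flux_eq_zero (dos_genus0_of_lt hz)

theorem abs_flux_sub_dos_genus0_le {y η : ℝ} (h0 : 0 < η) :
    |(genus0 y).flux η - 6 * y ^ 2 * (genus0 y).dos η| ≤
      |12 * η| * Real.sqrt |η ^ 2 - y ^ 2| / Real.pi := by
  rcases le_or_gt η y with h | h
  · have hnn : 0 ≤ y ^ 2 - η ^ 2 := by linarith [pow_le_pow_left₀ h0.le h 2]
    rw [abs_sub_comm (η ^ 2), abs_of_nonneg hnn, dos_genus0_eq h0.le h, flux_genus0_eq h0.le h]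
    have e : η / Real.pi * (6 * (2 * η ^ 2 - y ^ 2) / Real.sqrt (y ^ 2 - η ^ 2)) -
        6 * y ^ 2 * (η / Real.pi * (1 / Real.sqrt (y ^ 2 - η ^ 2))) =
        -(12 * η * ((y ^ 2 - η ^ 2) / Real.sqrt (y ^ 2 - η ^ 2)) / Real.pi) := by ring
    rw [Real.div_sqrt] at e
    rw [e, abs_neg, abs_div, abs_mul, abs_of_nonneg (Real.sqrt_nonneg _),
      abs_of_pos Real.pi_pos]
  · rw [flux_eq_zero (dos_genus0_of_lt h), dos_genus0_of_lt h, mul_zero, sub_zero, abs_zero]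
    positivity

theorem isSimpleWave_genus0 {qm qp : ℝ} (h0 : 0 ≤ qm) (h : qm < qp) :
    IsSimpleWave genus0 (genus0 qm) (genus0 qp) (fun y => 6 * y ^ 2) (fun y => 12 * y) qm qp
      (6 * qm ^ 2) (6 * qp ^ 2) where
  lt := h
  hasDerivAt y _ := ((hasDerivAt_pow 2 y).const_mul 6).congr_deriv (by push_cast; ring)
  deriv_pos y hy := by linarith [hy.1]
  speed_left := ((by fun_prop : Continuous fun y : ℝ => 6 * y ^ 2).tendsto qm).mono_left
    nhdsWithin_le_nhds
  speed_right := ((by fun_prop : Continuous fun y : ℝ => 6 * y ^ 2).tendsto qp).mono_left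
    nhdsWithin_le_nhds
  equilibrium_left := isEquilibrium_genus0 h0
  equilibrium_right := isEquilibrium_genus0 (h0.trans h.le)
  equilibrium y hy := isEquilibrium_genus0 (h0.trans hy.1.le)
  edges y _ := subset_union_right
  characteristic y _ η hη he := hasDerivAt_dos_flux_genus0 hη he
  continuousAt η hη hpos _ := continuousAt_of_abs_le_sqrt (k := fun _ => 12 * η) continuousAt_const
    (Eventually.of_forall fun y => abs_flux_sub_dos_genus0_le hpos)
  left η hη he := by
    obtain ⟨d, d1, d2⟩ := hasDerivAt_dos_flux_genus0 hη fun e => he (Or.inl e)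
    exact ⟨d1.continuousAt.tendsto.mono_left nhdsWithin_le_nhds,
      d2.continuousAt.tendsto.mono_left nhdsWithin_le_nhds⟩
  right η hη he := by
    obtain ⟨d, d1, d2⟩ := hasDerivAt_dos_flux_genus0 hη fun e => he (Or.inr e)
    exact ⟨d1.continuousAt.tendsto.mono_left nhdsWithin_le_nhds,
      d2.continuousAt.tendsto.mono_left nhdsWithin_le_nhds⟩

end Condensate

/-! ### Simple waves of genus 1 -/

namespace Condensate

section Moving

variable {L R : Condensate} {a b c lo hi sL sR : ℝ}

/-- The hypothesis `hed` puts the two fixed edges among the edges of L or R, whose values of η are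
excluded from the weak equation. Hence only the moving edge can cross an admissible η. The same
holds for the other two moving edges below. -/
theorem isSimpleWave_one (h0 : 0 ≤ lo) (hlt : lo < hi) (hb : hi ≤ b) (hbc : b < c)
    (tl : Tendsto (fun y => whithamV1 y b c) (𝓝[>] lo) (𝓝 sL))
    (tr : Tendsto (fun y => whithamV1 y b c) (𝓝[<] hi) (𝓝 sR))
    (hL : L.IsEquilibrium) (hR : R.IsEquilibrium) (hed : {b, c} ⊆ L.edges ∪ R.edges)
    (hleft : ∀ η, 0 < η → η ∉ L.edges ∪ R.edges →
      Tendsto (fun y => (genus1 y b c).dos η) (𝓝[>] lo) (𝓝 (L.dos η)) ∧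
      Tendsto (fun y => (genus1 y b c).flux η) (𝓝[>] lo) (𝓝 (L.flux η)))
    (hright : ∀ η, 0 < η → η ∉ L.edges ∪ R.edges →
      Tendsto (fun y => (genus1 y b c).dos η) (𝓝[<] hi) (𝓝 (R.dos η)) ∧
      Tendsto (fun y => (genus1 y b c).flux η) (𝓝[<] hi) (𝓝 (R.flux η))) :
    IsSimpleWave (fun y => genus1 y b c) L R (fun y => whithamV1 y b c)
      (fun y => edgeVelocitySlope (wSq y b c) (y ^ 2) (b ^ 2) (c ^ 2) * (2 * y)) lo hi sL sR := by
  have ord : ∀ y ∈ Ioo lo hi, 0 < y ∧ 0 ≤ y ∧ y < b ∧ b < c := fun y hy =>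
    ⟨h0.trans_lt hy.1, h0.trans hy.1.le, hy.2.trans_le hb, hbc⟩
  have ev : ∀ y ∈ Ioo lo hi, ∀ᶠ z in 𝓝 y, 0 ≤ z ∧ z < b ∧ b < c := fun y hy => by
    filter_upwards [isOpen_Ioo.mem_nhds hy] with z hz using (ord z hz).2
  have dV : ∀ y ∈ Ioo lo hi, HasDerivAt (fun y => whithamV1 y b c)
      (edgeVelocitySlope (wSq y b c) (y ^ 2) (b ^ 2) (c ^ 2) * (2 * y)) y := fun y hy => by
    obtain ⟨-, o1, o2, o3⟩ := ord y hy
    have dW := (hasDerivAt_wSq (a := fun y => y) (b := fun _ => b) (c := fun _ => c) o1 o2 o3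
      (hasDerivAt_id y) (hasDerivAt_const y b) (hasDerivAt_const y c)).congr_deriv
      (show _ = wSqSlope (wSq y b c) (y ^ 2) (b ^ 2) (c ^ 2) * (2 * y) by ring)
    have s1 := sq_lt_sq_of_nonneg o1 o2
    have s2 := sq_lt_sq_of_nonneg (o1.trans o2.le) o3
    refine (hasDerivAt_edgeVelocity (W := fun y => wSq y b c) s1.ne (s1.trans s2).ne
      (lt_wSq o1 o2 o3).ne dW).congr_of_eventuallyEq ?_
    filter_upwards [ev y hy] with z hz using whithamV1_eq hz.1 hz.2.1 hz.2.2
  refine ⟨hlt, dV, fun y hy => ?_, tl, tr, hL, hR, fun y hy => ?_, fun y hy => ?_,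
    fun y hy η hη he => ?_, fun η hη hpos _ => ?_, hleft, hright⟩
  · obtain ⟨o0, o1, o2, o3⟩ := ord y hy
    exact mul_pos (edgeVelocitySlope_pos_one o1 o2 o3) (by linarith)
  · obtain ⟨-, o1, o2, o3⟩ := ord y hy
    exact isEquilibrium_genus1 o1 o2 o3
  · rintro η (h | h)
    · exact Or.inr h
    · exact Or.inl (hed h)
  · obtain ⟨p, q, r, d1, d2⟩ := hasDerivAt_dos_flux_genus1 (a := fun y => y) (b := fun _ => b)
      (c := fun _ => c) (ev y hy) (hasDerivAt_id y) (hasDerivAt_const y b) (hasDerivAt_const y c)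
      hη he
    exact ⟨p, d1.congr_deriv (by ring), d2.congr_deriv (by ring)⟩
  · refine continuousAt_of_abs_le_sqrt
      (k := fun y => η * (12 * (η ^ 2 + y ^ 2 - (y ^ 2 + b ^ 2 + c ^ 2) / 2) - whithamV1 y b c))
      (D := Real.pi * Real.sqrt (|η ^ 2 - b ^ 2| * |η ^ 2 - c ^ 2|))
      (continuousAt_const.mul ((by fun_prop : ContinuousAt (fun y : ℝ =>
        12 * (η ^ 2 + y ^ 2 - (y ^ 2 + b ^ 2 + c ^ 2) / 2)) η).sub (dV η hη).continuousAt)) ?_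
    filter_upwards [ev η hη] with y hy
    refine abs_flux_sub_dos_le hy.1 hy.2.1 hy.2.2 hpos
      (by linarith [lt_wSq hy.1 hy.2.1 hy.2.2]) (whithamV1_eq hy.1 hy.2.1 hy.2.2) (by ring)
      (by ring) ?_
    rw [abs_mul, abs_mul, abs_sub_comm (c ^ 2)]
    ring

theorem isSimpleWave_two (ha : 0 ≤ a) (hlo : a ≤ lo) (hlt : lo < hi) (hc : hi ≤ c)
    (tl : Tendsto (fun y => whithamV2 a y c) (𝓝[>] lo) (𝓝 sL))
    (tr : Tendsto (fun y => whithamV2 a y c) (𝓝[<] hi) (𝓝 sR))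
    (hL : L.IsEquilibrium) (hR : R.IsEquilibrium) (hed : {a, c} ⊆ L.edges ∪ R.edges)
    (hleft : ∀ η, 0 < η → η ∉ L.edges ∪ R.edges →
      Tendsto (fun y => (genus1 a y c).dos η) (𝓝[>] lo) (𝓝 (L.dos η)) ∧
      Tendsto (fun y => (genus1 a y c).flux η) (𝓝[>] lo) (𝓝 (L.flux η)))
    (hright : ∀ η, 0 < η → η ∉ L.edges ∪ R.edges →
      Tendsto (fun y => (genus1 a y c).dos η) (𝓝[<] hi) (𝓝 (R.dos η)) ∧
      Tendsto (fun y => (genus1 a y c).flux η) (𝓝[<] hi) (𝓝 (R.flux η))) :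
    IsSimpleWave (fun y => genus1 a y c) L R (fun y => whithamV2 a y c)
      (fun y => edgeVelocitySlope (wSq a y c) (y ^ 2) (a ^ 2) (c ^ 2) * (2 * y)) lo hi sL sR := by
  have ord : ∀ y ∈ Ioo lo hi, 0 < y ∧ 0 ≤ a ∧ a < y ∧ y < c := fun y hy =>
    ⟨(ha.trans hlo).trans_lt hy.1, ha, hlo.trans_lt hy.1, hy.2.trans_le hc⟩
  have ev : ∀ y ∈ Ioo lo hi, ∀ᶠ z in 𝓝 y, 0 ≤ a ∧ a < z ∧ z < c := fun y hy => by
    filter_upwards [isOpen_Ioo.mem_nhds hy] with z hz using (ord z hz).2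
  have dV : ∀ y ∈ Ioo lo hi, HasDerivAt (fun y => whithamV2 a y c)
      (edgeVelocitySlope (wSq a y c) (y ^ 2) (a ^ 2) (c ^ 2) * (2 * y)) y := fun y hy => by
    obtain ⟨-, o1, o2, o3⟩ := ord y hy
    have dW := (hasDerivAt_wSq (a := fun _ => a) (b := fun y => y) (c := fun _ => c) o1 o2 o3
      (hasDerivAt_const y a) (hasDerivAt_id y) (hasDerivAt_const y c)).congr_deriv
      (show _ = wSqSlope (wSq a y c) (y ^ 2) (a ^ 2) (c ^ 2) * (2 * y) by ring)
    have s1 := sq_lt_sq_of_nonneg o1 o2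
    have s2 := sq_lt_sq_of_nonneg (o1.trans o2.le) o3
    refine (hasDerivAt_edgeVelocity (W := fun y => wSq a y c) s1.ne' s2.ne
      (wSq_lt o1 o2 o3).ne' dW).congr_of_eventuallyEq ?_
    filter_upwards [ev y hy] with z hz using whithamV2_eq hz.1 hz.2.1 hz.2.2
  refine ⟨hlt, dV, fun y hy => ?_, tl, tr, hL, hR, fun y hy => ?_, fun y hy => ?_,
    fun y hy η hη he => ?_, fun η hη hpos _ => ?_, hleft, hright⟩
  · obtain ⟨o0, o1, o2, o3⟩ := ord y hy
    exact mul_pos (edgeVelocitySlope_pos_two o1 o2 o3) (by linarith)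
  · obtain ⟨-, o1, o2, o3⟩ := ord y hy
    exact isEquilibrium_genus1 o1 o2 o3
  · rintro η (h | h | h)
    · exact Or.inl (hed (Or.inl h))
    · exact Or.inr h
    · exact Or.inl (hed (Or.inr h))
  · obtain ⟨p, q, r, d1, d2⟩ := hasDerivAt_dos_flux_genus1 (a := fun _ => a) (b := fun y => y)
      (c := fun _ => c) (ev y hy) (hasDerivAt_const y a) (hasDerivAt_id y) (hasDerivAt_const y c)
      hη he
    exact ⟨q, d1.congr_deriv (by ring), d2.congr_deriv (by ring)⟩
  · refine continuousAt_of_abs_le_sqrt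
      (k := fun y => η * (12 * (η ^ 2 + y ^ 2 - (y ^ 2 + a ^ 2 + c ^ 2) / 2) - whithamV2 a y c))
      (D := Real.pi * Real.sqrt (|η ^ 2 - a ^ 2| * |η ^ 2 - c ^ 2|))
      (continuousAt_const.mul ((by fun_prop : ContinuousAt (fun y : ℝ =>
        12 * (η ^ 2 + y ^ 2 - (y ^ 2 + a ^ 2 + c ^ 2) / 2)) η).sub (dV η hη).continuousAt)) ?_
    filter_upwards [ev η hη] with y hy
    refine abs_flux_sub_dos_le hy.1 hy.2.1 hy.2.2 hpos
      (by linarith [wSq_lt hy.1 hy.2.1 hy.2.2]) (whithamV2_eq hy.1 hy.2.1 hy.2.2) (by ring)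
      (by ring) ?_
    rw [abs_mul, abs_mul, abs_sub_comm (c ^ 2)]
    ring

theorem isSimpleWave_three (ha : 0 ≤ a) (hab : a < b) (hlo : b ≤ lo) (hlt : lo < hi)
    (tl : Tendsto (fun y => whithamV3 a b y) (𝓝[>] lo) (𝓝 sL))
    (tr : Tendsto (fun y => whithamV3 a b y) (𝓝[<] hi) (𝓝 sR))
    (hL : L.IsEquilibrium) (hR : R.IsEquilibrium) (hed : {a, b} ⊆ L.edges ∪ R.edges)
    (hleft : ∀ η, 0 < η → η ∉ L.edges ∪ R.edges →
      Tendsto (fun y => (genus1 a b y).dos η) (𝓝[>] lo) (𝓝 (L.dos η)) ∧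
      Tendsto (fun y => (genus1 a b y).flux η) (𝓝[>] lo) (𝓝 (L.flux η)))
    (hright : ∀ η, 0 < η → η ∉ L.edges ∪ R.edges →
      Tendsto (fun y => (genus1 a b y).dos η) (𝓝[<] hi) (𝓝 (R.dos η)) ∧
      Tendsto (fun y => (genus1 a b y).flux η) (𝓝[<] hi) (𝓝 (R.flux η))) :
    IsSimpleWave (fun y => genus1 a b y) L R (fun y => whithamV3 a b y)
      (fun y => edgeVelocitySlope (wSq a b y) (y ^ 2) (a ^ 2) (b ^ 2) * (2 * y)) lo hi sL sR := by
  have ord : ∀ y ∈ Ioo lo hi, 0 < y ∧ 0 ≤ a ∧ a < b ∧ b < y := fun y hy =>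
    ⟨((ha.trans hab.le).trans hlo).trans_lt hy.1, ha, hab, hlo.trans_lt hy.1⟩
  have ev : ∀ y ∈ Ioo lo hi, ∀ᶠ z in 𝓝 y, 0 ≤ a ∧ a < b ∧ b < z := fun y hy => by
    filter_upwards [isOpen_Ioo.mem_nhds hy] with z hz using (ord z hz).2
  have dV : ∀ y ∈ Ioo lo hi, HasDerivAt (fun y => whithamV3 a b y)
      (edgeVelocitySlope (wSq a b y) (y ^ 2) (a ^ 2) (b ^ 2) * (2 * y)) y := fun y hy => by
    obtain ⟨-, o1, o2, o3⟩ := ord y hy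
    have dW := (hasDerivAt_wSq (a := fun _ => a) (b := fun _ => b) (c := fun y => y) o1 o2 o3
      (hasDerivAt_const y a) (hasDerivAt_const y b) (hasDerivAt_id y)).congr_deriv
      (show _ = wSqSlope (wSq a b y) (y ^ 2) (a ^ 2) (b ^ 2) * (2 * y) by ring)
    have s1 := sq_lt_sq_of_nonneg o1 o2
    have s2 := sq_lt_sq_of_nonneg (o1.trans o2.le) o3
    refine (hasDerivAt_edgeVelocity (W := fun y => wSq a b y) (s1.trans s2).ne' s2.ne'
      ((wSq_lt o1 o2 o3).trans s2).ne' dW).congr_of_eventuallyEq ?_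
    filter_upwards [ev y hy] with z hz using whithamV3_eq hz.1 hz.2.1 hz.2.2
  refine ⟨hlt, dV, fun y hy => ?_, tl, tr, hL, hR, fun y hy => ?_, fun y hy => ?_,
    fun y hy η hη he => ?_, fun η hη hpos _ => ?_, hleft, hright⟩
  · obtain ⟨o0, o1, o2, o3⟩ := ord y hy
    exact mul_pos (edgeVelocitySlope_pos_three o1 o2 o3) (by linarith)
  · obtain ⟨-, o1, o2, o3⟩ := ord y hy
    exact isEquilibrium_genus1 o1 o2 o3
  · rintro η (h | h | h)
    · exact Or.inl (hed (Or.inl h))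
    · exact Or.inl (hed (Or.inr h))
    · exact Or.inr h
  · obtain ⟨p, q, r, d1, d2⟩ := hasDerivAt_dos_flux_genus1 (a := fun _ => a) (b := fun _ => b)
      (c := fun y => y) (ev y hy) (hasDerivAt_const y a) (hasDerivAt_const y b) (hasDerivAt_id y)
      hη he
    exact ⟨r, d1.congr_deriv (by ring), d2.congr_deriv (by ring)⟩
  · refine continuousAt_of_abs_le_sqrt
      (k := fun y => η * (12 * (η ^ 2 + y ^ 2 - (y ^ 2 + a ^ 2 + b ^ 2) / 2) - whithamV3 a b y))
      (D := Real.pi * Real.sqrt (|η ^ 2 - a ^ 2| * |η ^ 2 - b ^ 2|))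
      (continuousAt_const.mul ((by fun_prop : ContinuousAt (fun y : ℝ =>
        12 * (η ^ 2 + y ^ 2 - (y ^ 2 + a ^ 2 + b ^ 2) / 2)) η).sub (dV η hη).continuousAt)) ?_
    filter_upwards [ev η hη] with y hy
    refine abs_flux_sub_dos_le hy.1 hy.2.1 hy.2.2 hpos
      (by linarith [wSq_lt hy.1 hy.2.1 hy.2.2, sq_lt_sq_of_nonneg (hy.1.trans hy.2.1.le) hy.2.2])
      (whithamV3_eq hy.1 hy.2.1 hy.2.2) (by ring) (by ring) ?_
    rw [abs_mul, abs_mul, abs_sub_comm (y ^ 2)]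
    ring

end Moving

end Condensate

/-! ### Continuity of the Whitham velocities at a genuine genus 1 state -/

section NondegenerateLimits

variable {ι : Type*} {l : Filter ι} {a b c : ι → ℝ} {a₀ b₀ c₀ : ℝ}
  (ho : ∀ᶠ i in l, 0 ≤ a i ∧ a i < b i ∧ b i < c i) (ha : 0 ≤ a₀) (hab : a₀ < b₀) (hbc : b₀ < c₀)
  (ta : Tendsto a l (𝓝 a₀)) (tb : Tendsto b l (𝓝 b₀)) (tc : Tendsto c l (𝓝 c₀))
include ho ha hab hbc ta tb tc

theorem tendsto_whithamV1 :
    Tendsto (fun i => whithamV1 (a i) (b i) (c i)) l (𝓝 (whithamV1 a₀ b₀ c₀)) := by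
  rw [whithamV1_eq ha hab hbc]
  refine (tendsto_edgeVelocity (lt_wSq ha hab hbc).ne (tendsto_wSq ha hab hbc ta tb tc)
    (ta.pow 2) (tb.pow 2) (tc.pow 2)).congr' ?_
  filter_upwards [ho] with i hi using (whithamV1_eq hi.1 hi.2.1 hi.2.2).symm

theorem tendsto_whithamV2 :
    Tendsto (fun i => whithamV2 (a i) (b i) (c i)) l (𝓝 (whithamV2 a₀ b₀ c₀)) := by
  rw [whithamV2_eq ha hab hbc]
  refine (tendsto_edgeVelocity (wSq_lt ha hab hbc).ne' (tendsto_wSq ha hab hbc ta tb tc)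
    (tb.pow 2) (ta.pow 2) (tc.pow 2)).congr' ?_
  filter_upwards [ho] with i hi using (whithamV2_eq hi.1 hi.2.1 hi.2.2).symm

theorem tendsto_whithamV3 :
    Tendsto (fun i => whithamV3 (a i) (b i) (c i)) l (𝓝 (whithamV3 a₀ b₀ c₀)) := by
  rw [whithamV3_eq ha hab hbc]
  refine (tendsto_edgeVelocity ((wSq_lt ha hab hbc).trans
    (sq_lt_sq_of_nonneg (ha.trans hab.le) hbc)).ne' (tendsto_wSq ha hab hbc ta tb tc)
    (tc.pow 2) (ta.pow 2) (tb.pow 2)).congr' ?_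
  filter_upwards [ho] with i hi using (whithamV3_eq hi.1 hi.2.1 hi.2.2).symm

end NondegenerateLimits

/-! ### The rarefaction wave -/

theorem rarefaction_eq {qm qp x t : ℝ} (ht : 0 < t) : rarefaction qm qp x t =
    if x / t ≤ 6 * qm ^ 2 then qm else if x / t < 6 * qp ^ 2 then Real.sqrt (x / t / 6) else qp := by
  simp only [rarefaction, div_le_iff₀ ht, div_lt_iff₀ ht, div_div, mul_comm t]

/-- As a clamp of a continuous function, the profile is visibly continuous at the wave edges. -/
theorem rarefaction_eq_max_min {qm qp x t : ℝ} (h0 : 0 ≤ qm) (h : qm < qp) (ht : 0 < t) :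
    rarefaction qm qp x t = max qm (min qp (Real.sqrt (x / t / 6))) := by
  rw [rarefaction_eq ht]
  have hp := h0.trans h.le
  split_ifs with h1 h2
  · rw [max_eq_left]
    refine (min_le_right _ _).trans ?_
    rw [← Real.sqrt_sq h0]
    exact Real.sqrt_le_sqrt (by linarith)
  · rw [min_eq_right, max_eq_right]
    · rw [← Real.sqrt_sq h0]
      exact Real.sqrt_le_sqrt (by linarith)
    · rw [← Real.sqrt_sq hp]
      exact Real.sqrt_le_sqrt (by linarith)
  · rw [min_eq_left, max_eq_right h.le]
    rw [← Real.sqrt_sq hp]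
    exact Real.sqrt_le_sqrt (by linarith)

theorem continuous_rarefaction {qm qp t : ℝ} (h0 : 0 ≤ qm) (h : qm < qp) (ht : 0 < t) :
    Continuous fun x => rarefaction qm qp x t := by
  simp only [rarefaction_eq_max_min h0 h ht]
  fun_prop

theorem transportAt_rarefaction {qm qp x t : ℝ} (h : qm < qp) (h0 : 0 ≤ qm) (ht : 0 < t)
    (h1 : x ≠ 6 * qm ^ 2 * t) (h2 : x ≠ 6 * qp ^ 2 * t) :
    TransportAt (rarefaction qm qp) (6 * rarefaction qm qp x t ^ 2) x t := by
  have hs : 6 * qm ^ 2 < 6 * qp ^ 2 := by linarith [sq_lt_sq_of_nonneg h0 h]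
  have n1 : x / t ≠ 6 * qm ^ 2 := fun h => h1 (by rw [← h]; field_simp)
  have n2 : x / t ≠ 6 * qp ^ 2 := fun h => h2 (by rw [← h]; field_simp)
  set ρ : ℝ → ℝ := fun ξ =>
    if ξ ≤ 6 * qm ^ 2 then qm else if ξ < 6 * qp ^ 2 then Real.sqrt (ξ / 6) else qp with hl
  have key : ∃ d, HasDerivAt ρ d (x / t) ∧ 6 * ρ (x / t) ^ 2 * d = x / t * d := by
    rcases n1.lt_or_gt with n1 | n1
    · refine ⟨0, (hasDerivAt_const _ qm).congr_of_eventuallyEq ?_, by ring⟩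
      filter_upwards [gt_mem_nhds n1] with z hz using if_pos (le_of_lt hz)
    rcases n2.lt_or_gt with n2 | n2
    · have hpos : 0 < x / t / 6 := by
        have := sq_nonneg qm
        linarith
      have d0 : HasDerivAt (fun ξ : ℝ => ξ / 6) (1 / 6) (x / t) := (hasDerivAt_id _).div_const 6
      refine ⟨_, (d0.sqrt hpos.ne').congr_of_eventuallyEq ?_, ?_⟩
      · filter_upwards [lt_mem_nhds n1, gt_mem_nhds n2] with z hz1 hz2
        simp only [hl, if_neg (not_le.2 hz1), if_pos hz2]
      · simp only [hl, if_neg (not_le.2 n1), if_pos n2]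
        rw [Real.sq_sqrt hpos.le, mul_div_cancel₀ _ (by norm_num : (6 : ℝ) ≠ 0)]
    · refine ⟨0, (hasDerivAt_const _ qp).congr_of_eventuallyEq ?_, by ring⟩
      filter_upwards [lt_mem_nhds n2] with z hz
      simp only [hl, if_neg (not_le.2 (hs.trans hz)), if_neg (not_lt.2 hz.le)]
  obtain ⟨d, d1, d2⟩ := key
  refine ⟨_, _, (hasDerivAt_similarity_time ht.ne' d1).congr_of_eventuallyEq ?_,
    (hasDerivAt_similarity_space d1).congr_of_eventuallyEq
      (Eventually.of_forall fun y => rarefaction_eq ht), ?_⟩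
  · filter_upwards [lt_mem_nhds ht] with τ hτ using rarefaction_eq hτ
  · rw [rarefaction_eq ht]
    change -(d * x / t ^ 2) + 6 * ρ (x / t) ^ 2 * (d / t) = 0
    rw [← mul_div_assoc, d2]
    field_simp
    ring

theorem solvesRiemannProblem_rarefaction {qm qp : ℝ} (h0 : 0 ≤ qm) (h : qm < qp) :
    SolvesRiemannProblem (.genus0 qm) (.genus0 qp) (6 * qm ^ 2) (6 * qp ^ 2)
      (fun x t => .genus0 (rarefaction qm qp x t)) := by
  obtain ⟨ℓ, hp, -, hr⟩ := (Condensate.isSimpleWave_genus0 h0 h).exists_profile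
  -- The abstract profile satisfies 6ℓ² = ξ with ℓ positive, so it is the explicit square root. The
  -- two modulated states must agree for every t, and the middle branch can occur only for t > 0.
  convert hr using 3 with x t
  have hq := sq_lt_sq_of_nonneg h0 h
  simp only [rarefaction, centeredWave]
  split_ifs with h1 h2
  · rfl
  · have ht : 0 < t := by
      by_contra ht
      nlinarith
    have hξ : x / t ∈ Ioo (6 * qm ^ 2) (6 * qp ^ 2) :=
      ⟨(lt_div_iff₀ ht).2 (not_le.1 h1), (div_lt_iff₀ ht).2 h2⟩
    have e : x / (6 * t) = ℓ (x / t) ^ 2 := by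
      have := hp.eq _ hξ
      rw [mul_comm, ← div_div]
      linarith
    rw [e, Real.sqrt_sq (h0.trans (hp.mem _ hξ).1.le)]
  · rfl

/-! ### The five genus 1 waves -/

open Condensate in
-- At the left end the gap closes, so the two lower edges merge and drop out and the edge `qm`
-- remains. At the right end the upper band collapses and `qp` remains. Each wave below has one
-- degenerate end of these two kinds, while its other end is an ordinary genus 1 state reached by
-- continuity.
theorem isSimpleWave_dsw {qm qp : ℝ} (h0 : 0 ≤ qp) (h : qp < qm) :
    IsSimpleWave (fun y => genus1 qp y qm) (genus0 qm) (genus0 qp) (fun y => whithamV2 qp y qm)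
      (fun y => edgeVelocitySlope (wSq qp y qm) (y ^ 2) (qp ^ 2) (qm ^ 2) * (2 * y)) qp qm
      (12 * qp ^ 2 - 6 * qm ^ 2) (2 * qp ^ 2 + 4 * qm ^ 2) := by
  have oL : ∀ᶠ y in 𝓝[>] qp, 0 ≤ qp ∧ qp < y ∧ y < qm := by
    filter_upwards [Ioo_mem_nhdsGT h] with y hy using ⟨h0, hy.1, hy.2⟩
  have oR : ∀ᶠ y in 𝓝[<] qm, 0 ≤ qp ∧ qp < y ∧ y < qm := by
    filter_upwards [Ioo_mem_nhdsLT h] with y hy using ⟨h0, hy.1, hy.2⟩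
  have tL : Tendsto (fun y : ℝ => y) (𝓝[>] qp) (𝓝 qp) := tendsto_id.mono_left nhdsWithin_le_nhds
  have tR : Tendsto (fun y : ℝ => y) (𝓝[<] qm) (𝓝 qm) := tendsto_id.mono_left nhdsWithin_le_nhds
  refine isSimpleWave_two h0 le_rfl h le_rfl
    (tendsto_whithamV2_of_lower_gap oL h0 h tendsto_const_nhds tL tendsto_const_nhds)
    (tendsto_whithamV2_of_upper_band oR h0 h tendsto_const_nhds tR tendsto_const_nhds)
    (isEquilibrium_genus0 (h0.trans h.le)) (isEquilibrium_genus0 h0) ?_ (fun η hη he => ?_)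
    fun η hη he => ?_
  · simp [edges]
  · simp only [edges, mem_union, mem_singleton_iff, not_or] at he
    exact tendsto_dos_flux_of_lower_gap oL hη tendsto_const_nhds tendsto_const_nhds tL h0 h he.2 he.1
  · simp only [edges, mem_union, mem_singleton_iff, not_or] at he
    exact tendsto_dos_flux_of_upper_band oR hη tendsto_const_nhds tR tendsto_const_nhds h0 h he.2 he.1

open Condensate in
theorem isSimpleWave_three_plus {qm l2 l3 : ℝ} (h0 : 0 ≤ qm) (h1 : qm < l2) (h2 : l2 < l3) :
    IsSimpleWave (fun y => genus1 qm l2 y) (genus0 qm) (genus1 qm l2 l3)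
      (fun y => whithamV3 qm l2 y)
      (fun y => edgeVelocitySlope (wSq qm l2 y) (y ^ 2) (qm ^ 2) (l2 ^ 2) * (2 * y)) l2 l3
      (2 * qm ^ 2 + 4 * l2 ^ 2) (whithamV3 qm l2 l3) := by
  have oL : ∀ᶠ y in 𝓝[>] l2, 0 ≤ qm ∧ qm < l2 ∧ l2 < y := by
    filter_upwards [self_mem_nhdsWithin] with y hy using ⟨h0, h1, hy⟩
  have oR : ∀ᶠ y in 𝓝[<] l3, 0 ≤ qm ∧ qm < l2 ∧ l2 < y := by
    filter_upwards [Ioo_mem_nhdsLT h2] with y hy using ⟨h0, h1, hy.1⟩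
  have tL : Tendsto (fun y : ℝ => y) (𝓝[>] l2) (𝓝 l2) := tendsto_id.mono_left nhdsWithin_le_nhds
  have tR : Tendsto (fun y : ℝ => y) (𝓝[<] l3) (𝓝 l3) := tendsto_id.mono_left nhdsWithin_le_nhds
  refine isSimpleWave_three h0 h1 le_rfl h2
    (tendsto_whithamV3_of_upper_band oL h0 h1 tendsto_const_nhds tendsto_const_nhds tL)
    (tendsto_whithamV3 oR h0 h1 h2 tendsto_const_nhds tendsto_const_nhds tR)
    (isEquilibrium_genus0 h0) (isEquilibrium_genus1 h0 h1 h2) ?_ (fun η hη he => ?_)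
    fun η hη he => ?_
  · simp [insert_subset_iff, edges]
  · simp only [edges, mem_union, mem_insert_iff, mem_singleton_iff, not_or] at he
    exact tendsto_dos_flux_of_upper_band oL hη tendsto_const_nhds tendsto_const_nhds tL h0 h1
      he.1 he.2.2.1
  · exact tendsto_dos_flux_genus1 oR hη tendsto_const_nhds tendsto_const_nhds tR h0 h1 h2
      fun h => he (Or.inr h)

open Condensate in
theorem isSimpleWave_two_plus {l1 l2 qm : ℝ} (h0 : 0 ≤ l1) (h1 : l1 < l2) (h2 : l2 < qm) :
    IsSimpleWave (fun y => genus1 l1 y qm) (genus0 qm) (genus1 l1 l2 qm)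
      (fun y => whithamV2 l1 y qm)
      (fun y => edgeVelocitySlope (wSq l1 y qm) (y ^ 2) (l1 ^ 2) (qm ^ 2) * (2 * y)) l1 l2
      (12 * l1 ^ 2 - 6 * qm ^ 2) (whithamV2 l1 l2 qm) := by
  have oL : ∀ᶠ y in 𝓝[>] l1, 0 ≤ l1 ∧ l1 < y ∧ y < qm := by
    filter_upwards [Ioo_mem_nhdsGT h1] with y hy using ⟨h0, hy.1, hy.2.trans h2⟩
  have oR : ∀ᶠ y in 𝓝[<] l2, 0 ≤ l1 ∧ l1 < y ∧ y < qm := by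
    filter_upwards [Ioo_mem_nhdsLT h1] with y hy using ⟨h0, hy.1, hy.2.trans h2⟩
  have tL : Tendsto (fun y : ℝ => y) (𝓝[>] l1) (𝓝 l1) := tendsto_id.mono_left nhdsWithin_le_nhds
  have tR : Tendsto (fun y : ℝ => y) (𝓝[<] l2) (𝓝 l2) := tendsto_id.mono_left nhdsWithin_le_nhds
  refine isSimpleWave_two h0 le_rfl h1 h2.le
    (tendsto_whithamV2_of_lower_gap oL h0 (h1.trans h2) tendsto_const_nhds tL tendsto_const_nhds)
    (tendsto_whithamV2 oR h0 h1 h2 tendsto_const_nhds tR tendsto_const_nhds)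
    (isEquilibrium_genus0 ((h0.trans h1.le).trans h2.le)) (isEquilibrium_genus1 h0 h1 h2) ?_
    (fun η hη he => ?_) fun η hη he => ?_
  · simp [insert_subset_iff, edges]
  · simp only [edges, mem_union, mem_insert_iff, mem_singleton_iff, not_or] at he
    exact tendsto_dos_flux_of_lower_gap oL hη tendsto_const_nhds tendsto_const_nhds tL h0
      (h1.trans h2) he.2.1 he.1
  · exact tendsto_dos_flux_genus1 oR hη tendsto_const_nhds tR tendsto_const_nhds h0 h1 h2
      fun h => he (Or.inr h)

open Condensate in
theorem isSimpleWave_one_minus {l1 l2 qp : ℝ} (h0 : 0 ≤ l1) (h1 : l1 < l2) (h2 : l2 < qp) :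
    IsSimpleWave (fun y => genus1 y l2 qp) (genus1 l1 l2 qp) (genus0 qp)
      (fun y => whithamV1 y l2 qp)
      (fun y => edgeVelocitySlope (wSq y l2 qp) (y ^ 2) (l2 ^ 2) (qp ^ 2) * (2 * y)) l1 l2
      (whithamV1 l1 l2 qp) (12 * l2 ^ 2 - 6 * qp ^ 2) := by
  have oL : ∀ᶠ y in 𝓝[>] l1, 0 ≤ y ∧ y < l2 ∧ l2 < qp := by
    filter_upwards [Ioo_mem_nhdsGT h1] with y hy using ⟨h0.trans hy.1.le, hy.2, h2⟩
  have oR : ∀ᶠ y in 𝓝[<] l2, 0 ≤ y ∧ y < l2 ∧ l2 < qp := by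
    filter_upwards [Ioo_mem_nhdsLT h1] with y hy using ⟨h0.trans hy.1.le, hy.2, h2⟩
  have tL : Tendsto (fun y : ℝ => y) (𝓝[>] l1) (𝓝 l1) := tendsto_id.mono_left nhdsWithin_le_nhds
  have tR : Tendsto (fun y : ℝ => y) (𝓝[<] l2) (𝓝 l2) := tendsto_id.mono_left nhdsWithin_le_nhds
  refine isSimpleWave_one h0 h1 le_rfl h2
    (tendsto_whithamV1 oL h0 h1 h2 tL tendsto_const_nhds tendsto_const_nhds)
    (tendsto_whithamV1_of_lower_gap oR (h0.trans h1.le) h2 tR tendsto_const_nhds tendsto_const_nhds)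
    (isEquilibrium_genus1 h0 h1 h2) (isEquilibrium_genus0 ((h0.trans h1.le).trans h2.le)) ?_
    (fun η hη he => ?_) fun η hη he => ?_
  · simp [edges]
  · exact tendsto_dos_flux_genus1 oL hη tL tendsto_const_nhds tendsto_const_nhds h0 h1 h2
      fun h => he (Or.inl h)
  · simp only [edges, mem_union, mem_insert_iff, mem_singleton_iff, not_or] at he
    exact tendsto_dos_flux_of_lower_gap oR hη tR tendsto_const_nhds tendsto_const_nhds
      (h0.trans h1.le) h2 he.1.2.1 he.2

open Condensate in
theorem isSimpleWave_two_minus {qp l2 l3 : ℝ} (h0 : 0 ≤ qp) (h1 : qp < l2) (h2 : l2 < l3) :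
    IsSimpleWave (fun y => genus1 qp y l3) (genus1 qp l2 l3) (genus0 qp)
      (fun y => whithamV2 qp y l3)
      (fun y => edgeVelocitySlope (wSq qp y l3) (y ^ 2) (qp ^ 2) (l3 ^ 2) * (2 * y)) l2 l3
      (whithamV2 qp l2 l3) (2 * qp ^ 2 + 4 * l3 ^ 2) := by
  have oL : ∀ᶠ y in 𝓝[>] l2, 0 ≤ qp ∧ qp < y ∧ y < l3 := by
    filter_upwards [Ioo_mem_nhdsGT h2] with y hy using ⟨h0, h1.trans hy.1, hy.2⟩
  have oR : ∀ᶠ y in 𝓝[<] l3, 0 ≤ qp ∧ qp < y ∧ y < l3 := by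
    filter_upwards [Ioo_mem_nhdsLT h2] with y hy using ⟨h0, h1.trans hy.1, hy.2⟩
  have tL : Tendsto (fun y : ℝ => y) (𝓝[>] l2) (𝓝 l2) := tendsto_id.mono_left nhdsWithin_le_nhds
  have tR : Tendsto (fun y : ℝ => y) (𝓝[<] l3) (𝓝 l3) := tendsto_id.mono_left nhdsWithin_le_nhds
  refine isSimpleWave_two h0 h1.le h2 le_rfl
    (tendsto_whithamV2 oL h0 h1 h2 tendsto_const_nhds tL tendsto_const_nhds)
    (tendsto_whithamV2_of_upper_band oR h0 (h1.trans h2) tendsto_const_nhds tR tendsto_const_nhds)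
    (isEquilibrium_genus1 h0 h1 h2) (isEquilibrium_genus0 h0) ?_ (fun η hη he => ?_)
    fun η hη he => ?_
  · simp [insert_subset_iff, edges]
  · exact tendsto_dos_flux_genus1 oL hη tendsto_const_nhds tL tendsto_const_nhds h0 h1 h2
      fun h => he (Or.inl h)
  · simp only [edges, mem_union, mem_insert_iff, mem_singleton_iff, not_or] at he
    exact tendsto_dos_flux_of_upper_band oR hη tendsto_const_nhds tR tendsto_const_nhds h0
      (h1.trans h2) he.2 he.1.2.2

/-! ### Assembly: fixed edges satisfy their Whitham equations trivially, the moving one by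
self-similarity -/

theorem mainTheorem6 :
    -- the Whitham characteristic velocities in genus 1
    (∀ a b c : ℝ, 0 ≤ a → a < b → b < c →
      whithamV1 a b c = 2 * (a ^ 2 + b ^ 2 + c ^ 2)
        + 4 * (b ^ 2 - a ^ 2) / (muRatio a b c - 1) ∧
      whithamV2 a b c = 2 * (a ^ 2 + b ^ 2 + c ^ 2)
        + 4 * (c ^ 2 - b ^ 2) * (b ^ 2 - a ^ 2)
          / (c ^ 2 - b ^ 2 - (c ^ 2 - a ^ 2) * muRatio a b c) ∧
      whithamV3 a b c = 2 * (a ^ 2 + b ^ 2 + c ^ 2)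
        + 4 * (c ^ 2 - b ^ 2) / muRatio a b c) ∧
    -- genus 0 rarefaction wave
    (∀ qm qp : ℝ, 0 ≤ qm → qm < qp →
      (∀ t, 0 < t → Continuous fun x => rarefaction qm qp x t) ∧
      (∀ x t, 0 < t → x ≠ 6 * qm ^ 2 * t → x ≠ 6 * qp ^ 2 * t →
        TransportAt (rarefaction qm qp) (6 * rarefaction qm qp x t ^ 2) x t) ∧
      SolvesRiemannProblem (.genus0 qm) (.genus0 qp) (6 * qm ^ 2) (6 * qp ^ 2)
        (fun x t => .genus0 (rarefaction qm qp x t))) ∧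
    -- dispersive shock wave
    (∀ qm qp : ℝ, 0 ≤ qp → qp < qm → ∀ sL sR : ℝ,
      sL = 12 * qp ^ 2 - 6 * qm ^ 2 → sR = 2 * qp ^ 2 + 4 * qm ^ 2 →
      ∃ ℓ : ℝ → ℝ,
        IsWaveProfile (fun y => whithamV2 qp y qm) qp qm sL sR ℓ ∧
        (∀ x t, 0 < t → sL * t < x → x < sR * t →
          Whitham1At (fun _ _ => qp) (fun y τ => ℓ (y / τ)) (fun _ _ => qm) x t) ∧
        SolvesRiemannProblem (.genus0 qm) (.genus0 qp) sL sR
          (centeredWave (.genus0 qm) (fun ξ => .genus1 qp (ℓ ξ) qm) (.genus0 qp) sL sR)) ∧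
    -- 3⁺-wave
    (∀ qm l2 l3 : ℝ, 0 ≤ qm → qm < l2 → l2 < l3 → ∀ sL sR : ℝ,
      sL = 2 * qm ^ 2 + 4 * l2 ^ 2 → sR = whithamV3 qm l2 l3 →
      ∃ ℓ : ℝ → ℝ,
        IsWaveProfile (fun y => whithamV3 qm l2 y) l2 l3 sL sR ℓ ∧
        (∀ x t, 0 < t → sL * t < x → x < sR * t →
          Whitham1At (fun _ _ => qm) (fun _ _ => l2) (fun y τ => ℓ (y / τ)) x t) ∧
        SolvesRiemannProblem (.genus0 qm) (.genus1 qm l2 l3) sL sR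
          (centeredWave (.genus0 qm) (fun ξ => .genus1 qm l2 (ℓ ξ)) (.genus1 qm l2 l3) sL sR)) ∧
    -- 2⁺-wave
    (∀ l1 l2 qm : ℝ, 0 ≤ l1 → l1 < l2 → l2 < qm → ∀ sL sR : ℝ,
      sL = 12 * l1 ^ 2 - 6 * qm ^ 2 → sR = whithamV2 l1 l2 qm →
      ∃ ℓ : ℝ → ℝ,
        IsWaveProfile (fun y => whithamV2 l1 y qm) l1 l2 sL sR ℓ ∧
        (∀ x t, 0 < t → sL * t < x → x < sR * t →
          Whitham1At (fun _ _ => l1) (fun y τ => ℓ (y / τ)) (fun _ _ => qm) x t) ∧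
        SolvesRiemannProblem (.genus0 qm) (.genus1 l1 l2 qm) sL sR
          (centeredWave (.genus0 qm) (fun ξ => .genus1 l1 (ℓ ξ) qm) (.genus1 l1 l2 qm) sL sR)) ∧
    -- 1⁻-wave
    (∀ l1 l2 qp : ℝ, 0 ≤ l1 → l1 < l2 → l2 < qp → ∀ sL sR : ℝ,
      sL = whithamV1 l1 l2 qp → sR = 12 * l2 ^ 2 - 6 * qp ^ 2 →
      ∃ ℓ : ℝ → ℝ,
        IsWaveProfile (fun y => whithamV1 y l2 qp) l1 l2 sL sR ℓ ∧
        (∀ x t, 0 < t → sL * t < x → x < sR * t →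
          Whitham1At (fun y τ => ℓ (y / τ)) (fun _ _ => l2) (fun _ _ => qp) x t) ∧
        SolvesRiemannProblem (.genus1 l1 l2 qp) (.genus0 qp) sL sR
          (centeredWave (.genus1 l1 l2 qp) (fun ξ => .genus1 (ℓ ξ) l2 qp) (.genus0 qp) sL sR)) ∧
    -- 2⁻-wave
    (∀ qp l2 l3 : ℝ, 0 ≤ qp → qp < l2 → l2 < l3 → ∀ sL sR : ℝ,
      sL = whithamV2 qp l2 l3 → sR = 2 * qp ^ 2 + 4 * l3 ^ 2 →
      ∃ ℓ : ℝ → ℝ,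
        IsWaveProfile (fun y => whithamV2 qp y l3) l2 l3 sL sR ℓ ∧
        (∀ x t, 0 < t → sL * t < x → x < sR * t →
          Whitham1At (fun _ _ => qp) (fun y τ => ℓ (y / τ)) (fun _ _ => l3) x t) ∧
        SolvesRiemannProblem (.genus1 qp l2 l3) (.genus0 qp) sL sR
          (centeredWave (.genus1 qp l2 l3) (fun ξ => .genus1 qp (ℓ ξ) l3) (.genus0 qp) sL sR)) := by
  refine ⟨fun a b c ha hab hbc => ⟨whithamV1_formula ha hab hbc, whithamV2_formula ha hab hbc,
      whithamV3_formula ha hab hbc⟩,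
    fun qm qp h0 h => ⟨fun t ht => continuous_rarefaction h0 h ht,
      fun x t ht h1 h2 => transportAt_rarefaction h h0 ht h1 h2,
      solvesRiemannProblem_rarefaction h0 h⟩,
    fun qm qp h0 h sL sR hL hR => ?_, fun qm l2 l3 h0 h1 h2 sL sR hL hR => ?_,
    fun l1 l2 qm h0 h1 h2 sL sR hL hR => ?_, fun l1 l2 qp h0 h1 h2 sL sR hL hR => ?_,
    fun qp l2 l3 h0 h1 h2 sL sR hL hR => ?_⟩
  · obtain ⟨ℓ, hp, ht, hr⟩ := (isSimpleWave_dsw h0 h).exists_profile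
    subst hL hR
    exact ⟨ℓ, hp, fun x t h0 h1 h2 => ⟨transportAt_const _ _ _ _, ht x t h0 h1 h2,
      transportAt_const _ _ _ _⟩, hr⟩
  · obtain ⟨ℓ, hp, ht, hr⟩ := (isSimpleWave_three_plus h0 h1 h2).exists_profile
    subst hL hR
    exact ⟨ℓ, hp, fun x t h0 h1 h2 => ⟨transportAt_const _ _ _ _, transportAt_const _ _ _ _,
      ht x t h0 h1 h2⟩, hr⟩
  · obtain ⟨ℓ, hp, ht, hr⟩ := (isSimpleWave_two_plus h0 h1 h2).exists_profile
    subst hL hR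
    exact ⟨ℓ, hp, fun x t h0 h1 h2 => ⟨transportAt_const _ _ _ _, ht x t h0 h1 h2,
      transportAt_const _ _ _ _⟩, hr⟩
  · obtain ⟨ℓ, hp, ht, hr⟩ := (isSimpleWave_one_minus h0 h1 h2).exists_profile
    subst hL hR
    exact ⟨ℓ, hp, fun x t h0 h1 h2 => ⟨ht x t h0 h1 h2, transportAt_const _ _ _ _,
      transportAt_const _ _ _ _⟩, hr⟩
  · obtain ⟨ℓ, hp, ht, hr⟩ := (isSimpleWave_two_minus h0 h1 h2).exists_profile
    subst hL hR
    exact ⟨ℓ, hp, fun x t h0 h1 h2 => ⟨transportAt_const _ _ _ _, ht x t h0 h1 h2,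
      transportAt_const _ _ _ _⟩, hr⟩

end
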